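/- **Theorem.** Let $(\mathcal M,g)$ be a smooth (Hausdorff, finite-dimensional) Riemannian or pseudo-Riemannian manifold, let $p:\widetilde{\mathcal M}\to\mathcal M$ be a surjective smooth covering (a covering map which is a local diffeomorphism), equipped with the pulled back metric $p^*g$, and let $G$ be a Lie group with Lie algebra $\mathfrak g$ acting smoothly on $\widetilde{\mathcal M}$ by isometries, such that $\mathcal M$ is the quotient of $\widetilde{\mathcal M}$ by a subgroup $\Gamma\subseteq G$ (that is, the fibres of $p$ are the $\Gamma$-orbits). Let $\Pi\in\wedge^2\mathfrak g$ be $\mathrm{Ad}_G$-invariant and Poisson (that is, the left-invariant bivector field on $G$ with value $\Pi$ at the identity is a Poisson structure; equivalently $[\Pi,\Pi]=0$). Let $\widetilde\pi$ be the bivector field on $\widetilde{\mathcal M}$ whose value at $x$ is the image of $\Pi$ under $\wedge^2$ of the derivative at $1$ of $a\mapsto a\cdot x$. Then there is a bivector field $\pi$ on $\mathcal M$ with $p_*\widetilde\pi_x=\pi_{p(x)}$ for all $x\in\widetilde{\mathcal M}$; it is a smooth Poisson structure, i.e. $\{f,h\}=\pi(df,dh)$ is a Poisson bracket on smooth functions;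 and it is compatible with $g$ in the following sense. For $1$-forms let $\#\alpha$ be the vector field with $\beta(\#\alpha)=\pi(\alpha,\beta)$, and let $[\alpha,\beta]_\pi=\mathcal L_{\#\alpha}\beta-\mathcal L_{\#\beta}\alpha-d(\pi(\alpha,\beta))$ be the Koszul bracket. A contravariant connection is a biadditive operator $\mathcal D$ on smooth $1$-forms with $\mathcal D_{f\alpha}\beta=f\,\mathcal D_\alpha\beta$ and $\mathcal D_\alpha(f\beta)=f\,\mathcal D_\alpha\beta+(\#\alpha)(f)\,\beta$. The metric contravariant connection is the unique one with $\mathcal D_\alpha\beta-\mathcal D_\beta\alpha=[\alpha,\beta]_\pi$ and $(\#\alpha)\langle\beta,\gamma\rangle=\langle\mathcal D_\alpha\beta,\gamma\rangle+\langle\beta,\mathcal D_\alpha\gamma\rangle$, where $\langle\cdot,\cdot\rangle$ is the metric induced by $g$ on covectors. Compatibility means: 1. the metric contravariant connection $\mathcal D$ exists and is flat: $\mathcal D_\alpha\mathcal D_\beta-\mathcal D_\beta\mathcal D_\alpha-\mathcal D_{[\alpha,\beta]_\pi}=0$; 2. its metacurvature vanishes: extending $\mathcal D$ to $2$-forms as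 a derivation of the wedge product and putting $\{f,\sigma\}=\mathcal D_{df}\sigma$ for forms $\sigma$ of degree one and two, the bracket $\{\alpha,\beta\}=\{\beta,\alpha\}$ of $1$-forms with values in $2$-forms, determined by additivity, $\{f\alpha,\beta\}=f\{\alpha,\beta\}+\alpha\wedge\{f,\beta\}$ and $d\{f,\beta\}=\{df,\beta\}+\{f,d\beta\}$, exists, and $$M(df,\beta,\gamma)=\{f,\{\beta,\gamma\}\}-\{\{f,\beta\},\gamma\}-\{\{f,\gamma\},\beta\}=0$$ for all smooth functions $f$ and smooth $1$-forms $\beta,\gamma$; 3. $d(\pi\lrcorner\epsilon)=0$ for every local Riemannian volume form $\epsilon$ of $g$ (value $\pm1$ on orthonormal frames), where $(X\wedge Y)\lrcorner\epsilon=\epsilon(X,Y,\dots)$. -/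

import Mathlib

open scoped Manifold ContDiff Topology

noncomputable section

/-! ### Linear algebra of bivectors -/

section LinearAlgebra

variable {V : Type*} [NormedAddCommGroup V] [NormedSpace ℝ V]
  {N : Type*} [AddCommGroup N] [Module ℝ N]

/-- An alternating bilinear map, as an alternating map of two variables. -/
def altOfBilin (B : V →ₗ[ℝ] V →ₗ[ℝ] N) (hB : ∀ v, B v v = 0) : V [⋀^Fin 2]→ₗ[ℝ] N where
  toFun v := B (v 0) (v 1)
  map_update_add' v i x y := by fin_cases i <;> simp
  map_update_smul' v i c x := by fin_cases i <;> simp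
  map_eq_zero_of_eq' v i j hv hij := by
    have h01 : v 0 = v 1 := by
      fin_cases i <;> fin_cases j <;> simp_all
    simp [h01, hB]

/-- The linear map `∧²V → N` with `u ∧ v ↦ B u v`, for an alternating bilinear map `B`. -/
def bivectorLift (B : V →ₗ[ℝ] V →ₗ[ℝ] N) (hB : ∀ v, B v v = 0) : ⋀[ℝ]^2 V →ₗ[ℝ] N :=
  exteriorPower.alternatingMapLinearEquiv (altOfBilin B hB)

theorem bivectorLift_ιMulti (B : V →ₗ[ℝ] V →ₗ[ℝ] N) (hB : ∀ v, B v v = 0) (v : Fin 2 → V) :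
    bivectorLift B hB (exteriorPower.ιMulti ℝ 2 v) = B (v 0) (v 1) := by
  simp only [bivectorLift, exteriorPower.alternatingMapLinearEquiv_apply_ιMulti]
  rfl

/-- The wedge product of two covectors, `(a ∧ b)(u, v) = a(u) b(v) - a(v) b(u)`. -/
def covWedge (a b : V →L[ℝ] ℝ) : V [⋀^Fin 2]→L[ℝ] ℝ where
  toFun v := a (v 0) * b (v 1) - a (v 1) * b (v 0)
  map_update_add' v i x y := by fin_cases i <;> simp <;> ring
  map_update_smul' v i c x := by fin_cases i <;> simp <;> ring
  map_eq_zero_of_eq' v i j hv hij := by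
    have h01 : v 0 = v 1 := by
      fin_cases i <;> fin_cases j <;> simp_all
    simp [h01]
  cont := by fun_prop

/-- The pairing of a bivector with two covectors, `(u ∧ v)(a, b) = a(u) b(v) - a(v) b(u)`. -/
def bivectorEval (P : ⋀[ℝ]^2 V) (a b : V →L[ℝ] ℝ) : ℝ :=
  exteriorPower.alternatingMapLinearEquiv (covWedge a b).toAlternatingMap P

theorem bivectorEval_ιMulti (v : Fin 2 → V) (a b : V →L[ℝ] ℝ) :
    bivectorEval (exteriorPower.ιMulti ℝ 2 v) a b = a (v 0) * b (v 1) - a (v 1) * b (v 0) := by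
  simp only [bivectorEval, exteriorPower.alternatingMapLinearEquiv_apply_ιMulti]
  rfl

/-- The vector `#a` associated to a covector `a` by a bivector `P`: for `P = u ∧ v` it is
`a(u) v - a(v) u`, so that `b(#a) = P(a, b)`. -/
def bivectorSharp (P : ⋀[ℝ]^2 V) (a : V →L[ℝ] ℝ) : V :=
  bivectorLift
    (LinearMap.mk₂ ℝ (fun u v => a u • v - a v • u)
      (fun _ _ _ => by simp only [map_add, add_smul, smul_add]; abel)
      (fun _ _ _ => by
        simp only [map_smul, smul_sub, smul_smul, smul_eq_mul]
        congr 2; ring)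
      (fun _ _ _ => by simp only [map_add, add_smul, smul_add]; abel)
      (fun _ _ _ => by
        simp only [map_smul, smul_sub, smul_smul, smul_eq_mul]
        congr 2; ring))
    (fun v => by simp) P

/-- The contraction of a bivector with a form, `(u ∧ v) ⌟ η = η(u, v, …)`. -/
def bivectorContract {k : ℕ} (P : ⋀[ℝ]^2 V) (η : V [⋀^Fin (k + 2)]→L[ℝ] ℝ) :
    V [⋀^Fin k]→L[ℝ] ℝ :=
  bivectorLift
    (LinearMap.mk₂ ℝ (fun u v => (η.curryLeft u).curryLeft v)
      (fun _ _ _ => by ext; simp)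
      (fun _ _ _ => by ext; simp)
      (fun _ _ _ => by ext; simp)
      (fun _ _ _ => by ext; simp))
    (fun v => by ext; simp) P

/-- The interior product of a vector with a `2`-form, `(v ⌟ σ)(w) = σ(v, w)`. -/
def vectorContract (v : V) (σ : V [⋀^Fin 2]→L[ℝ] ℝ) : V →L[ℝ] ℝ :=
  (ContinuousAlternatingMap.ofSubsingleton ℝ V ℝ (0 : Fin 1)).symm (σ.curryLeft v)

end LinearAlgebra

/-! ### Tensor fields on a manifold modelled on `E` -/

section Manifold

variable (E : Type*) [NormedAddCommGroup E] [NormedSpace ℝ E]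
  (M : Type*) [TopologicalSpace M] [ChartedSpace E M]

/-- (Not necessarily smooth) differential forms of degree `k`. -/
abbrev FormField (k : ℕ) : Type _ := (x : M) → TangentSpace 𝓘(ℝ, E) x [⋀^Fin k]→L[ℝ] ℝ

/-- (Not necessarily smooth) covector fields. -/
abbrev CovectorField : Type _ := (x : M) → TangentSpace 𝓘(ℝ, E) x →L[ℝ] ℝ

/-- (Not necessarily smooth) bivector fields. -/
abbrev BivectorField : Type _ := (x : M) → ⋀[ℝ]^2 (TangentSpace 𝓘(ℝ, E) x)

variable {E M}

/-- The representation of a form in the preferred chart at `x₀`, that is, its pullback by the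
inverse of that chart. -/
def FormField.inChart {k : ℕ} (η : FormField E M k) (x₀ : M) (y : E) : E [⋀^Fin k]→L[ℝ] ℝ :=
  (η ((extChartAt 𝓘(ℝ, E) x₀).symm y)).compContinuousLinearMap
    (mfderiv 𝓘(ℝ, E) 𝓘(ℝ, E) (extChartAt 𝓘(ℝ, E) x₀).symm y)

/-- A form is smooth on an open set if it is so in the charts. -/
def FormField.SmoothOn {k : ℕ} (η : FormField E M k) (U : Set M) : Prop :=
  ∀ x₀ : M, ContDiffOn ℝ ∞ (η.inChart x₀)
    ((extChartAt 𝓘(ℝ, E) x₀).target ∩ (extChartAt 𝓘(ℝ, E) x₀).symm ⁻¹' U)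

/-- Smooth differential forms. -/
def FormField.Smooth {k : ℕ} (η : FormField E M k) : Prop := η.SmoothOn Set.univ

/-- The exterior derivative of a form, computed at `x` in the preferred chart at `x`. -/
def FormField.d {k : ℕ} (η : FormField E M k) : FormField E M (k + 1) := fun x =>
  (extDeriv (η.inChart x) (extChartAt 𝓘(ℝ, E) x x)).compContinuousLinearMap
    (mfderiv 𝓘(ℝ, E) 𝓘(ℝ, E) (extChartAt 𝓘(ℝ, E) x) x)

/-- A covector field as a form of degree one. -/
def CovectorField.toForm (α : CovectorField E M) : FormField E M 1 := fun x =>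
  ContinuousAlternatingMap.ofSubsingleton ℝ (TangentSpace 𝓘(ℝ, E) x) ℝ (0 : Fin 1) (α x)

/-- Smooth `1`-forms. -/
def CovectorField.Smooth (α : CovectorField E M) : Prop := FormField.Smooth α.toForm

/-- The exterior derivative of a `1`-form. -/
def CovectorField.d (α : CovectorField E M) : FormField E M 2 := FormField.d α.toForm

/-- The wedge product of two `1`-forms. -/
def CovectorField.wedge (α β : CovectorField E M) : FormField E M 2 := fun x =>
  covWedge (V := E) (α x) (β x)

variable (E) in
/-- Smooth real functions. -/
def SmoothFun (f : M → ℝ) : Prop := ContMDiff 𝓘(ℝ, E) 𝓘(ℝ, ℝ) ∞ f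

variable (E) in
/-- The differential of a function. -/
def dFun (f : M → ℝ) : CovectorField E M := fun x => mfderiv 𝓘(ℝ, E) 𝓘(ℝ, ℝ) f x

/-- The product of a form with a function. -/
def FormField.fsmul {k : ℕ} (f : M → ℝ) (η : FormField E M k) : FormField E M k :=
  fun x => f x • η x

/-- The product of a `1`-form with a function. -/
def CovectorField.fsmul (f : M → ℝ) (α : CovectorField E M) : CovectorField E M :=
  fun x => f x • α x

/-! ### Poisson structures and contravariant connections -/

/-- The function `π(α, β)`. -/
def BivectorField.eval (π : BivectorField E M) (α β : CovectorField E M) : M → ℝ := fun x =>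
  bivectorEval (V := E) (π x) (α x) (β x)

/-- The bracket of functions `{f, h} = π(df, dh)`. -/
def BivectorField.bracket (π : BivectorField E M) (f h : M → ℝ) : M → ℝ :=
  π.eval (dFun E f) (dFun E h)

/-- A bivector field is a Poisson structure if its bracket maps pairs of smooth functions to
smooth functions (that is, if it is smooth) and satisfies the Jacobi identity. -/
structure BivectorField.IsPoisson (π : BivectorField E M) : Prop where
  smooth : ∀ f h : M → ℝ, SmoothFun E f → SmoothFun E h → SmoothFun E (π.bracket f h)
  jacobi : ∀ f h k : M → ℝ, SmoothFun E f → SmoothFun E h → SmoothFun E k →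
    π.bracket f (π.bracket h k) + π.bracket h (π.bracket k f) + π.bracket k (π.bracket f h) = 0

/-- The Koszul bracket of `1`-forms, `[α, β]_π = #α ⌟ dβ - #β ⌟ dα + d(π(α, β))`, equivalently
`L_{#α} β - L_{#β} α - d(π(α, β))`; it is the Lie algebroid bracket with `[df, dh]_π = d{f, h}`. -/
def BivectorField.koszul (π : BivectorField E M) (α β : CovectorField E M) : CovectorField E M :=
  fun x =>
    (show TangentSpace 𝓘(ℝ, E) x →L[ℝ] ℝ from
        vectorContract (V := E) (bivectorSharp (V := E) (π x) (α x)) (β.d x))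
      - (show TangentSpace 𝓘(ℝ, E) x →L[ℝ] ℝ from
        vectorContract (V := E) (bivectorSharp (V := E) (π x) (β x)) (α.d x))
      + dFun E (π.eval α β) x

/-- A contravariant connection (on the cotangent bundle): an operator on smooth `1`-forms with
`D_{fα} β = f D_α β` and `D_α (fβ) = f D_α β + (#α)(f) β`, where `(#α)(f) = π(α, df)`. -/
structure IsContravariantConnection (π : BivectorField E M)
    (D : CovectorField E M → CovectorField E M → CovectorField E M) : Prop where
  smooth : ∀ α β : CovectorField E M, α.Smooth → β.Smooth → CovectorField.Smooth (D α β)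
  add_left : ∀ α α' β : CovectorField E M, α.Smooth → α'.Smooth → β.Smooth →
    D (α + α') β = D α β + D α' β
  add_right : ∀ α β β' : CovectorField E M, α.Smooth → β.Smooth → β'.Smooth →
    D α (β + β') = D α β + D α β'
  fsmul_left : ∀ (f : M → ℝ) (α β : CovectorField E M), SmoothFun E f → α.Smooth → β.Smooth →
    D (α.fsmul f) β = (D α β).fsmul f
  leibniz : ∀ (f : M → ℝ) (α β : CovectorField E M), SmoothFun E f → α.Smooth → β.Smooth →
    D α (β.fsmul f) = (D α β).fsmul f + β.fsmul (π.eval α (dFun E f))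

/-- The torsion `D_α β - D_β α - [α, β]_π` vanishes. -/
def IsTorsionFree (π : BivectorField E M)
    (D : CovectorField E M → CovectorField E M → CovectorField E M) : Prop :=
  ∀ α β : CovectorField E M, α.Smooth → β.Smooth → D α β - D β α - π.koszul α β = 0

/-- The curvature `D_α D_β - D_β D_α - D_{[α, β]_π}` vanishes. -/
def IsFlat (π : BivectorField E M)
    (D : CovectorField E M → CovectorField E M → CovectorField E M) : Prop :=
  ∀ α β γ : CovectorField E M, α.Smooth → β.Smooth → γ.Smooth →
    D α (D β γ) - D β (D α γ) - D (π.koszul α β) γ = 0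

/-! ### The metacurvature -/

/-- The generalized Poisson brackets determined by a contravariant connection `D`:
`D₂` is the extension of `D` to `2`-forms, giving `{f, σ} = D₂_{df} σ`, and `B` is the bracket
`{α, β}` of two `1`-forms with values in `2`-forms, determined by the product identity
`{fα, β} = f {α, β} + α ∧ {f, β}` and the Leibniz identity `d{f, β} = {df, β} + {f, dβ}`,
where `{f, β} = D_{df} β`. -/
structure IsGeneralizedBracket (π : BivectorField E M)
    (D : CovectorField E M → CovectorField E M → CovectorField E M)
    (D₂ : CovectorField E M → FormField E M 2 → FormField E M 2)
    (B : CovectorField E M → CovectorField E M → FormField E M 2) : Prop where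
  ext_smooth : ∀ (α : CovectorField E M) (σ : FormField E M 2), α.Smooth → σ.Smooth →
    FormField.Smooth (D₂ α σ)
  ext_add : ∀ (α : CovectorField E M) (σ τ : FormField E M 2), α.Smooth → σ.Smooth → τ.Smooth →
    D₂ α (σ + τ) = D₂ α σ + D₂ α τ
  ext_leibniz : ∀ (f : M → ℝ) (α : CovectorField E M) (σ : FormField E M 2), SmoothFun E f →
    α.Smooth → σ.Smooth →
    D₂ α (σ.fsmul f) = (D₂ α σ).fsmul f + σ.fsmul (π.eval α (dFun E f))
  ext_wedge : ∀ α β γ : CovectorField E M, α.Smooth → β.Smooth → γ.Smooth →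
    D₂ α (β.wedge γ) = (D α β).wedge γ + β.wedge (D α γ)
  smooth : ∀ α β : CovectorField E M, α.Smooth → β.Smooth → FormField.Smooth (B α β)
  symm : ∀ α β : CovectorField E M, α.Smooth → β.Smooth → B α β = B β α
  add_left : ∀ α α' β : CovectorField E M, α.Smooth → α'.Smooth → β.Smooth →
    B (α + α') β = B α β + B α' β
  product : ∀ (f : M → ℝ) (α β : CovectorField E M), SmoothFun E f → α.Smooth → β.Smooth →
    B (α.fsmul f) β = (B α β).fsmul f + α.wedge (D (dFun E f) β)
  leibniz : ∀ (f : M → ℝ) (β : CovectorField E M), SmoothFun E f → β.Smooth →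
    (D (dFun E f) β).d = B (dFun E f) β + D₂ (dFun E f) β.d

/-- The generalized Poisson brackets of `D` exist, and the metacurvature
`M(df, β, γ) = {f, {β, γ}} - {{f, β}, γ} - {{f, γ}, β}` formed with them vanishes. -/
def HasZeroMetacurvature (π : BivectorField E M)
    (D : CovectorField E M → CovectorField E M → CovectorField E M) : Prop :=
  (∃ D₂ B, IsGeneralizedBracket π D D₂ B) ∧
  ∀ D₂ B, IsGeneralizedBracket π D D₂ B →
    ∀ (f : M → ℝ) (β γ : CovectorField E M), SmoothFun E f → β.Smooth → γ.Smooth →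
      D₂ (dFun E f) (B β γ) - B (D (dFun E f) β) γ - B (D (dFun E f) γ) β = 0

/-! ### Pseudo-Riemannian metrics -/

variable (E M) in
/-- A smooth pseudo-Riemannian metric (Riemannian metrics are the positive definite ones). -/
structure PseudoRiemannianMetric [IsManifold 𝓘(ℝ, E) ∞ M] where
  /-- The bilinear form on each tangent space. -/
  val : (x : M) → TangentSpace 𝓘(ℝ, E) x →L[ℝ] TangentSpace 𝓘(ℝ, E) x →L[ℝ] ℝ
  symm : ∀ (x : M) (v w : TangentSpace 𝓘(ℝ, E) x), val x v w = val x w v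
  nondegenerate : ∀ (x : M) (v : TangentSpace 𝓘(ℝ, E) x), (∀ w, val x v w = 0) → v = 0
  smooth : ContMDiff 𝓘(ℝ, E) (𝓘(ℝ, E).prod 𝓘(ℝ, E →L[ℝ] E →L[ℝ] ℝ)) ∞
    (fun x => Bundle.TotalSpace.mk' (E →L[ℝ] E →L[ℝ] ℝ)
      (E := fun x : M => TangentSpace 𝓘(ℝ, E) x →L[ℝ] TangentSpace 𝓘(ℝ, E) x →L[ℝ] ℝ) x (val x))

variable [IsManifold 𝓘(ℝ, E) ∞ M]

/-- Lowering indices, `v ↦ g(v, ·)`, as a linear isomorphism. -/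
def PseudoRiemannianMetric.flat [FiniteDimensional ℝ E] (g : PseudoRiemannianMetric E M) (x : M) :
    E ≃ₗ[ℝ] (E →L[ℝ] ℝ) :=
  LinearMap.linearEquivOfInjective
    (show E →ₗ[ℝ] (E →L[ℝ] ℝ) from (g.val x : E →L[ℝ] E →L[ℝ] ℝ).toLinearMap)
    ((injective_iff_map_eq_zero _).2 fun v hv =>
      g.nondegenerate x v fun w => DFunLike.congr_fun hv w)
    ((Subspace.dual_finrank_eq (K := ℝ) (V := E)).symm.trans
      (LinearMap.toContinuousLinearMap (𝕜 := ℝ) (E := E) (F' := ℝ)).finrank_eq)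

/-- The induced metric on covectors, `⟨α, β⟩ = g(α^♯, β^♯)`, as a function. -/
def PseudoRiemannianMetric.inner [FiniteDimensional ℝ E] (g : PseudoRiemannianMetric E M)
    (α β : CovectorField E M) : M → ℝ := fun x =>
  g.val x ((g.flat x).symm (α x)) ((g.flat x).symm (β x))

/-- The metric contravariant connection of `g` and `π`, as an operator on smooth `1`-forms:
a torsion-free contravariant connection for which the contravariant derivative of the metric
vanishes, `(#α)⟨β, γ⟩ = ⟨D_α β, γ⟩ + ⟨β, D_α γ⟩`. -/
structure IsMetricContravariantConnection [FiniteDimensional ℝ E] (g : PseudoRiemannianMetric E M)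
    (π : BivectorField E M) (D : CovectorField E M → CovectorField E M → CovectorField E M) :
    Prop where
  connection : IsContravariantConnection π D
  torsionFree : IsTorsionFree π D
  metric : ∀ α β γ : CovectorField E M, α.Smooth → β.Smooth → γ.Smooth →
    π.eval α (dFun E (g.inner β γ)) = g.inner (D α β) γ + g.inner β (D α γ)

/-- A Riemannian volume form on an open set `U`, for a manifold of dimension `n`: a smooth
`n`-form `ε` on `U` with `ε(v₁, …, vₙ)² = |det g(vᵢ, vⱼ)|`, that is, with value `±1` on
orthonormal frames. -/
structure PseudoRiemannianMetric.IsVolumeFormOn {n : ℕ} (g : PseudoRiemannianMetric E M)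
    (U : Set M) (ε : FormField E M n) : Prop where
  smooth : ε.SmoothOn U
  sq_eq : ∀ x ∈ U, ∀ v : Fin n → TangentSpace 𝓘(ℝ, E) x,
    (ε x v) ^ 2 = |Matrix.det (Matrix.of fun i j => g.val x (v i) (v j))|

/-- The contraction `π ⌟ η`. -/
def BivectorField.contract {k : ℕ} (π : BivectorField E M) (η : FormField E M (k + 2)) :
    FormField E M k := fun x =>
  bivectorContract (V := E) (π x) (η x)

/-- Compatibility of a Poisson structure and a metric: the metric contravariant connection `D`
(it exists and is determined on smooth forms) is flat and has vanishing metacurvature, and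
`d(π ⌟ ε) = 0` for the Riemannian volume form `ε`. The last condition is local and insensitive to
the sign of `ε`, so that it is imposed for all local volume forms; in dimension below two
`π ⌟ ε` is zero for degree reasons. -/
structure IsCompatible [FiniteDimensional ℝ E] (g : PseudoRiemannianMetric E M)
    (π : BivectorField E M) : Prop where
  exists_connection : ∃ D, IsMetricContravariantConnection g π D
  flat : ∀ D, IsMetricContravariantConnection g π D → IsFlat π D
  metacurvature : ∀ D, IsMetricContravariantConnection g π D → HasZeroMetacurvature π D
  volume : ∀ k : ℕ, Module.finrank ℝ E = k + 2 → ∀ U : Set M, IsOpen U →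
    ∀ ε : FormField E M (k + 2), g.IsVolumeFormOn U ε →
      ∀ x ∈ U, FormField.d (π.contract ε) x = 0

/-! ### Group actions and coverings -/

section Action

variable {F : Type*} [NormedAddCommGroup F] [NormedSpace ℝ F]
  {G : Type*} [TopologicalSpace G] [ChartedSpace F G] [Group G]

variable (F) in
/-- The adjoint action of `a` on the Lie algebra (the tangent space at `1`). -/
def adjointAction (a : G) : GroupLieAlgebra 𝓘(ℝ, F) G →L[ℝ] GroupLieAlgebra 𝓘(ℝ, F) G :=
  (mfderiv 𝓘(ℝ, F) 𝓘(ℝ, F) (fun b : G => a * b * a⁻¹) (1 : G) : F →L[ℝ] F)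

variable (F) in
/-- `Ad_G`-invariance of an element of `∧²𝔤`. -/
def IsAdInvariant (Q : ⋀[ℝ]^2 (GroupLieAlgebra 𝓘(ℝ, F) G)) : Prop :=
  ∀ a : G, exteriorPower.map 2 (adjointAction F a).toLinearMap Q = Q

variable (F) in
/-- The left-invariant bivector field on `G` with value `Q` at `1`. -/
def leftInvariantBivector (Q : ⋀[ℝ]^2 (GroupLieAlgebra 𝓘(ℝ, F) G)) : BivectorField F G := fun a =>
  exteriorPower.map 2
    (show F →L[ℝ] F from
      mfderiv 𝓘(ℝ, F) 𝓘(ℝ, F) (fun b : G => a * b) (1 : G)).toLinearMap Q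

variable (E F) in
/-- The infinitesimal action at `x`: the derivative at `1` of `a ↦ a • x`. Applied to an element
of the Lie algebra it gives the value at `x` of the corresponding fundamental vector field. -/
def infinitesimalAction {M : Type*} [TopologicalSpace M] [ChartedSpace E M] [SMul G M] (x : M) :
    GroupLieAlgebra 𝓘(ℝ, F) G →L[ℝ] TangentSpace 𝓘(ℝ, E) x :=
  (mfderiv 𝓘(ℝ, F) 𝓘(ℝ, E) (fun a : G => a • x) (1 : G) : F →L[ℝ] E)

variable (E F) in
/-- The bivector field induced on a `G`-space by an element of `∧²𝔤`, through the fundamental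
vector fields. -/
def inducedBivector (M : Type*) [TopologicalSpace M] [ChartedSpace E M] [SMul G M]
    (Q : ⋀[ℝ]^2 (GroupLieAlgebra 𝓘(ℝ, F) G)) : BivectorField E M := fun x =>
  exteriorPower.map 2 (infinitesimalAction E F x).toLinearMap Q

/-- The pullback of a metric by a map, as a field of bilinear forms. -/
def PseudoRiemannianMetric.pullback {N : Type*} [TopologicalSpace N] [ChartedSpace E N]
    (g : PseudoRiemannianMetric E M) (p : N → M) (x : N)
    (v w : TangentSpace 𝓘(ℝ, E) x) : ℝ :=
  g.val (p x) (mfderiv 𝓘(ℝ, E) 𝓘(ℝ, E) p x v) (mfderiv 𝓘(ℝ, E) 𝓘(ℝ, E) p x w)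

end Action

end Manifold

end

noncomputable section

/-! ### Smoothness of fields of alternating forms -/

section Forms

variable {E : Type*} [NormedAddCommGroup E] [NormedSpace ℝ E]

/-! Everything comes from one algebraic fact: an `Ad`-invariant bivector on a Lie algebra is built
on an abelian subalgebra. Let `Q♯` be the map from covectors to the Lie algebra given by the
bivector. Differentiating the invariance shows that `b([S, Q♯a])` is symmetric in `a` and `b`. For
`S = Q♯c` it is also antisymmetric in `c` and `a`. A trilinear form symmetric in one pair of
neighbouring slots and antisymmetric in the other is zero, so the range of `Q♯` is abelian
(`invariant_bivector_range_abelian`). Since `Q` is a sum of products of elements of its range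
(`bivector_exists_sum_range`), it is a sum of `uᵣ ∧ vᵣ` with commuting factors
(`exists_commuting_sum`).

The fundamental fields of these elements commute, and they are Killing fields because the action is
isometric. Invariance of `Q` under `Γ` lets the induced bivector descend to the quotient
(`pushBivector_smul`). As the projection is a local diffeomorphism, the descended field is locally
`π = ∑ uᵣ ∧ vᵣ` with commuting Killing fields (`hasAdaptedFrames_of_action`).

The rest is local. Put `D_α β = ∑ α(uᵣ) L_{vᵣ} β - α(vᵣ) L_{uᵣ} β`. Cartan's formula makes it
torsion-free (`frameConn_torsion`), the Killing equation makes it metric (`eval_dFun_inner`), and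
commutation of the Lie derivatives makes it flat (`frameConn_flat`). The bracket of `1`-forms is `∑
L_{uᵣ} α ∧ L_{vᵣ} β - L_{vᵣ} α ∧ L_{uᵣ} β`. Its Leibniz identity is `d L_X = L_X d`, and its
metacurvature vanishes because the second derivatives `uᵣ uₛ f` are symmetric in the indices
(`frameBracket_metacurvature`). The Jacobi identity has the same cause (`frameEval_jacobi`). Finally
`π ⌟ ε` is a sum of contractions of a closed form with commuting fields preserving it, hence closed
(`contract_closed_of_adaptedFrames`).

To pass from local to global, each operator is shown to be determined pointwise by its axioms: the
connection by the Koszul argument (`IsMetricConnectionAt.unique`), the others because the difference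
of two candidates is tensorial (`frameConnForm_unique`, `frameBracket_unique`). So the expressions
in different frames agree and define global operators, and every operator satisfying the axioms has
these expressions. -/

/-- Expanding the arguments in a basis gives a finite sum of products of their coordinates with
values of the form on fixed basis vectors. -/
theorem ContDiffAt.alternating_apply [FiniteDimensional ℝ E] {H : Type*} [NormedAddCommGroup H]
    [NormedSpace ℝ H] {k : ℕ} {n : WithTop ℕ∞} {η : H → E [⋀^Fin k]→L[ℝ] ℝ} {v : Fin k → H → E}
    {w : H} (hη : ContDiffAt ℝ n η w) (hv : ∀ i, ContDiffAt ℝ n (v i) w) :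
    ContDiffAt ℝ n (fun y => η y fun i => v i y) w := by
  classical
  set b := Module.finBasis ℝ E
  have key : (fun y => η y fun i => v i y) = fun y => ∑ r : Fin k → Fin (Module.finrank ℝ E),
      (∏ i, (b.equivFunL (v i y)) (r i)) * η y fun i => b (r i) := by
    funext y
    have h1 : (fun i => v i y) = fun i => ∑ j, (b.equivFunL (v i y)) j • b j := by
      funext i
      exact (b.sum_equivFun (v i y)).symm
    conv_lhs => rw [h1]
    have h2 := (η y).toMultilinearMap.map_sum (fun i j => (b.equivFunL (v i y)) j • b j)
    refine h2.trans (Finset.sum_congr rfl fun r _ => ?_)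
    exact (η y).toMultilinearMap.map_smul_univ (fun i => (b.equivFunL (v i y)) (r i))
      (fun i => b (r i))
  rw [key]
  refine ContDiffAt.sum fun r _ => ContDiffAt.mul (contDiffAt_prod fun i _ => ?_) ?_
  · exact (contDiffAt_pi.1 (b.equivFunL.contDiff.contDiffAt.comp w (hv i))) (r i)
  · exact (ContinuousAlternatingMap.apply ℝ E ℝ (fun i => b (r i))).contDiff.contDiffAt.comp w hη

/-- Evaluation on tuples of basis vectors embeds the alternating forms linearly in a
finite-dimensional space. A linear left inverse recovers the form from its values, so smoothness can
be tested on fixed vectors. -/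
theorem contDiffAt_alternating [FiniteDimensional ℝ E] {H : Type*} [NormedAddCommGroup H]
    [NormedSpace ℝ H] {k : ℕ} {n : WithTop ℕ∞} {η : H → E [⋀^Fin k]→L[ℝ] ℝ} {w : H}
    (hη : ∀ v, ContDiffAt ℝ n (fun y => η y v) w) : ContDiffAt ℝ n η w := by
  classical
  set b := Module.finBasis ℝ E
  let ev : (E [⋀^Fin k]→L[ℝ] ℝ) →ₗ[ℝ] ((Fin k → Fin (Module.finrank ℝ E)) → ℝ) :=
    { toFun := fun f r => f fun i => b (r i)
      map_add' := fun _ _ => rfl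
      map_smul' := fun _ _ => rfl }
  have hev : LinearMap.ker ev = ⊥ := by
    refine LinearMap.ker_eq_bot'.2 fun f hf => ?_
    apply ContinuousAlternatingMap.toAlternatingMap_injective
    exact b.ext_alternating fun r _ => congrFun hf r
  obtain ⟨φ, hφ⟩ := ev.exists_leftInverse_of_injective hev
  have h1 : η = fun y => (LinearMap.toContinuousLinearMap φ) (ev (η y)) := by
    funext y
    exact (LinearMap.congr_fun hφ (η y)).symm
  rw [h1]
  refine (LinearMap.toContinuousLinearMap φ).contDiff.contDiffAt.comp w ?_
  exact contDiffAt_pi.2 fun r => hη fun i => b (r i)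

theorem contDiffAt_covector [FiniteDimensional ℝ E] {H : Type*} [NormedAddCommGroup H]
    [NormedSpace ℝ H] {N : Type*} [NormedAddCommGroup N] [NormedSpace ℝ N]
    {n : WithTop ℕ∞} {a : H → E →L[ℝ] N} {w : H}
    (ha : ∀ v, ContDiffAt ℝ n (fun y => a y v) w) : ContDiffAt ℝ n a w := by
  classical
  set b := Module.finBasis ℝ E
  have h1 : a = fun y => ∑ j,
      ((LinearMap.toContinuousLinearMap (b.coord j)).smulRight (a y (b j)) : E →L[ℝ] N) := by
    funext y
    ext v
    conv_lhs => rw [← b.sum_repr v]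
    simp only [map_sum, map_smul]
    simp [_root_.sum_apply]
  rw [h1]
  refine ContDiffAt.sum fun j _ => ?_
  exact contDiffAt_const.smulRight (ha (b j))

theorem ContDiffAt.fderiv_infty {N : Type*} [NormedAddCommGroup N] [NormedSpace ℝ N] {f : E → N}
    {w : E} (hf : ContDiffAt ℝ ∞ f w) : ContDiffAt ℝ ∞ (fderiv ℝ f) w :=
  hf.fderiv_right le_rfl

theorem ContDiffAt.diff {N : Type*} [NormedAddCommGroup N] [NormedSpace ℝ N] {f : E → N}
    {w : E} (hf : ContDiffAt ℝ ∞ f w) : DifferentiableAt ℝ f w :=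
  hf.differentiableAt (by simp)

theorem ContDiffAt.fderiv_fderiv_symm {N : Type*} [NormedAddCommGroup N] [NormedSpace ℝ N]
    {f : E → N} {w : E} (hf : ContDiffAt ℝ ∞ f w) (u v : E) :
    fderiv ℝ (fderiv ℝ f) w u v = fderiv ℝ (fderiv ℝ f) w v u :=
  (hf.of_le (m := 2) (WithTop.coe_le_coe.2 (le_top : (2 : ℕ∞) ≤ ⊤))).isSymmSndFDerivAt
    (by simp) u v

theorem ContDiffAt.eventually_diff {N : Type*} [NormedAddCommGroup N] [NormedSpace ℝ N] {f : E → N}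
    {w : E} (hf : ContDiffAt ℝ ∞ f w) : ∀ᶠ y in 𝓝 w, DifferentiableAt ℝ f y :=
  ((hf.of_le (m := 1) (by simp)).eventually (by simp)).mono fun _ h =>
    h.differentiableAt one_ne_zero

end Forms

/-! ### Lie derivatives on a vector space -/

section Lie

variable {E : Type*} [NormedAddCommGroup E] [NormedSpace ℝ E]

/-- The Lie derivative of a function. -/
def lieFun (X : E → E) (f : E → ℝ) (w : E) : ℝ := fderiv ℝ f w (X w)

/-- The Lie derivative of a `1`-form. -/
def lieCov (X : E → E) (a : E → E →L[ℝ] ℝ) (w : E) : E →L[ℝ] ℝ :=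
  fderiv ℝ a w (X w) + a w ∘L fderiv ℝ X w

/-- The Lie derivative of a form. -/
def lieForm {k : ℕ} (X : E → E) (σ : E → E [⋀^Fin k]→L[ℝ] ℝ) (w : E) : E [⋀^Fin k]→L[ℝ] ℝ :=
  fderiv ℝ σ w (X w) +
    (σ w).fderivCompContinuousLinearMap (ContinuousLinearMap.id ℝ E) (fderiv ℝ X w)

/-- A `1`-form as a field of alternating forms. -/
def covForm (a : E → E →L[ℝ] ℝ) (w : E) : E [⋀^Fin 1]→L[ℝ] ℝ :=
  ContinuousAlternatingMap.ofSubsingleton ℝ E ℝ (0 : Fin 1) (a w)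

/-- The exterior derivative of a `1`-form. -/
def dCov (a : E → E →L[ℝ] ℝ) (w : E) : E [⋀^Fin 2]→L[ℝ] ℝ := extDeriv (covForm a) w

variable {X Y : E → E} {f h : E → ℝ} {a b : E → E →L[ℝ] ℝ} {σ τ : E → E [⋀^Fin 2]→L[ℝ] ℝ} {w : E}

theorem lieCov_apply (u : E) :
    lieCov X a w u = fderiv ℝ a w (X w) u + a w (fderiv ℝ X w u) := rfl

theorem lieForm_apply {k : ℕ} (σ : E → E [⋀^Fin k]→L[ℝ] ℝ) (v : Fin k → E) :
    lieForm X σ w v = fderiv ℝ σ w (X w) v +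
      ∑ i, σ w (Function.update v i (fderiv ℝ X w (v i))) := by
  classical
  simp only [lieForm, ContinuousAlternatingMap.add_apply,
    ContinuousAlternatingMap.fderivCompContinuousLinearMap_apply]
  congr 1
  refine Finset.sum_congr rfl fun i _ => ?_
  congr 1
  funext j
  by_cases hij : j = i
  · subst hij; simp
  · simp [hij]

theorem lieForm_two (σ : E → E [⋀^Fin 2]→L[ℝ] ℝ) (u v : E) :
    lieForm X σ w ![u, v] = fderiv ℝ σ w (X w) ![u, v] + σ w ![fderiv ℝ X w u, v] +
      σ w ![u, fderiv ℝ X w v] := by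
  rw [lieForm_apply, Fin.sum_univ_two]
  simp only [Matrix.cons_val_zero, Matrix.cons_val_one, add_assoc]
  congr 3 <;> (funext j; fin_cases j <;> simp)

theorem alternating_two_ext {σ τ : E [⋀^Fin 2]→L[ℝ] ℝ} (h : ∀ u v, σ ![u, v] = τ ![u, v]) :
    σ = τ := by
  ext v
  have : v = ![v 0, v 1] := by funext j; fin_cases j <;> rfl
  rw [this]
  exact h _ _

theorem covForm_contDiffAt {n : WithTop ℕ∞} (ha : ContDiffAt ℝ n a w) :
    ContDiffAt ℝ n (covForm a) w :=
  (ContinuousAlternatingMap.ofSubsingletonLIE (𝕜 := ℝ) (E := E) (F := ℝ)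
    (0 : Fin 1)).contDiff.contDiffAt.comp w ha

theorem fderiv_form_apply {k : ℕ} {σ : E → E [⋀^Fin k]→L[ℝ] ℝ} (hσ : DifferentiableAt ℝ σ w)
    (u : E) (v : Fin k → E) : fderiv ℝ σ w u v = fderiv ℝ (fun y => σ y v) w u := by
  have := (ContinuousAlternatingMap.apply ℝ E ℝ v).hasFDerivAt.comp w hσ.hasFDerivAt
  have h2 : fderiv ℝ (fun y => σ y v) w = _ := this.fderiv
  rw [h2]; rfl

theorem fderiv_cov_apply (ha : DifferentiableAt ℝ a w)
    (u v : E) : fderiv ℝ a w u v = fderiv ℝ (fun y => a y v) w u := by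
  have := (ContinuousLinearMap.apply ℝ ℝ v).hasFDerivAt.comp w ha.hasFDerivAt
  have h2 : fderiv ℝ (fun y => a y v) w = _ := this.fderiv
  rw [h2]; rfl

theorem dCov_apply (ha : DifferentiableAt ℝ a w) (u v : E) :
    dCov a w ![u, v] = fderiv ℝ a w u v - fderiv ℝ a w v u := by
  have hd : DifferentiableAt ℝ (covForm a) w :=
    (ContinuousAlternatingMap.ofSubsingletonLIE (𝕜 := ℝ) (E := E) (F := ℝ)
      (0 : Fin 1)).differentiable.differentiableAt.comp w ha
  rw [dCov, extDeriv_apply hd, Fin.sum_univ_two, fderiv_cov_apply ha, fderiv_cov_apply ha]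
  simp [covForm, Fin.removeNth, sub_eq_add_neg]


theorem covWedge_apply (a b : E →L[ℝ] ℝ) (u v : E) :
    covWedge a b ![u, v] = a u * b v - a v * b u := rfl

theorem ContDiffAt.covWedge [FiniteDimensional ℝ E] {n : WithTop ℕ∞} (ha : ContDiffAt ℝ n a w)
    (hb : ContDiffAt ℝ n b w) : ContDiffAt ℝ n (fun y => covWedge (a y) (b y)) w :=
  contDiffAt_alternating fun _ => ((ha.clm_apply contDiffAt_const).mul
    (hb.clm_apply contDiffAt_const)).sub ((ha.clm_apply contDiffAt_const).mul
    (hb.clm_apply contDiffAt_const))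

theorem lieFun_contDiffAt (hX : ContDiffAt ℝ ∞ X w) (hf : ContDiffAt ℝ ∞ f w) :
    ContDiffAt ℝ ∞ (lieFun X f) w :=
  hf.fderiv_infty.clm_apply hX

theorem lieCov_contDiffAt (hX : ContDiffAt ℝ ∞ X w) (ha : ContDiffAt ℝ ∞ a w) :
    ContDiffAt ℝ ∞ (lieCov X a) w :=
  (ha.fderiv_infty.clm_apply hX).add (ha.clm_comp hX.fderiv_infty)

theorem lieForm_contDiffAt [FiniteDimensional ℝ E] {k : ℕ} {σ : E → E [⋀^Fin k]→L[ℝ] ℝ}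
    (hX : ContDiffAt ℝ ∞ X w) (hσ : ContDiffAt ℝ ∞ σ w) : ContDiffAt ℝ ∞ (lieForm X σ) w := by
  refine contDiffAt_alternating fun v => ?_
  simp only [lieForm_apply]
  refine ContDiffAt.add ?_ (ContDiffAt.sum fun i _ => ?_)
  · exact (hσ.fderiv_infty.clm_apply hX).alternating_apply fun i => contDiffAt_const
  · refine hσ.alternating_apply fun j => ?_
    by_cases hij : j = i
    · subst hij
      simpa using hX.fderiv_infty.clm_apply contDiffAt_const
    · simpa [hij] using contDiffAt_const

theorem ContDiffAt.extDeriv {k : ℕ} {σ : E → E [⋀^Fin k]→L[ℝ] ℝ} (hσ : ContDiffAt ℝ ∞ σ w) :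
    ContDiffAt ℝ ∞ (extDeriv σ) w := by
  have h : _root_.extDeriv σ = fun y =>
      ContinuousAlternatingMap.alternatizeUncurryFinCLM ℝ E ℝ (fderiv ℝ σ y) := by
    funext y
    rfl
  rw [h]
  exact (ContinuousAlternatingMap.alternatizeUncurryFinCLM ℝ E ℝ).contDiff.contDiffAt.comp w
    hσ.fderiv_infty

theorem dCov_contDiffAt (ha : ContDiffAt ℝ ∞ a w) : ContDiffAt ℝ ∞ (dCov a) w :=
  (covForm_contDiffAt ha).extDeriv

theorem lieCov_add (ha : DifferentiableAt ℝ a w) (hb : DifferentiableAt ℝ b w) :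
    lieCov X (fun y => a y + b y) w = lieCov X a w + lieCov X b w := by
  ext u
  simp only [lieCov_apply, fderiv_fun_add ha hb, add_apply]
  ring

theorem lieCov_smul (hf : DifferentiableAt ℝ f w) (ha : DifferentiableAt ℝ a w) :
    lieCov X (fun y => f y • a y) w = f w • lieCov X a w + lieFun X f w • a w := by
  ext u
  simp only [lieCov_apply, fderiv_fun_smul hf ha, add_apply, lieFun,
    smul_apply, ContinuousLinearMap.smulRight_apply, smul_eq_mul]
  ring

theorem lieForm_add (hσ : DifferentiableAt ℝ σ w) (hτ : DifferentiableAt ℝ τ w) :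
    lieForm X (fun y => σ y + τ y) w = lieForm X σ w + lieForm X τ w := by
  refine alternating_two_ext fun u v => ?_
  simp only [lieForm_two, fderiv_fun_add hσ hτ, add_apply,
    ContinuousAlternatingMap.add_apply]
  ring

theorem lieForm_smul (hf : DifferentiableAt ℝ f w) (hσ : DifferentiableAt ℝ σ w) :
    lieForm X (fun y => f y • σ y) w = f w • lieForm X σ w + lieFun X f w • σ w := by
  refine alternating_two_ext fun u v => ?_
  simp only [lieForm_two, fderiv_fun_smul hf hσ, add_apply, lieFun,
    ContinuousAlternatingMap.add_apply, ContinuousAlternatingMap.smul_apply,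
    smul_apply, ContinuousLinearMap.smulRight_apply, smul_eq_mul]
  ring

theorem lieForm_covWedge [FiniteDimensional ℝ E] (ha : ContDiffAt ℝ ∞ a w)
    (hb : ContDiffAt ℝ ∞ b w) :
    lieForm X (fun y => covWedge (a y) (b y)) w =
      covWedge (lieCov X a w) (b w) + covWedge (a w) (lieCov X b w) := by
  refine alternating_two_ext fun u v => ?_
  rw [lieForm_two, fderiv_form_apply (ha.covWedge hb).diff]
  have hau : ∀ u, DifferentiableAt ℝ (fun y => a y u) w := fun u =>
    (ha.clm_apply contDiffAt_const).diff
  have hbu : ∀ u, DifferentiableAt ℝ (fun y => b y u) w := fun u =>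
    (hb.clm_apply contDiffAt_const).diff
  have h1 : fderiv ℝ (fun y => covWedge (a y) (b y) ![u, v]) w (X w) =
      fderiv ℝ a w (X w) u * b w v + a w u * fderiv ℝ b w (X w) v
      - (fderiv ℝ a w (X w) v * b w u + a w v * fderiv ℝ b w (X w) u) := by
    simp only [covWedge_apply]
    rw [fderiv_fun_sub ((hau u).fun_mul (hbu v)) ((hau v).fun_mul (hbu u)), fderiv_fun_mul (hau u) (hbu v),
      fderiv_fun_mul (hau v) (hbu u)]
    simp only [fderiv_cov_apply ha.diff, fderiv_cov_apply hb.diff, sub_apply,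
      add_apply, smul_apply, smul_eq_mul]
    ring
  rw [h1]
  simp only [covWedge_apply, ContinuousAlternatingMap.add_apply, lieCov_apply]
  ring

/-- `d L_X f = L_X df`, by the symmetry of the second derivative of `f`. -/
theorem fderiv_lieFun (hX : DifferentiableAt ℝ X w) (hf : ContDiffAt ℝ ∞ f w) :
    fderiv ℝ (lieFun X f) w = lieCov X (fderiv ℝ f) w := by
  ext u
  unfold lieFun
  rw [fderiv_clm_apply hf.fderiv_infty.diff hX, lieCov_apply]
  simp [hf.fderiv_fderiv_symm u, add_comm]

theorem fderiv_lieCov (hX : ContDiffAt ℝ ∞ X w) (ha : ContDiffAt ℝ ∞ a w) (u v : E) :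
    fderiv ℝ (lieCov X a) w u v = fderiv ℝ (fderiv ℝ a) w u (X w) v +
      fderiv ℝ a w (fderiv ℝ X w u) v + fderiv ℝ a w u (fderiv ℝ X w v) +
      a w (fderiv ℝ (fderiv ℝ X) w u v) := by
  unfold lieCov
  rw [fderiv_fun_add (ha.fderiv_infty.clm_apply hX).diff (ha.clm_comp hX.fderiv_infty).diff,
    fderiv_clm_apply ha.fderiv_infty.diff hX.diff, fderiv_clm_comp ha.diff hX.fderiv_infty.diff]
  simp
  ring

/-- `d L_X = L_X d` on `1`-forms. The second derivatives of `X` are symmetric and drop out on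
antisymmetrization; those of `a` match after exchanging the order of differentiation. -/
theorem dCov_lieCov (hX : ContDiffAt ℝ ∞ X w) (ha : ContDiffAt ℝ ∞ a w) :
    dCov (lieCov X a) w = lieForm X (dCov a) w := by
  refine alternating_two_ext fun u v => ?_
  rw [lieForm_two, dCov_apply (lieCov_contDiffAt hX ha).diff,
    fderiv_form_apply (dCov_contDiffAt ha).diff]
  have h1 : (fun y => dCov a y ![u, v]) =ᶠ[𝓝 w] fun y => fderiv ℝ a y u v - fderiv ℝ a y v u :=
    ha.eventually_diff.mono fun y hy => dCov_apply hy u v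
  have hd : ∀ u v, DifferentiableAt ℝ (fun y => fderiv ℝ a y u v) w := fun u v =>
    ((ha.fderiv_infty.clm_apply contDiffAt_const).clm_apply contDiffAt_const).diff
  have h2 : ∀ u v, fderiv ℝ (fun y => fderiv ℝ a y u v) w (X w) =
      fderiv ℝ (fderiv ℝ a) w (X w) u v := fun u v => by
    rw [fderiv_clm_apply (ha.fderiv_infty.clm_apply contDiffAt_const).diff
      (differentiableAt_const _), fderiv_clm_apply ha.fderiv_infty.diff (differentiableAt_const _)]
    simp
  rw [h1.fderiv_eq, fderiv_fun_sub (hd u v) (hd v u), dCov_apply ha.diff, dCov_apply ha.diff,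
    fderiv_lieCov hX ha, fderiv_lieCov hX ha, sub_apply, h2, h2,
    ha.fderiv_fderiv_symm (X w) u, ha.fderiv_fderiv_symm (X w) v, hX.fderiv_fderiv_symm u v]
  ring

/-- In general `X(a(Y)) = (L_X a)(Y) + a([X, Y])`; the hypothesis removes the bracket at the one
point considered. -/
theorem lieFun_pairing (ha : DifferentiableAt ℝ a w) (hY : DifferentiableAt ℝ Y w)
    (hXY : fderiv ℝ Y w (X w) = fderiv ℝ X w (Y w)) :
    lieFun X (fun y => a y (Y y)) w = lieCov X a w (Y w) := by
  rw [lieFun, fderiv_clm_apply ha hY, lieCov_apply]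
  simp [hXY, add_comm]

/-- `[L_X, L_Y] = L_{[X, Y]}`. Commutation is required near the point, since the first derivative of
`[X, Y]` enters. -/
theorem lieCov_comm (hX : ContDiffAt ℝ ∞ X w) (hY : ContDiffAt ℝ ∞ Y w)
    (ha : ContDiffAt ℝ ∞ a w)
    (hXY : ∀ᶠ y in 𝓝 w, fderiv ℝ Y y (X y) = fderiv ℝ X y (Y y)) :
    lieCov X (lieCov Y a) w = lieCov Y (lieCov X a) w := by
  ext u
  -- The commutation relation is differentiated in the direction `u`; this relates the second
  -- derivatives of the two fields.
  have h1 := DFunLike.congr_fun (Filter.EventuallyEq.fderiv_eq (𝕜 := ℝ) hXY) u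
  rw [fderiv_clm_apply hY.fderiv_infty.diff hX.diff,
    fderiv_clm_apply hX.fderiv_infty.diff hY.diff] at h1
  simp only [add_apply, ContinuousLinearMap.comp_apply,
    ContinuousLinearMap.flip_apply] at h1
  have h2 := congrArg (a w) h1
  simp only [map_add] at h2
  simp only [lieCov_apply, fderiv_lieCov hX ha, fderiv_lieCov hY ha]
  rw [hXY.self_of_nhds, ha.fderiv_fderiv_symm (X w) (Y w),
    hY.fderiv_fderiv_symm (X w) u, hX.fderiv_fderiv_symm (Y w) u]
  linarith

theorem dCov_smul (hf : DifferentiableAt ℝ f w) (ha : DifferentiableAt ℝ a w) :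
    dCov (fun y => f y • a y) w = f w • dCov a w + covWedge (fderiv ℝ f w) (a w) := by
  refine alternating_two_ext fun u v => ?_
  rw [dCov_apply (hf.fun_smul ha), fderiv_fun_smul hf ha]
  simp only [ContinuousAlternatingMap.add_apply, ContinuousAlternatingMap.smul_apply,
    dCov_apply ha, covWedge_apply, add_apply, smul_apply,
    ContinuousLinearMap.smulRight_apply, smul_eq_mul]
  ring

end Lie
end

noncomputable section

/-! ### The contravariant connection of a bivector `∑ uᵣ ∧ vᵣ` with commuting `uᵣ`, `vᵣ` -/

section FrameCalculus

variable {E : Type*} [NormedAddCommGroup E] [NormedSpace ℝ E] {ι : Type*} [Fintype ι]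

/-- The vector fields `X` and `Y` commute near `w`. -/
def CommuteNear (X Y : E → E) (w : E) : Prop :=
  ∀ᶠ y in 𝓝 w, fderiv ℝ Y y (X y) = fderiv ℝ X y (Y y)

theorem CommuteNear.symm {X Y : E → E} {w : E} (h : CommuteNear X Y w) : CommuteNear Y X w :=
  h.mono fun _ hy => hy.symm

/-- The smooth vector fields `uᵣ`, `vᵣ` commute with each other near `w`. -/
structure IsCommutingFrame (u v : ι → E → E) (w : E) : Prop where
  smooth_left : ∀ r, ContDiffAt ℝ ∞ (u r) w
  smooth_right : ∀ r, ContDiffAt ℝ ∞ (v r) w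
  comm_left : ∀ r s, CommuteNear (u r) (u s) w
  comm_right : ∀ r s, CommuteNear (v r) (v s) w
  comm_mixed : ∀ r s, CommuteNear (u r) (v s) w

variable (u v : ι → E → E)

/-- The value of `∑ uᵣ ∧ vᵣ` at `w` on two covectors. -/
def frameEval (a b : E →L[ℝ] ℝ) (w : E) : ℝ :=
  ∑ r, (a (u r w) * b (v r w) - a (v r w) * b (u r w))

/-- The contraction of a covector with `∑ uᵣ ∧ vᵣ`. -/
def frameSharp (a : E →L[ℝ] ℝ) (w : E) : E :=
  ∑ r, (a (u r w) • v r w - a (v r w) • u r w)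

/-- The contravariant derivative `∑ a(uᵣ) L_{vᵣ} b - a(vᵣ) L_{uᵣ} b`. -/
def frameConn (a : E →L[ℝ] ℝ) (b : E → E →L[ℝ] ℝ) (w : E) : E →L[ℝ] ℝ :=
  ∑ r, (a (u r w) • lieCov (v r) b w - a (v r w) • lieCov (u r) b w)

/-- The contravariant derivative of a `2`-form. -/
def frameConnForm (a : E →L[ℝ] ℝ) (σ : E → E [⋀^Fin 2]→L[ℝ] ℝ) (w : E) : E [⋀^Fin 2]→L[ℝ] ℝ :=
  ∑ r, (a (u r w) • lieForm (v r) σ w - a (v r w) • lieForm (u r) σ w)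

/-- The bracket `∑ L_{uᵣ} a ∧ L_{vᵣ} b - L_{vᵣ} a ∧ L_{uᵣ} b` of `1`-forms. -/
def frameBracket (a b : E → E →L[ℝ] ℝ) (w : E) : E [⋀^Fin 2]→L[ℝ] ℝ :=
  ∑ r, (covWedge (lieCov (u r) a w) (lieCov (v r) b w) -
    covWedge (lieCov (v r) a w) (lieCov (u r) b w))

variable {u v} {f h k : E → ℝ} {a b c : E → E →L[ℝ] ℝ} {σ τ : E → E [⋀^Fin 2]→L[ℝ] ℝ} {w : E}

/-- Flatness, the Jacobi identity and the vanishing of the metacurvature all reduce to a double sum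
over the frame whose terms cancel against the exchange of the two indices. -/
theorem sum_sum_eq_zero_of_antisymm {T : ι → ι → ℝ} (hT : ∀ r s, T r s + T s r = 0) :
    ∑ r, ∑ s, T r s = 0 := by
  have h1 : ∑ r, ∑ s, T r s + ∑ r, ∑ s, T s r = 0 := by
    simp only [← Finset.sum_add_distrib, hT, Finset.sum_const_zero]
  rw [Finset.sum_comm (f := fun r s => T s r)] at h1
  linarith

theorem frameConn_apply (a : E →L[ℝ] ℝ) (b : E → E →L[ℝ] ℝ) (z : E) :
    frameConn u v a b w z =
      ∑ r, (a (u r w) * lieCov (v r) b w z - a (v r w) * lieCov (u r) b w z) := by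
  simp [frameConn, sum_apply]

theorem frameConnForm_apply (a : E →L[ℝ] ℝ) (σ : E → E [⋀^Fin 2]→L[ℝ] ℝ) (z : Fin 2 → E) :
    frameConnForm u v a σ w z =
      ∑ r, (a (u r w) * lieForm (v r) σ w z - a (v r w) * lieForm (u r) σ w z) := by
  simp [frameConnForm]

theorem frameBracket_apply (a b : E → E →L[ℝ] ℝ) (y z : E) :
    frameBracket u v a b w ![y, z] =
      ∑ r, ((lieCov (u r) a w y * lieCov (v r) b w z - lieCov (u r) a w z * lieCov (v r) b w y) -
        (lieCov (v r) a w y * lieCov (u r) b w z - lieCov (v r) a w z * lieCov (u r) b w y)) := by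
  simp [frameBracket, covWedge_apply]

/-! #### Smoothness -/

theorem frameEval_contDiffAt (H : IsCommutingFrame u v w)
    (ha : ContDiffAt ℝ ∞ a w) (hb : ContDiffAt ℝ ∞ b w) :
    ContDiffAt ℝ ∞ (fun y => frameEval u v (a y) (b y) y) w :=
  ContDiffAt.sum fun r _ =>
    ((ha.clm_apply (H.smooth_left r)).mul (hb.clm_apply (H.smooth_right r))).sub
    ((ha.clm_apply (H.smooth_right r)).mul (hb.clm_apply (H.smooth_left r)))

theorem frameConn_contDiffAt (H : IsCommutingFrame u v w)
    (ha : ContDiffAt ℝ ∞ a w) (hb : ContDiffAt ℝ ∞ b w) :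
    ContDiffAt ℝ ∞ (fun y => frameConn u v (a y) b y) w :=
  ContDiffAt.sum fun r _ =>
    ((ha.clm_apply (H.smooth_left r)).smul (lieCov_contDiffAt (H.smooth_right r) hb)).sub
    ((ha.clm_apply (H.smooth_right r)).smul (lieCov_contDiffAt (H.smooth_left r) hb))

theorem frameConnForm_contDiffAt [FiniteDimensional ℝ E] (H : IsCommutingFrame u v w)
    (ha : ContDiffAt ℝ ∞ a w)
    (hσ : ContDiffAt ℝ ∞ σ w) : ContDiffAt ℝ ∞ (fun y => frameConnForm u v (a y) σ y) w :=
  ContDiffAt.sum fun r _ =>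
    ((ha.clm_apply (H.smooth_left r)).smul (lieForm_contDiffAt (H.smooth_right r) hσ)).sub
    ((ha.clm_apply (H.smooth_right r)).smul (lieForm_contDiffAt (H.smooth_left r) hσ))

theorem frameBracket_contDiffAt [FiniteDimensional ℝ E] (H : IsCommutingFrame u v w)
    (ha : ContDiffAt ℝ ∞ a w)
    (hb : ContDiffAt ℝ ∞ b w) : ContDiffAt ℝ ∞ (frameBracket u v a b) w :=
  ContDiffAt.sum fun r _ =>
    ((lieCov_contDiffAt (H.smooth_left r) ha).covWedge
      (lieCov_contDiffAt (H.smooth_right r) hb)).sub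
    ((lieCov_contDiffAt (H.smooth_right r) ha).covWedge (lieCov_contDiffAt (H.smooth_left r) hb))

/-! #### Product rules -/

theorem frameConn_add_left (a a' : E →L[ℝ] ℝ) (b : E → E →L[ℝ] ℝ) :
    frameConn u v (a + a') b w = frameConn u v a b w + frameConn u v a' b w := by
  ext z
  simp only [frameConn_apply, add_apply, ← Finset.sum_add_distrib]
  exact Finset.sum_congr rfl fun r _ => by ring

theorem frameConn_sub_left (a a' : E →L[ℝ] ℝ) (b : E → E →L[ℝ] ℝ) :
    frameConn u v (a - a') b w = frameConn u v a b w - frameConn u v a' b w := by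
  ext z
  simp only [frameConn_apply, sub_apply, ← Finset.sum_sub_distrib]
  exact Finset.sum_congr rfl fun r _ => by ring

theorem frameConn_smul_left (t : ℝ) (a : E →L[ℝ] ℝ) (b : E → E →L[ℝ] ℝ) :
    frameConn u v (t • a) b w = t • frameConn u v a b w := by
  ext z
  simp only [frameConn_apply, smul_apply, smul_eq_mul, Finset.mul_sum]
  exact Finset.sum_congr rfl fun r _ => by ring

theorem frameConn_add_right (a : E →L[ℝ] ℝ) (hb : DifferentiableAt ℝ b w)
    (hc : DifferentiableAt ℝ c w) :
    frameConn u v a (fun y => b y + c y) w = frameConn u v a b w + frameConn u v a c w := by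
  ext z
  simp only [frameConn_apply, add_apply, ← Finset.sum_add_distrib, lieCov_add hb hc]
  exact Finset.sum_congr rfl fun r _ => by ring

theorem frameConn_leibniz (a : E →L[ℝ] ℝ) (hf : DifferentiableAt ℝ f w)
    (hb : DifferentiableAt ℝ b w) :
    frameConn u v a (fun y => f y • b y) w =
      f w • frameConn u v a b w + frameEval u v a (fderiv ℝ f w) w • b w := by
  ext z
  simp only [frameConn_apply, add_apply, smul_apply, smul_eq_mul, frameEval, Finset.mul_sum,
    Finset.sum_mul, ← Finset.sum_add_distrib, lieCov_smul hf hb, lieFun]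
  exact Finset.sum_congr rfl fun r _ => by ring

theorem frameConnForm_add (a : E →L[ℝ] ℝ) (hσ : DifferentiableAt ℝ σ w)
    (hτ : DifferentiableAt ℝ τ w) :
    frameConnForm u v a (fun y => σ y + τ y) w =
      frameConnForm u v a σ w + frameConnForm u v a τ w := by
  ext z
  simp only [frameConnForm_apply, ContinuousAlternatingMap.add_apply, ← Finset.sum_add_distrib,
    lieForm_add hσ hτ]
  exact Finset.sum_congr rfl fun r _ => by ring

theorem frameConnForm_leibniz (a : E →L[ℝ] ℝ) (hf : DifferentiableAt ℝ f w)
    (hσ : DifferentiableAt ℝ σ w) :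
    frameConnForm u v a (fun y => f y • σ y) w =
      f w • frameConnForm u v a σ w + frameEval u v a (fderiv ℝ f w) w • σ w := by
  ext z
  simp only [frameConnForm_apply, ContinuousAlternatingMap.add_apply,
    ContinuousAlternatingMap.smul_apply, smul_eq_mul, frameEval, Finset.mul_sum,
    Finset.sum_mul, ← Finset.sum_add_distrib, lieForm_smul hf hσ, lieFun]
  exact Finset.sum_congr rfl fun r _ => by ring

theorem frameConnForm_covWedge [FiniteDimensional ℝ E] (a : E →L[ℝ] ℝ) (hb : ContDiffAt ℝ ∞ b w)
    (hc : ContDiffAt ℝ ∞ c w) :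
    frameConnForm u v a (fun y => covWedge (b y) (c y)) w =
      covWedge (frameConn u v a b w) (c w) + covWedge (b w) (frameConn u v a c w) := by
  refine alternating_two_ext fun y z => ?_
  simp only [frameConnForm_apply, ContinuousAlternatingMap.add_apply, lieForm_covWedge hb hc,
    covWedge_apply, frameConn_apply, Finset.mul_sum, Finset.sum_mul, ← Finset.sum_add_distrib,
    ← Finset.sum_sub_distrib]
  exact Finset.sum_congr rfl fun r _ => by ring

theorem frameBracket_symm (a b : E → E →L[ℝ] ℝ) :
    frameBracket u v a b w = frameBracket u v b a w := by
  refine alternating_two_ext fun y z => ?_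
  simp only [frameBracket_apply]
  exact Finset.sum_congr rfl fun r _ => by ring

theorem frameBracket_add_left (ha : DifferentiableAt ℝ a w) (hb : DifferentiableAt ℝ b w)
    (c : E → E →L[ℝ] ℝ) :
    frameBracket u v (fun y => a y + b y) c w = frameBracket u v a c w + frameBracket u v b c w := by
  refine alternating_two_ext fun y z => ?_
  simp only [frameBracket_apply, ContinuousAlternatingMap.add_apply, lieCov_add ha hb, add_apply,
    ← Finset.sum_add_distrib]
  exact Finset.sum_congr rfl fun r _ => by ring

theorem frameBracket_product (hf : DifferentiableAt ℝ f w) (ha : DifferentiableAt ℝ a w)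
    (b : E → E →L[ℝ] ℝ) :
    frameBracket u v (fun y => f y • a y) b w =
      f w • frameBracket u v a b w + covWedge (a w) (frameConn u v (fderiv ℝ f w) b w) := by
  refine alternating_two_ext fun y z => ?_
  simp only [frameBracket_apply, ContinuousAlternatingMap.add_apply, lieCov_smul hf ha, add_apply,
    ContinuousAlternatingMap.smul_apply, covWedge_apply, frameConn_apply, Finset.mul_sum, smul_apply,
    smul_eq_mul, ← Finset.sum_add_distrib, ← Finset.sum_sub_distrib, lieFun]
  exact Finset.sum_congr rfl fun r _ => by ring

/-! #### Identities that use commutation -/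

theorem fderiv_pairing {X : E → E} (hX : ContDiffAt ℝ ∞ X w) (ha : ContDiffAt ℝ ∞ a w) (z : E) :
    fderiv ℝ (fun y => a y (X y)) w z = fderiv ℝ a w z (X w) + a w (fderiv ℝ X w z) := by
  rw [fderiv_clm_apply ha.diff hX.diff]
  simp [add_comm]

/-- Cartan's formula `L_X b = X ⌟ db + d(b(X))` in each term: the contractions add up to `#a ⌟ db -
#b ⌟ da`, and the exact parts to the differential of `π(a, b)`. -/
theorem frameConn_torsion (H : IsCommutingFrame u v w)
    (ha : ContDiffAt ℝ ∞ a w) (hb : ContDiffAt ℝ ∞ b w) (z : E) :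
    frameConn u v (a w) b w z - frameConn u v (b w) a w z =
      dCov b w ![frameSharp u v (a w) w, z] - dCov a w ![frameSharp u v (b w) w, z] +
        fderiv ℝ (fun y => frameEval u v (a y) (b y) y) w z := by
  have hd : ∀ {X : E → E} {a : E → E →L[ℝ] ℝ}, ContDiffAt ℝ ∞ X w → ContDiffAt ℝ ∞ a w →
      DifferentiableAt ℝ (fun y => a y (X y)) w := fun hX ha => (ha.clm_apply hX).diff
  have h1 : fderiv ℝ (fun y => frameEval u v (a y) (b y) y) w z = ∑ r,
      ((fderiv ℝ a w z (u r w) + a w (fderiv ℝ (u r) w z)) * b w (v r w) +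
        a w (u r w) * (fderiv ℝ b w z (v r w) + b w (fderiv ℝ (v r) w z)) -
      ((fderiv ℝ a w z (v r w) + a w (fderiv ℝ (v r) w z)) * b w (u r w) +
        a w (v r w) * (fderiv ℝ b w z (u r w) + b w (fderiv ℝ (u r) w z)))) := by
    unfold frameEval
    rw [fderiv_fun_sum fun r _ => ((hd (H.smooth_left r) ha).fun_mul (hd (H.smooth_right r) hb)).fun_sub
      ((hd (H.smooth_right r) ha).fun_mul (hd (H.smooth_left r) hb)), sum_apply]
    refine Finset.sum_congr rfl fun r _ => ?_
    rw [fderiv_fun_sub ((hd (H.smooth_left r) ha).fun_mul (hd (H.smooth_right r) hb))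
      ((hd (H.smooth_right r) ha).fun_mul (hd (H.smooth_left r) hb)),
      fderiv_fun_mul (hd (H.smooth_left r) ha) (hd (H.smooth_right r) hb),
      fderiv_fun_mul (hd (H.smooth_right r) ha) (hd (H.smooth_left r) hb)]
    simp only [sub_apply, add_apply, smul_apply, smul_eq_mul, fderiv_pairing (H.smooth_left r) ha,
      fderiv_pairing (H.smooth_left r) hb, fderiv_pairing (H.smooth_right r) ha,
      fderiv_pairing (H.smooth_right r) hb]
    ring
  rw [h1, dCov_apply ha.diff, dCov_apply hb.diff]
  simp only [frameConn_apply, frameSharp, map_sum, map_sub, map_smul, sum_apply, sub_apply,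
    smul_apply, smul_eq_mul, ← Finset.sum_sub_distrib, ← Finset.sum_add_distrib, lieCov_apply]
  exact Finset.sum_congr rfl fun r _ => by ring

/-- The connection is invariant under a vector field commuting with the frame. -/
theorem lieCov_frameConn (H : IsCommutingFrame u v w)
    {X : E → E} (hX : ContDiffAt ℝ ∞ X w) (hu : ∀ r, CommuteNear X (u r) w)
    (hv : ∀ r, CommuteNear X (v r) w) (hb : ContDiffAt ℝ ∞ b w) (hc : ContDiffAt ℝ ∞ c w) :
    lieCov X (fun y => frameConn u v (b y) c y) w =
      frameConn u v (lieCov X b w) c w + frameConn u v (b w) (lieCov X c) w := by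
  have hterm : ∀ {Y Z : E → E}, ContDiffAt ℝ ∞ Y w → ContDiffAt ℝ ∞ Z w →
      ContDiffAt ℝ ∞ (fun y => b y (Y y) • lieCov Z c y) w := fun hY hZ =>
    (hb.clm_apply hY).smul (lieCov_contDiffAt hZ hc)
  -- Leibniz rule for a single term. Commutation with `Y` moves `L_X` inside the pairing `b(Y)`;
  -- commutation with `Z` exchanges `L_X` and `L_Z`.
  have hL : ∀ {Y Z : E → E}, ContDiffAt ℝ ∞ Y w → ContDiffAt ℝ ∞ Z w → CommuteNear X Y w →
      CommuteNear X Z w → ∀ z, lieCov X (fun y => b y (Y y) • lieCov Z c y) w z =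
      b w (Y w) * lieCov Z (lieCov X c) w z + lieCov X b w (Y w) * lieCov Z c w z := by
    intro Y Z hY hZ hXY hXZ z
    rw [lieCov_smul (hb.clm_apply hY).diff (lieCov_contDiffAt hZ hc).diff,
      lieFun_pairing hb.diff hY.diff hXY.self_of_nhds, lieCov_comm hX hZ hc hXZ]
    rfl
  have hsum : ∀ z, lieCov X (fun y => frameConn u v (b y) c y) w z = ∑ r,
      (lieCov X (fun y => b y (u r y) • lieCov (v r) c y) w z -
        lieCov X (fun y => b y (v r y) • lieCov (u r) c y) w z) := by
    intro z
    have h1 : ∀ r, DifferentiableAt ℝ (fun y => b y (u r y) • lieCov (v r) c y) w := fun r =>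
      (hterm (H.smooth_left r) (H.smooth_right r)).diff
    have h2 : ∀ r, DifferentiableAt ℝ (fun y => b y (v r y) • lieCov (u r) c y) w := fun r =>
      (hterm (H.smooth_right r) (H.smooth_left r)).diff
    simp only [lieCov_apply]
    unfold frameConn
    rw [fderiv_fun_sum fun r _ => (h1 r).fun_sub (h2 r)]
    simp only [fderiv_fun_sub (h1 _) (h2 _), sum_apply, sub_apply, ← Finset.sum_add_distrib]
    exact Finset.sum_congr rfl fun r _ => by ring
  ext z
  rw [hsum]
  simp only [hL (H.smooth_left _) (H.smooth_right _) (hu _) (hv _),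
    hL (H.smooth_right _) (H.smooth_left _) (hv _) (hu _), add_apply, frameConn_apply,
    ← Finset.sum_add_distrib]
  exact Finset.sum_congr rfl fun r _ => by ring

/-- In `D_a D_b c` the outer Lie derivatives act on `D_b c` by the Leibniz rule of
`lieCov_frameConn`. The terms that differentiate `b` form `D_{D_a b} c`; with the roles of `a` and
`b` exchanged, they are cancelled by the bracket `D_a b - D_b a`. The terms that differentiate `c`
twice cancel because the Lie derivatives commute. -/
theorem frameConn_flat (H : IsCommutingFrame u v w)
    (ha : ContDiffAt ℝ ∞ a w) (hb : ContDiffAt ℝ ∞ b w)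
    (hc : ContDiffAt ℝ ∞ c w) :
    frameConn u v (a w) (fun y => frameConn u v (b y) c y) w -
      frameConn u v (b w) (fun y => frameConn u v (a y) c y) w -
      frameConn u v (frameConn u v (a w) b w - frameConn u v (b w) a w) c w = 0 := by
  ext z
  have hLu : ∀ r {b : E → E →L[ℝ] ℝ}, ContDiffAt ℝ ∞ b w → _ := fun r b hb =>
    lieCov_frameConn H (H.smooth_left r) (H.comm_left r) (H.comm_mixed r) hb hc
  have hLv : ∀ r {b : E → E →L[ℝ] ℝ}, ContDiffAt ℝ ∞ b w → _ := fun r b hb =>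
    lieCov_frameConn H (H.smooth_right r) (fun s => (H.comm_mixed s r).symm) (H.comm_right r) hb hc
  have huu : ∀ r s, lieCov (u r) (lieCov (u s) c) w = lieCov (u s) (lieCov (u r) c) w := fun r s =>
    lieCov_comm (H.smooth_left r) (H.smooth_left s) hc (H.comm_left r s)
  have hvv : ∀ r s, lieCov (v r) (lieCov (v s) c) w = lieCov (v s) (lieCov (v r) c) w := fun r s =>
    lieCov_comm (H.smooth_right r) (H.smooth_right s) hc (H.comm_right r s)
  have huv : ∀ r s, lieCov (u r) (lieCov (v s) c) w = lieCov (v s) (lieCov (u r) c) w := fun r s =>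
    lieCov_comm (H.smooth_left r) (H.smooth_right s) hc (H.comm_mixed r s)
  rw [sub_apply, sub_apply, frameConn_sub_left, frameConn_apply, frameConn_apply (b w) _ z]
  simp only [hLu _ ha, hLu _ hb, hLv _ ha, hLv _ hb, add_apply, sub_apply, frameConn_apply,
    mul_add, Finset.mul_sum, Finset.sum_mul, ← Finset.sum_sub_distrib, ← Finset.sum_add_distrib,
    zero_apply]
  refine sum_sum_eq_zero_of_antisymm fun r s => ?_
  simp only [huv]
  rw [huu s r, hvv s r]
  ring

theorem lieForm_sum {κ : Type*} (s : Finset κ) {X : E → E} {η : κ → E → E [⋀^Fin 2]→L[ℝ] ℝ}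
    (hη : ∀ r ∈ s, DifferentiableAt ℝ (η r) w) :
    lieForm X (fun y => ∑ r ∈ s, η r y) w = ∑ r ∈ s, lieForm X (η r) w := by
  refine alternating_two_ext fun y z => ?_
  simp only [lieForm_two, fderiv_fun_sum hη, sum_apply, ContinuousAlternatingMap.sum_apply,
    Finset.sum_add_distrib]

theorem lieForm_sub {X : E → E} (hσ : DifferentiableAt ℝ σ w) (hτ : DifferentiableAt ℝ τ w) :
    lieForm X (fun y => σ y - τ y) w = lieForm X σ w - lieForm X τ w := by
  refine alternating_two_ext fun y z => ?_
  simp only [lieForm_two, fderiv_fun_sub hσ hτ, sub_apply, ContinuousAlternatingMap.sub_apply]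
  ring

/-- `L_X` is a derivation of the wedge product and commutes with each `L_{uᵣ}` and `L_{vᵣ}`. -/
theorem lieForm_frameBracket [FiniteDimensional ℝ E] (H : IsCommutingFrame u v w) {X : E → E}
    (hX : ContDiffAt ℝ ∞ X w) (hu : ∀ r, CommuteNear X (u r) w) (hv : ∀ r, CommuteNear X (v r) w)
    (ha : ContDiffAt ℝ ∞ a w) (hb : ContDiffAt ℝ ∞ b w) :
    lieForm X (frameBracket u v a b) w =
      frameBracket u v (lieCov X a) b w + frameBracket u v a (lieCov X b) w := by
  have hau := fun r => lieCov_contDiffAt (H.smooth_left r) ha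
  have hav := fun r => lieCov_contDiffAt (H.smooth_right r) ha
  have hbu := fun r => lieCov_contDiffAt (H.smooth_left r) hb
  have hbv := fun r => lieCov_contDiffAt (H.smooth_right r) hb
  unfold frameBracket
  rw [lieForm_sum _ fun r _ => (((hau r).covWedge (hbv r)).sub ((hav r).covWedge (hbu r))).diff,
    ← Finset.sum_add_distrib]
  refine Finset.sum_congr rfl fun r _ => ?_
  rw [lieForm_sub ((hau r).covWedge (hbv r)).diff ((hav r).covWedge (hbu r)).diff,
    lieForm_covWedge (hau r) (hbv r), lieForm_covWedge (hav r) (hbu r),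
    lieCov_comm hX (H.smooth_left r) ha (hu r), lieCov_comm hX (H.smooth_right r) ha (hv r),
    lieCov_comm hX (H.smooth_left r) hb (hu r), lieCov_comm hX (H.smooth_right r) hb (hv r)]
  abel

/-- Each term of `D_{df} b` is `(u f) L_v b` up to sign and exchange of `u` and `v`. Its
differential is `L_u df ∧ L_v b + (u f) L_v db`; the first summand is what dictates the formula for
the bracket of `1`-forms. -/
theorem frameConn_fderiv_leibniz [FiniteDimensional ℝ E] (H : IsCommutingFrame u v w)
    (hf : ContDiffAt ℝ ∞ f w) (hb : ContDiffAt ℝ ∞ b w) :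
    dCov (fun y => frameConn u v (fderiv ℝ f y) b y) w =
      frameBracket u v (fderiv ℝ f) b w + frameConnForm u v (fderiv ℝ f w) (dCov b) w := by
  have hfu := fun r => lieFun_contDiffAt (H.smooth_left r) hf
  have hfv := fun r => lieFun_contDiffAt (H.smooth_right r) hf
  have hbu := fun r => lieCov_contDiffAt (H.smooth_left r) hb
  have hbv := fun r => lieCov_contDiffAt (H.smooth_right r) hb
  have h1 : ∀ r, DifferentiableAt ℝ (fun y => lieFun (u r) f y • lieCov (v r) b y) w := fun r =>
    ((hfu r).smul (hbv r)).diff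
  have h2 : ∀ r, DifferentiableAt ℝ (fun y => lieFun (v r) f y • lieCov (u r) b y) w := fun r =>
    ((hfv r).smul (hbu r)).diff
  have h0 : DifferentiableAt ℝ (fun y => frameConn u v (fderiv ℝ f y) b y) w :=
    (frameConn_contDiffAt H hf.fderiv_infty hb).diff
  refine alternating_two_ext fun y z => ?_
  have h3 : dCov (fun y => frameConn u v (fderiv ℝ f y) b y) w ![y, z] = ∑ r,
      (dCov (fun y => lieFun (u r) f y • lieCov (v r) b y) w ![y, z] -
        dCov (fun y => lieFun (v r) f y • lieCov (u r) b y) w ![y, z]) := by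
    rw [dCov_apply h0]
    simp only [dCov_apply (h1 _), dCov_apply (h2 _)]
    have : fderiv ℝ (fun y => frameConn u v (fderiv ℝ f y) b y) w = ∑ r, fderiv ℝ (fun y =>
        lieFun (u r) f y • lieCov (v r) b y - lieFun (v r) f y • lieCov (u r) b y) w :=
      fderiv_fun_sum (u := Finset.univ) fun r _ => (h1 r).fun_sub (h2 r)
    rw [this]
    simp only [fderiv_fun_sub (h1 _) (h2 _), sum_apply, sub_apply, ← Finset.sum_sub_distrib]
    exact Finset.sum_congr rfl fun r _ => by ring
  rw [h3]
  simp only [dCov_smul (hfu _).diff (hbv _).diff, dCov_smul (hfv _).diff (hbu _).diff,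
    fderiv_lieFun (H.smooth_left _).diff hf, fderiv_lieFun (H.smooth_right _).diff hf,
    dCov_lieCov (H.smooth_left _) hb, dCov_lieCov (H.smooth_right _) hb,
    ContinuousAlternatingMap.add_apply, ContinuousAlternatingMap.smul_apply, covWedge_apply,
    frameBracket_apply, frameConnForm_apply, smul_eq_mul, ← Finset.sum_add_distrib]
  exact Finset.sum_congr rfl fun r _ => by simp only [lieFun]; ring

/-- The operators `L_{uᵣ}` and `L_{vᵣ}` act as derivations on the bracket and on `D`, so the terms
in which `df` is not differentiated cancel. The others carry coefficients of the type `(L_{uᵣ}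
df)(uₛ) = uₛ uᵣ f`, whose symmetry makes the remaining double sum antisymmetric. -/
theorem frameBracket_metacurvature [FiniteDimensional ℝ E] (H : IsCommutingFrame u v w)
    (hf : ContDiffAt ℝ ∞ f w) (hb : ContDiffAt ℝ ∞ b w) (hc : ContDiffAt ℝ ∞ c w) :
    frameConnForm u v (fderiv ℝ f w) (frameBracket u v b c) w -
      frameBracket u v (fun y => frameConn u v (fderiv ℝ f y) b y) c w -
      frameBracket u v (fun y => frameConn u v (fderiv ℝ f y) c y) b w = 0 := by
  have hD : ∀ r {b : E → E →L[ℝ] ℝ}, ContDiffAt ℝ ∞ b w → _ := fun r b hb =>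
    lieCov_frameConn H (H.smooth_left r) (H.comm_left r) (H.comm_mixed r) hf.fderiv_infty hb
  have hD' : ∀ r {b : E → E →L[ℝ] ℝ}, ContDiffAt ℝ ∞ b w → _ := fun r b hb =>
    lieCov_frameConn H (H.smooth_right r) (fun s => (H.comm_mixed s r).symm) (H.comm_right r)
      hf.fderiv_infty hb
  have hB : ∀ r, _ := fun r =>
    lieForm_frameBracket H (H.smooth_left r) (H.comm_left r) (H.comm_mixed r) hb hc
  have hB' : ∀ r, _ := fun r =>
    lieForm_frameBracket H (H.smooth_right r) (fun s => (H.comm_mixed s r).symm) (H.comm_right r)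
      hb hc
  -- Both sides are second derivatives of `f` along the two fields, taken in opposite orders; the
  -- three relations cover the pairs of left and right factors.
  have hdf : ∀ r s, lieCov (u r) (fderiv ℝ f) w (u s w) = lieCov (u s) (fderiv ℝ f) w (u r w) := by
    intro r s
    rw [lieCov_apply, lieCov_apply, hf.fderiv_fderiv_symm, (H.comm_left r s).self_of_nhds]
  have hdf' : ∀ r s, lieCov (v r) (fderiv ℝ f) w (v s w) =
      lieCov (v s) (fderiv ℝ f) w (v r w) := by
    intro r s
    rw [lieCov_apply, lieCov_apply, hf.fderiv_fderiv_symm, (H.comm_right r s).self_of_nhds]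
  have hdfm : ∀ r s, lieCov (u r) (fderiv ℝ f) w (v s w) =
      lieCov (v s) (fderiv ℝ f) w (u r w) := by
    intro r s
    rw [lieCov_apply, lieCov_apply, hf.fderiv_fderiv_symm, (H.comm_mixed r s).self_of_nhds]
  have hc' : ∀ {X Y : E → E}, ContDiffAt ℝ ∞ X w → ContDiffAt ℝ ∞ Y w → CommuteNear X Y w →
      ∀ {b : E → E →L[ℝ] ℝ}, ContDiffAt ℝ ∞ b w →
        lieCov X (lieCov Y b) w = lieCov Y (lieCov X b) w := fun hX hY hXY b hb =>
    lieCov_comm hX hY hb hXY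
  have huu := fun r s => @hc' _ _ (H.smooth_left r) (H.smooth_left s) (H.comm_left r s)
  have hvv := fun r s => @hc' _ _ (H.smooth_right r) (H.smooth_right s) (H.comm_right r s)
  have huv := fun r s => @hc' _ _ (H.smooth_left r) (H.smooth_right s) (H.comm_mixed r s)
  refine alternating_two_ext fun y z => ?_
  simp only [ContinuousAlternatingMap.sub_apply, ContinuousAlternatingMap.coe_zero, Pi.zero_apply,
    frameConnForm_apply, frameBracket_apply, hB, hB', hD _ hb, hD' _ hb, hD _ hc, hD' _ hc,
    ContinuousAlternatingMap.add_apply, add_apply, frameConn_apply,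
    mul_add, add_mul, Finset.mul_sum, Finset.sum_mul, ← Finset.sum_sub_distrib,
    ← Finset.sum_add_distrib]
  refine sum_sum_eq_zero_of_antisymm fun r s => ?_
  simp only [huv _ _ hb, huv _ _ hc, hdfm]
  rw [huu s r hb, hvv s r hb, huu s r hc, hvv s r hc, hdf s r, hdf' s r]
  ring

/-- Exact forms are closed, so the torsion formula reduces to `d{h, k} = D_{dh} dk - D_{dk} dh`. -/
theorem fderiv_frameEval_fderiv (H : IsCommutingFrame u v w) (hh : ContDiffAt ℝ ∞ h w)
    (hk : ContDiffAt ℝ ∞ k w) :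
    fderiv ℝ (fun y => frameEval u v (fderiv ℝ h y) (fderiv ℝ k y) y) w =
      frameConn u v (fderiv ℝ h w) (fderiv ℝ k) w - frameConn u v (fderiv ℝ k w) (fderiv ℝ h) w := by
  have hd : ∀ {h : E → ℝ}, ContDiffAt ℝ ∞ h w → ∀ y z, dCov (fderiv ℝ h) w ![y, z] = 0 := by
    intro h hh y z
    rw [dCov_apply hh.fderiv_infty.diff, hh.fderiv_fderiv_symm, sub_self]
  ext z
  rw [sub_apply, frameConn_torsion H hh.fderiv_infty hk.fderiv_infty, hd hh, hd hk]
  ring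

/-- Once the inner differentials are expressed by `D`, each term contains one second derivative of a
function along two frame fields. These are symmetric because the fields commute, and the cyclic sum
cancels in pairs. -/
theorem frameEval_jacobi (H : IsCommutingFrame u v w) (hf : ContDiffAt ℝ ∞ f w)
    (hh : ContDiffAt ℝ ∞ h w) (hk : ContDiffAt ℝ ∞ k w) :
    frameEval u v (fderiv ℝ f w)
        (fderiv ℝ (fun y => frameEval u v (fderiv ℝ h y) (fderiv ℝ k y) y) w) w +
      frameEval u v (fderiv ℝ h w)
        (fderiv ℝ (fun y => frameEval u v (fderiv ℝ k y) (fderiv ℝ f y) y) w) w +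
      frameEval u v (fderiv ℝ k w)
        (fderiv ℝ (fun y => frameEval u v (fderiv ℝ f y) (fderiv ℝ h y) y) w) w = 0 := by
  have hdf : ∀ {f : E → ℝ}, ContDiffAt ℝ ∞ f w → ∀ r s,
      lieCov (u r) (fderiv ℝ f) w (u s w) = lieCov (u s) (fderiv ℝ f) w (u r w) := by
    intro f hf r s
    rw [lieCov_apply, lieCov_apply, hf.fderiv_fderiv_symm, (H.comm_left r s).self_of_nhds]
  have hdf' : ∀ {f : E → ℝ}, ContDiffAt ℝ ∞ f w → ∀ r s,
      lieCov (v r) (fderiv ℝ f) w (v s w) = lieCov (v s) (fderiv ℝ f) w (v r w) := by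
    intro f hf r s
    rw [lieCov_apply, lieCov_apply, hf.fderiv_fderiv_symm, (H.comm_right r s).self_of_nhds]
  have hdfm : ∀ {f : E → ℝ}, ContDiffAt ℝ ∞ f w → ∀ r s,
      lieCov (u r) (fderiv ℝ f) w (v s w) = lieCov (v s) (fderiv ℝ f) w (u r w) := by
    intro f hf r s
    rw [lieCov_apply, lieCov_apply, hf.fderiv_fderiv_symm, (H.comm_mixed r s).self_of_nhds]
  rw [fderiv_frameEval_fderiv H hf hh, fderiv_frameEval_fderiv H hh hk,
    fderiv_frameEval_fderiv H hk hf]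
  simp only [frameEval, sub_apply, frameConn_apply, Finset.mul_sum,
    ← Finset.sum_sub_distrib, ← Finset.sum_add_distrib, hdfm hf, hdfm hh, hdfm hk]
  refine sum_sum_eq_zero_of_antisymm fun r s => ?_
  rw [hdf hf s r, hdf hh s r, hdf hk s r, hdf' hf s r, hdf' hh s r, hdf' hk s r]
  ring

end FrameCalculus
end

noncomputable section

/-! ### Interior products and Cartan's formula -/

section Cartan

variable {E : Type*} [NormedAddCommGroup E] [NormedSpace ℝ E] [FiniteDimensional ℝ E] {k : ℕ}
  {X Y : E → E} {η : E → E [⋀^Fin (k + 1)]→L[ℝ] ℝ} {w : E}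

/-- The interior product of a vector field with a form. -/
def interiorProduct (X : E → E) (η : E → E [⋀^Fin (k + 1)]→L[ℝ] ℝ) (w : E) : E [⋀^Fin k]→L[ℝ] ℝ :=
  (η w).curryLeft (X w)

theorem interiorProduct_apply (z : Fin k → E) :
    interiorProduct X η w z = η w (Matrix.vecCons (X w) z) := rfl

theorem interiorProduct_contDiffAt (hX : ContDiffAt ℝ ∞ X w) (hη : ContDiffAt ℝ ∞ η w) :
    ContDiffAt ℝ ∞ (interiorProduct X η) w :=
  contDiffAt_alternating fun z => hη.alternating_apply (v := Fin.cons X fun i _ => z i)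
    (Fin.cases hX fun _ => contDiffAt_const) |>.congr_of_eventuallyEq
      (Filter.Eventually.of_forall fun y => by
        refine congrArg (η y) (funext fun i => ?_)
        refine Fin.cases rfl (fun _ => rfl) i)

theorem fderiv_interiorProduct (hX : ContDiffAt ℝ ∞ X w) (hη : ContDiffAt ℝ ∞ η w) (d : E)
    (z : Fin k → E) : fderiv ℝ (interiorProduct X η) w d z =
      fderiv ℝ η w d (Matrix.vecCons (X w) z) + η w (Matrix.vecCons (fderiv ℝ X w d) z) := by
  rw [fderiv_form_apply (interiorProduct_contDiffAt hX hη).diff]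
  have h1 : (fun y => interiorProduct X η y z) =
      fun y => η y (fun i => (Fin.cons X (fun i _ => z i) : Fin (k + 1) → E → E) i y) := by
    funext y
    rw [interiorProduct_apply]
    congr 1
    funext i
    refine Fin.cases rfl (fun _ => rfl) i
  have h2 : ∀ i, DifferentiableAt ℝ ((Fin.cons X (fun i _ => z i) : Fin (k + 1) → E → E) i) w :=
    Fin.cases hX.diff fun _ => differentiableAt_const _
  rw [h1, fderiv_continuousAlternatingMap_apply_apply hη.diff h2, Fin.sum_univ_succ]
  have h3 : (fun i => (Fin.cons X (fun i _ => z i) : Fin (k + 1) → E → E) i w) =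
      Matrix.vecCons (X w) z := by
    funext i
    refine Fin.cases rfl (fun _ => rfl) i
  simp only [h3]
  -- The entries other than the first are constant, so their derivatives put a zero vector in a
  -- slot.
  have h4 : ∀ i : Fin k, η w (Function.update (Matrix.vecCons (X w) z) i.succ
      (fderiv ℝ ((Fin.cons X (fun i _ => z i) : Fin (k + 1) → E → E) i.succ) w d)) = 0 := by
    intro i
    refine (η w).map_coord_zero i.succ ?_
    simp
  have h5 : η w (Function.update (Matrix.vecCons (X w) z) 0
      (fderiv ℝ ((Fin.cons X (fun i _ => z i) : Fin (k + 1) → E → E) 0) w d)) =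
      η w (Matrix.vecCons (fderiv ℝ X w d) z) :=
    congrArg (η w) (Fin.update_cons_zero _ _ _)
  rw [Finset.sum_eq_zero fun i _ => h4 i, h5]
  ring

/-- Cartan's formula. In the alternating sum for `dη(X, z)` the slot of `X` gives the derivative of
`η` along `X`, and the other slots give the derivatives of `η` occurring in `d(X ⌟ η)`, with the
opposite sign. The derivatives of `X` supply the remaining terms of `L_X η`. -/
theorem extDeriv_interiorProduct (hX : ContDiffAt ℝ ∞ X w) (hη : ContDiffAt ℝ ∞ η w) :
    extDeriv (interiorProduct X η) w = lieForm X η w - (extDeriv η w).curryLeft (X w) := by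
  ext z
  -- The sign is that of moving the first vector past `i` others into its own slot.
  have h1 : ∀ i : Fin (k + 1), (-1 : ℝ) ^ (i : ℕ) •
      η w (Matrix.vecCons (fderiv ℝ X w (z i)) (i.removeNth z)) =
      η w (Function.update z i (fderiv ℝ X w (z i))) := by
    intro i
    rw [← Fin.insertNth_removeNth]
    have := AlternatingMap.map_insertNth (η w).toAlternatingMap i (fderiv ℝ X w (z i))
      (i.removeNth z)
    refine Eq.trans ?_ this.symm
    norm_num
  have hd := hη.diff
  rw [ContinuousAlternatingMap.sub_apply, lieForm_apply,
    ContinuousAlternatingMap.curryLeft_apply_apply, extDeriv_apply hη.diff,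
    extDeriv_apply (interiorProduct_contDiffAt hX hη).diff,
    Fin.sum_univ_succ (n := k + 1)]
  simp only [← fderiv_form_apply hη.diff, ← fderiv_form_apply (interiorProduct_contDiffAt hX hη).diff,
    fderiv_interiorProduct hX hη, smul_add, Finset.sum_add_distrib]
  have h2 : ∀ i : Fin (k + 1), Fin.removeNth i.succ (Matrix.vecCons (X w) z) =
      Matrix.vecCons (X w) (i.removeNth z) := by
    intro i
    funext j
    refine Fin.cases ?_ (fun j => ?_) j
    · simp [Fin.removeNth]
    · simp [Fin.removeNth]
  have h3 : Fin.removeNth 0 (Matrix.vecCons (X w) z) = z := by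
    funext j
    simp [Fin.removeNth]
  simp only [h2, h3, Matrix.cons_val_zero, Matrix.cons_val_succ, Fin.val_succ, pow_succ, Fin.val_zero,
    pow_zero, one_smul, mul_neg, mul_one, neg_smul, Finset.sum_neg_distrib]
  simp only [smul_eq_mul] at h1
  simp only [← h1]
  ring_nf

/-- `L_Y (X ⌟ η) = X ⌟ L_Y η + [Y, X] ⌟ η`. The derivative of `X` along `Y` is exchanged for that of
`Y` along `X`, which is the slot-zero term of `L_Y η`. -/
theorem lieForm_interiorProduct (hX : ContDiffAt ℝ ∞ X w) (hη : ContDiffAt ℝ ∞ η w)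
    (hXY : fderiv ℝ X w (Y w) = fderiv ℝ Y w (X w)) :
    lieForm Y (interiorProduct X η) w = (lieForm Y η w).curryLeft (X w) := by
  ext z
  rw [ContinuousAlternatingMap.curryLeft_apply_apply, lieForm_apply, lieForm_apply,
    fderiv_interiorProduct hX hη, Fin.sum_univ_succ, hXY]
  simp only [Matrix.cons_val_zero, Matrix.cons_val_succ, interiorProduct_apply]
  have h1 : Function.update (Matrix.vecCons (X w) z) 0 (fderiv ℝ Y w (X w)) =
      Matrix.vecCons (fderiv ℝ Y w (X w)) z := by
    simp [Matrix.vecCons, Fin.update_cons_zero]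
  have h2 : ∀ i : Fin k, Function.update (Matrix.vecCons (X w) z) i.succ (fderiv ℝ Y w (z i)) =
      Matrix.vecCons (X w) (Function.update z i (fderiv ℝ Y w (z i))) := by
    intro i
    simp [Matrix.vecCons, Fin.cons_update]
  rw [h1, add_assoc]
  simp only [h2]

/-- The contraction of a closed form with two commuting fields that preserve it is closed. -/
theorem extDeriv_interiorProduct_interiorProduct {η : E → E [⋀^Fin (k + 2)]→L[ℝ] ℝ}
    (hX : ContDiffAt ℝ ∞ X w) (hY : ContDiffAt ℝ ∞ Y w) (hη : ContDiffAt ℝ ∞ η w)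
    (hXY : fderiv ℝ X w (Y w) = fderiv ℝ Y w (X w)) (hd : extDeriv η w = 0)
    (hLX : lieForm X η w = 0) (hLY : lieForm Y η w = 0) :
    extDeriv (interiorProduct Y (interiorProduct X η)) w = 0 := by
  -- With two uses of Cartan's formula the derivative becomes `X ⌟ L_Y η - Y ⌟ (L_X η - X ⌟ dη)`,
  -- where every term vanishes.
  rw [extDeriv_interiorProduct hY (interiorProduct_contDiffAt hX hη), lieForm_interiorProduct hX hη hXY,
    extDeriv_interiorProduct hX hη, hd, hLX, hLY]
  ext z
  simp

/-- With `n` one more than the dimension, this makes a volume form closed. -/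
theorem alternating_eq_zero_of_finrank_lt {n : ℕ} (h : Module.finrank ℝ E < n)
    (σ : E [⋀^Fin n]→L[ℝ] ℝ) : σ = 0 := by
  ext v
  refine (σ.toAlternatingMap).map_linearDependent v fun hv => ?_
  have := hv.fintype_card_le_finrank
  simp at this
  omega

end Cartan

/-! ### Killing fields -/

section Killing

variable {E : Type*} [NormedAddCommGroup E] [NormedSpace ℝ E] [FiniteDimensional ℝ E]
  {X : E → E} {G : E → E →L[ℝ] E →L[ℝ] ℝ} {w : E}

/-- The Lie derivative of the bilinear form `G` along `X` vanishes at `w`. -/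
def IsKillingAt (G : E → E →L[ℝ] E →L[ℝ] ℝ) (X : E → E) (w : E) : Prop :=
  ∀ y z, fderiv ℝ G w (X w) y z + G w (fderiv ℝ X w y) z + G w y (fderiv ℝ X w z) = 0

/-- The bilinear form on covectors induced by a nondegenerate bilinear form. -/
def covInner (B : E →L[ℝ] E →L[ℝ] ℝ) (a b : E →L[ℝ] ℝ) : ℝ := B (B.inverse a) (B.inverse b)

theorem covInner_contDiffAt {a b : E → E →L[ℝ] ℝ} (hG : ContDiffAt ℝ ∞ G w)
    (hw : (G w).IsInvertible) (ha : ContDiffAt ℝ ∞ a w) (hb : ContDiffAt ℝ ∞ b w) :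
    ContDiffAt ℝ ∞ (fun y => covInner (G y) (a y) (b y)) w := by
  have hi : ContDiffAt ℝ ∞ (fun y => (G y).inverse) w := by
    obtain ⟨e, he⟩ := hw
    have h1 := contDiffAt_map_inverse (𝕜 := ℝ) (n := ∞) e
    rw [he] at h1
    exact h1.comp w hG
  exact (hG.clm_apply (hi.clm_apply ha)).clm_apply (hi.clm_apply hb)

/-- Raising indices commutes with the Lie derivative along a Killing field, so such a field also
preserves the metric on covectors. -/
theorem lieFun_covInner {a b : E → E →L[ℝ] ℝ} (hG : ContDiffAt ℝ ∞ G w)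
    (hw : (G w).IsInvertible) (hK : IsKillingAt G X w) (ha : ContDiffAt ℝ ∞ a w)
    (hb : ContDiffAt ℝ ∞ b w) :
    lieFun X (fun y => covInner (G y) (a y) (b y)) w =
      covInner (G w) (lieCov X a w) (b w) + covInner (G w) (a w) (lieCov X b w) := by
  have hi : ContDiffAt ℝ ∞ (fun y => (G y).inverse) w := by
    obtain ⟨e, he⟩ := hw
    have h1 := contDiffAt_map_inverse (𝕜 := ℝ) (n := ∞) e
    rw [he] at h1
    exact h1.comp w hG
  have hev : ∀ᶠ y in 𝓝 w, (G y).IsInvertible := by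
    obtain ⟨e, he⟩ := hw
    exact hG.continuousAt.eventually (by rw [← he]; exact e.nhds)
  have key : ∀ {a : E → E →L[ℝ] ℝ}, ContDiffAt ℝ ∞ a w →
      fderiv ℝ (fun y => (G y).inverse (a y)) w (X w) =
        (G w).inverse (lieCov X a w) + fderiv ℝ X w ((G w).inverse (a w)) := by
    intro a ha
    set s : E → E := fun y => (G y).inverse (a y) with hs
    have hsd : DifferentiableAt ℝ s w := (hi.clm_apply ha).diff
    have h1 : (fun y => G y (s y)) =ᶠ[𝓝 w] a := hev.mono fun y hy => by
      obtain ⟨e, he⟩ := hy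
      simp [hs, ← he]
    have h2 := h1.fderiv_eq (𝕜 := ℝ)
    rw [fderiv_clm_apply hG.diff hsd] at h2
    -- For `a = G s` the Killing equation turns `L_X (G s)` into `G [X, s]`.
    have h3 : lieCov X a w = G w (fderiv ℝ s w (X w) - fderiv ℝ X w (s w)) := by
      ext z
      rw [lieCov_apply, ← h2, ← h1.self_of_nhds]
      have := hK (s w) z
      simp only [add_apply, ContinuousLinearMap.comp_apply, ContinuousLinearMap.flip_apply, map_sub,
        sub_apply]
      linarith
    obtain ⟨e, he⟩ := hw
    rw [h3, ← he]
    simp [hs, ← he]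
  unfold lieFun covInner
  have hsa := (hi.clm_apply ha)
  have hsb := (hi.clm_apply hb)
  rw [fderiv_clm_apply (hG.clm_apply hsa).diff hsb.diff, fderiv_clm_apply hG.diff hsa.diff]
  have := hK ((G w).inverse (a w)) ((G w).inverse (b w))
  simp only [add_apply, ContinuousLinearMap.comp_apply, ContinuousLinearMap.flip_apply, key ha,
    key hb, map_add]
  linarith

/-- The part of `L_X σ` that involves the derivative of `X` is obtained by moving all arguments
along `id + tA`. In this form it can be compared with a variation of Gram determinants. -/
theorem hasDerivAt_alternating_flow {n : ℕ} (σ : E [⋀^Fin n]→L[ℝ] ℝ) (A : E →L[ℝ] E)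
    (z : Fin n → E) : HasDerivAt (fun t : ℝ => σ (fun i => z i + t • A (z i)))
      (∑ i, σ (Function.update z i (A (z i)))) 0 := by
  have h1 : HasDerivAt (fun t : ℝ => fun i => z i + t • A (z i)) (fun i => A (z i)) 0 := by
    refine hasDerivAt_pi.2 fun i => ?_
    simpa using ((hasDerivAt_id (0 : ℝ)).smul_const (A (z i))).const_add (z i)
  have h2 := (σ.hasFDerivAt (fun i => z i + (0 : ℝ) • A (z i))).comp_hasDerivAt (0 : ℝ) h1
  simpa [ContinuousMultilinearMap.linearDeriv_apply, Function.comp_def] using h2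

/-- A kernel vector of the Gram matrix is a combination of the basis orthogonal to the whole space,
hence zero by nondegeneracy. -/
theorem det_bilin_ne_zero {n : ℕ} {B : E →L[ℝ] E →L[ℝ] ℝ} (hB : B.IsInvertible)
    (hn : Module.finrank ℝ E = n) {z : Fin n → E} (hz : LinearIndependent ℝ z) :
    Matrix.det (Matrix.of fun i j => B (z i) (z j)) ≠ 0 := by
  intro h0
  obtain ⟨c, hc, hc0⟩ := Matrix.exists_mulVec_eq_zero_iff.2 h0
  have h1 : ∀ i, B (z i) (∑ j, c j • z j) = 0 := fun i => by
    have := congrFun hc0 i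
    simp only [Matrix.mulVec, dotProduct, Matrix.of_apply, Pi.zero_apply] at this
    simpa [map_sum, mul_comm] using this
  have h2 : ∀ y, B y (∑ j, c j • z j) = 0 := by
    intro y
    have hy : y ∈ Submodule.span ℝ (Set.range z) := by
      rw [hz.span_eq_top_of_card_eq_finrank' (by simp [hn])]; trivial
    induction hy using Submodule.span_induction with
    | mem x hx => obtain ⟨i, rfl⟩ := hx; exact h1 i
    | zero => simp
    | add x y _ _ hx hy => rw [map_add, add_apply, hx, hy, add_zero]
    | smul t x _ hx => rw [map_smul, smul_apply, hx, smul_zero]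
  have h3 : ∑ j, c j • z j = 0 := by
    obtain ⟨e, he⟩ := hB
    by_contra hne
    obtain ⟨φ, hφ⟩ := SeparatingDual.exists_ne_zero (R := ℝ) hne
    apply hφ
    rw [← h2 (e.symm φ), ← he]
    simp
  exact hc (funext fun j => Fintype.linearIndependent_iff.1 hz c h3 j)

/-- A Killing field preserves the volume form. -/
theorem lieForm_volume {n : ℕ} {η : E → E [⋀^Fin n]→L[ℝ] ℝ} (hn : Module.finrank ℝ E = n)
    (hG : ContDiffAt ℝ ∞ G w) (hw : (G w).IsInvertible)
    (hK : IsKillingAt G X w) (hη : ContDiffAt ℝ ∞ η w)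
    (hsq : ∀ᶠ y in 𝓝 w, ∀ v : Fin n → E,
      (η y v) ^ 2 = |Matrix.det (Matrix.of fun i j => G y (v i) (v j))|) :
    lieForm X η w = 0 := by
  set A := fderiv ℝ X w with hA
  ext z
  rw [lieForm_apply, ← hA]
  -- On a basis one differentiates `η(z)² = |det G(zᵢ, zⱼ)|`; on a dependent family the two parts of
  -- `L_X η` vanish separately.
  by_cases hz : LinearIndependent ℝ z
  · let D : (Fin n → Fin n → ℝ) → ℝ := fun m => Matrix.det (Matrix.of m)
    have hD : Differentiable ℝ D := by
      simp only [D, Matrix.det_apply]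
      simp only [Matrix.of_apply]
      fun_prop
    set m₀ : Fin n → Fin n → ℝ := fun i j => G w (z i) (z j) with hm₀
    have hdet : D m₀ ≠ 0 := det_bilin_ne_zero hw hn hz
    -- The constant `s` is the sign of the determinant, locally constant where it is nonzero; it
    -- replaces the absolute value by a differentiable function.
    obtain ⟨s, hs⟩ : ∃ s : ℝ, ∀ᶠ m in 𝓝 m₀, |D m| = s * D m := by
      rcases lt_or_gt_of_ne hdet with h | h
      · refine ⟨-1, (hD.continuous.continuousAt.eventually_lt continuousAt_const h).mono
          fun m hm => ?_⟩
        rw [abs_of_neg hm]; ring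
      · refine ⟨1, (continuousAt_const.eventually_lt hD.continuous.continuousAt h).mono
          fun m hm => ?_⟩
        rw [abs_of_pos hm]; ring
    have hz0 : η w z ≠ 0 := by
      intro h0
      have := hsq.self_of_nhds z
      rw [h0] at this
      exact hdet (abs_eq_zero.1 (by simpa using this.symm))
    have hline : HasDerivAt (fun t : ℝ => w + t • X w) (X w) 0 := by
      simpa using ((hasDerivAt_id (0 : ℝ)).smul_const (X w)).const_add w
    have hline0 : w + (0 : ℝ) • X w = w := by simp
    -- the derivative along `X`
    have hm1 : HasDerivAt (fun t : ℝ => fun i j => G (w + t • X w) (z i) (z j))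
        (fun i j => fderiv ℝ G w (X w) (z i) (z j)) 0 := by
      refine hasDerivAt_pi.2 fun i => hasDerivAt_pi.2 fun j => ?_
      have h1 : HasFDerivAt (fun y => G y (z i) (z j)) (fderiv ℝ (fun y => G y (z i) (z j)) w)
          (w + (0 : ℝ) • X w) := by
        rw [hline0]
        exact ((hG.clm_apply contDiffAt_const).clm_apply contDiffAt_const).diff.hasFDerivAt
      have h2 := h1.comp_hasDerivAt (0 : ℝ) hline
      rw [fderiv_clm_apply (hG.clm_apply contDiffAt_const).diff (differentiableAt_const _),
        fderiv_clm_apply hG.diff (differentiableAt_const _)] at h2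
      simpa [Function.comp_def] using h2
    -- The second variation keeps the point and moves the vectors by `id + tA`. The Killing equation
    -- says that the velocities of the two Gram matrices are opposite.
    have hm2 : HasDerivAt (fun t : ℝ => fun i j => G w (z i + t • A (z i)) (z j + t • A (z j)))
        (fun i j => G w (A (z i)) (z j) + G w (z i) (A (z j))) 0 := by
      refine hasDerivAt_pi.2 fun i => hasDerivAt_pi.2 fun j => ?_
      have h1 : ∀ i, HasDerivAt (fun t : ℝ => z i + t • A (z i)) (A (z i)) 0 := fun i => by
        simpa using ((hasDerivAt_id (0 : ℝ)).smul_const (A (z i))).const_add (z i)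
      have h2 := ((hasDerivAt_const (0 : ℝ) (G w)).clm_apply (h1 i)).clm_apply (h1 j)
      simpa using h2
    have hD1 := (hD _).hasFDerivAt.comp_hasDerivAt (0 : ℝ) hm1
    have hD2 := (hD _).hasFDerivAt.comp_hasDerivAt (0 : ℝ) hm2
    have e1 : (fun i j => G (w + (0 : ℝ) • X w) (z i) (z j)) = m₀ := by simp [hm₀]
    have e2 : (fun i j => G w (z i + (0 : ℝ) • A (z i)) (z j + (0 : ℝ) • A (z j))) = m₀ := by
      simp [hm₀]
    rw [e1] at hD1
    rw [e2] at hD2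
    have hη1 : HasDerivAt (fun t : ℝ => η (w + t • X w) z) (fderiv ℝ η w (X w) z) 0 := by
      have h1 : HasFDerivAt η (fderiv ℝ η w) (w + (0 : ℝ) • X w) := by
        rw [hline0]; exact hη.diff.hasFDerivAt
      exact ((ContinuousAlternatingMap.apply ℝ E ℝ z).hasFDerivAt.comp_hasDerivAt (0 : ℝ)
        (h1.comp_hasDerivAt (0 : ℝ) hline))
    have hη1' := hη1.pow 2
    have hη2' := (hasDerivAt_alternating_flow (η w) A z).pow 2
    have c1 : (fun t : ℝ => (η (w + t • X w) z) ^ 2) =ᶠ[𝓝 0]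
        fun t => s * D (fun i j => G (w + t • X w) (z i) (z j)) := by
      have t1 : Filter.Tendsto (fun t : ℝ => w + t • X w) (𝓝 0) (𝓝 w) := by
        have := hline.continuousAt.tendsto
        rwa [hline0] at this
      have t2 := hm1.continuousAt.tendsto
      rw [e1] at t2
      filter_upwards [t1.eventually hsq, t2.eventually hs] with t h1 h2
      rw [h1 z]
      exact h2
    have c2 : (fun t : ℝ => (η w (fun i => z i + t • A (z i))) ^ 2) =ᶠ[𝓝 0]
        fun t => s * D (fun i j => G w (z i + t • A (z i)) (z j + t • A (z j))) := by
      have t2 := hm2.continuousAt.tendsto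
      rw [e2] at t2
      filter_upwards [t2.eventually hs] with t h2
      rw [hsq.self_of_nhds]
      exact h2
    have d1 := (hη1'.congr_of_eventuallyEq c1.symm).unique (hD1.const_mul s)
    have d2 := (hη2'.congr_of_eventuallyEq c2.symm).unique (hD2.const_mul s)
    have hzero : (fun i j => fderiv ℝ G w (X w) (z i) (z j)) +
        (fun i j => G w (A (z i)) (z j) + G w (z i) (A (z j))) = (0 : Fin n → Fin n → ℝ) := by
      funext i j
      have := hK (z i) (z j)
      simp only [Pi.add_apply, Pi.zero_apply]
      linarith
    have hsum := congrArg (fderiv ℝ D m₀) hzero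
    rw [map_add, map_zero] at hsum
    -- The two derivatives of the squared volume add up to `2 η(z) (L_X η)(z)`, and those of the
    -- determinant cancel.
    have : 2 * η w z * (fderiv ℝ η w (X w) z + ∑ i, η w (Function.update z i (A (z i)))) = 0 := by
      simp only [zero_smul, add_zero] at d1 d2
      have := congrArg (s * ·) hsum
      simp only [mul_add, mul_zero, ← d1, ← d2] at this
      norm_num at this
      linarith
    have h2 : 2 * η w z ≠ 0 := by simpa using hz0
    exact (mul_eq_zero.1 this).resolve_left h2
  · have h1 : fderiv ℝ η w (X w) z = 0 :=
      (fderiv ℝ η w (X w)).toAlternatingMap.map_linearDependent z hz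
    -- A linear image of a dependent family is dependent, so the form vanishes along the whole
    -- curve.
    have h2 : (fun t : ℝ => η w (fun i => z i + t • A (z i))) = fun _ => 0 := by
      funext t
      have h3 : (fun i => z i + t • A (z i)) = (LinearMap.id + t • A.toLinearMap : E →ₗ[ℝ] E) ∘ z := by
        funext i
        simp
      rw [h3]
      exact (η w).toAlternatingMap.map_linearDependent _ fun hd => hz (LinearIndependent.of_comp _ hd)
    have h3 := hasDerivAt_alternating_flow (η w) A z
    rw [h2] at h3
    rw [h1, h3.unique (hasDerivAt_const _ _), zero_add]
    rfl

end Killing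
end

noncomputable section

/-! ### Derivatives of maps between manifolds, as linear maps of the model spaces -/

section TangentMaps

variable {E : Type*} [NormedAddCommGroup E] [NormedSpace ℝ E]
  {F : Type*} [NormedAddCommGroup F] [NormedSpace ℝ F]
  {F' : Type*} [NormedAddCommGroup F'] [NormedSpace ℝ F']
  {M : Type*} [TopologicalSpace M] [ChartedSpace E M]
  {N : Type*} [TopologicalSpace N] [ChartedSpace F N]
  {P : Type*} [TopologicalSpace P] [ChartedSpace F' P]

variable (E F) in
/-- The derivative of a map, with values in the linear maps between the model spaces. -/
def modelDeriv (f : M → N) (x : M) : E →L[ℝ] F := mfderiv 𝓘(ℝ, E) 𝓘(ℝ, F) f x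

theorem modelDeriv_comp {g : N → P} {f : M → N} {x : M}
    (hg : MDifferentiableAt 𝓘(ℝ, F) 𝓘(ℝ, F') g (f x))
    (hf : MDifferentiableAt 𝓘(ℝ, E) 𝓘(ℝ, F) f x) :
    modelDeriv E F' (fun y => g (f y)) x = modelDeriv F F' g (f x) ∘L modelDeriv E F f x :=
  mfderiv_comp x hg hf

theorem modelDeriv_congr {f g : M → N} {x : M} (h : f =ᶠ[𝓝 x] g) :
    modelDeriv E F f x = modelDeriv E F g x :=
  h.mfderiv_eq

theorem modelDeriv_eq_fderiv {f : E → F} {x : E} : modelDeriv E F f x = fderiv ℝ f x :=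
  mfderiv_eq_fderiv

theorem modelDeriv_id (x : M) : modelDeriv E E (fun y : M => y) x = ContinuousLinearMap.id ℝ E :=
  mfderiv_id

end TangentMaps

/-! ### Local parametrizations -/

section Param

variable {E : Type*} [NormedAddCommGroup E] [NormedSpace ℝ E]
  {M : Type*} [TopologicalSpace M] [ChartedSpace E M]

variable (E M) in
/-- A smooth parametrization of an open subset of `M` by an open subset of `E`. -/
abbrev LocalParam : Type _ := PartialDiffeomorph 𝓘(ℝ, E) 𝓘(ℝ, E) E M ∞

/-- The inverse of the preferred chart. -/
def chartParam [IsManifold 𝓘(ℝ, E) ∞ M] (x : M) : LocalParam E M where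
  toPartialEquiv := (extChartAt 𝓘(ℝ, E) x).symm
  open_source := isOpen_extChartAt_target x
  open_target := isOpen_extChartAt_source x
  contMDiffOn_toFun := contMDiffOn_extChartAt_symm x
  contMDiffOn_invFun := by
    have h : ContMDiffOn 𝓘(ℝ, E) 𝓘(ℝ, E) ∞ (extChartAt 𝓘(ℝ, E) x) (chartAt E x).source :=
      contMDiffOn_extChartAt
    rw [← extChartAt_source 𝓘(ℝ, E) x] at h
    exact h

namespace LocalParam

variable (ψ φ : LocalParam E M) {w : E}

/-- The derivative of a parametrization. -/
abbrev deriv (w : E) : E →L[ℝ] E := modelDeriv E E ψ.toFun w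

variable {ψ φ}

theorem mdifferentiableAt (hw : w ∈ ψ.source) :
    MDifferentiableAt 𝓘(ℝ, E) 𝓘(ℝ, E) ψ.toFun w :=
  (ψ.contMDiffOn_toFun.contMDiffAt (ψ.open_source.mem_nhds hw)).mdifferentiableAt (by simp)

theorem mdifferentiableAt_inv {x : M} (hx : x ∈ ψ.target) :
    MDifferentiableAt 𝓘(ℝ, E) 𝓘(ℝ, E) ψ.invFun x :=
  (ψ.contMDiffOn_invFun.contMDiffAt (ψ.open_target.mem_nhds hx)).mdifferentiableAt (by simp)

theorem continuousAt (hw : w ∈ ψ.source) : ContinuousAt ψ.toFun w :=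
  (mdifferentiableAt hw).continuousAt

theorem inv_apply (hw : w ∈ ψ.source) : ψ.invFun (ψ.toFun w) = w := ψ.left_inv' hw

theorem apply_inv {x : M} (hx : x ∈ ψ.target) : ψ.toFun (ψ.invFun x) = x := ψ.right_inv' hx

theorem apply_mem (hw : w ∈ ψ.source) : ψ.toFun w ∈ ψ.target := ψ.map_source' hw

theorem inv_mem {x : M} (hx : x ∈ ψ.target) : ψ.invFun x ∈ ψ.source := ψ.map_target' hx

theorem deriv_inv_comp (hw : w ∈ ψ.source) :
    modelDeriv E E ψ.invFun (ψ.toFun w) ∘L ψ.deriv w = ContinuousLinearMap.id ℝ E := by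
  rw [← modelDeriv_comp (mdifferentiableAt_inv (apply_mem hw)) (mdifferentiableAt hw),
    ← modelDeriv_id (M := E) w]
  exact modelDeriv_congr ((ψ.open_source.eventually_mem hw).mono fun y hy => inv_apply hy)

theorem deriv_comp_inv (hw : w ∈ ψ.source) :
    ψ.deriv w ∘L modelDeriv E E ψ.invFun (ψ.toFun w) = ContinuousLinearMap.id ℝ E := by
  have h := modelDeriv_comp (g := ψ.toFun) (f := ψ.invFun) (x := ψ.toFun w)
    (by rw [inv_apply hw]; exact mdifferentiableAt hw) (mdifferentiableAt_inv (apply_mem hw))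
  rw [inv_apply hw] at h
  rw [← h, ← modelDeriv_id (ψ.toFun w)]
  exact modelDeriv_congr ((ψ.open_target.eventually_mem (apply_mem hw)).mono fun y hy =>
    apply_inv hy)

variable (ψ) in
/-- The derivative of a parametrization as an isomorphism. -/
def derivEquiv (hw : w ∈ ψ.source) : E ≃L[ℝ] E :=
  ContinuousLinearEquiv.equivOfInverse (ψ.deriv w) (modelDeriv E E ψ.invFun (ψ.toFun w))
    (fun v => DFunLike.congr_fun (deriv_inv_comp hw) v)
    (fun v => DFunLike.congr_fun (deriv_comp_inv hw) v)

/-- The change of parameters. -/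
def transition (ψ φ : LocalParam E M) (w : E) : E := φ.invFun (ψ.toFun w)

theorem transition_contDiffAt (hw : w ∈ ψ.source) (hφ : ψ.toFun w ∈ φ.target) :
    ContDiffAt ℝ ∞ (transition ψ φ) w := by
  rw [← contMDiffAt_iff_contDiffAt]
  exact (φ.contMDiffOn_invFun.contMDiffAt (φ.open_target.mem_nhds hφ)).comp w
    (ψ.contMDiffOn_toFun.contMDiffAt (ψ.open_source.mem_nhds hw))

theorem eventually_mem (hw : w ∈ ψ.source) {U : Set M} (hU : IsOpen U) (hφ : ψ.toFun w ∈ U) :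
    ∀ᶠ y in 𝓝 w, y ∈ ψ.source ∧ ψ.toFun y ∈ U :=
  (ψ.open_source.eventually_mem hw).and ((continuousAt hw).eventually (hU.eventually_mem hφ))

theorem deriv_transition (hw : w ∈ ψ.source) (hφ : ψ.toFun w ∈ φ.target) :
    ψ.deriv w = φ.deriv (transition ψ φ w) ∘L fderiv ℝ (transition ψ φ) w := by
  have h := modelDeriv_comp (E := E) (F := E) (F' := E) (g := φ.toFun) (f := transition ψ φ)
    (x := w) (mdifferentiableAt (inv_mem hφ))
    ((transition_contDiffAt hw hφ).diff).mdifferentiableAt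
  rw [← modelDeriv_eq_fderiv, ← h]
  exact modelDeriv_congr ((eventually_mem hw φ.open_target hφ).mono fun y hy =>
    (apply_inv hy.2).symm)

end LocalParam

/-! ### Pullback of forms by parametrizations -/

/-- The pullback of a form by a map from `E` to `M`. -/
def pullForm {k : ℕ} (ψ : E → M) (η : FormField E M k) (w : E) : E [⋀^Fin k]→L[ℝ] ℝ :=
  ContinuousAlternatingMap.compContinuousLinearMap (M := E) (M' := E) (η (ψ w))
    (modelDeriv E E ψ w)

/-- The pullback of a `1`-form by a map from `E` to `M`. -/
def pullCov (ψ : E → M) (α : CovectorField E M) (w : E) : E →L[ℝ] ℝ :=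
  ContinuousLinearMap.comp (M₁ := E) (M₂ := E) (α (ψ w)) (modelDeriv E E ψ w)

variable {k : ℕ} {ψ φ : LocalParam E M} {w : E}

theorem pullForm_apply (ψ : E → M) (η : FormField E M k) (w : E) (v : Fin k → E) :
    pullForm ψ η w v = (η (ψ w) : E [⋀^Fin k]→L[ℝ] ℝ) fun i => modelDeriv E E ψ w (v i) := rfl

theorem pullCov_apply (ψ : E → M) (α : CovectorField E M) (w v : E) :
    pullCov ψ α w v = (α (ψ w) : E →L[ℝ] ℝ) (modelDeriv E E ψ w v) := rfl

theorem pullForm_toForm (ψ : E → M) (α : CovectorField E M) :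
    pullForm ψ α.toForm = covForm (pullCov ψ α) := by
  funext w
  ext v
  rfl

theorem pullForm_wedge (ψ : E → M) (α β : CovectorField E M) :
    pullForm ψ (α.wedge β) = fun w => covWedge (pullCov ψ α w) (pullCov ψ β w) := by
  funext w
  ext v
  rfl

/-- The derivative of a parametrization is an isomorphism, so identities between forms may be
checked after pullback. -/
theorem pullForm_injective (hw : w ∈ ψ.source) {η σ : FormField E M k}
    (h : pullForm ψ.toFun η w = pullForm ψ.toFun σ w) : η (ψ.toFun w) = σ (ψ.toFun w) := by
  ext v
  have h1 := DFunLike.congr_fun h fun i => (ψ.derivEquiv hw).symm (v i)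
  have h2 : (fun i => modelDeriv E E ψ.toFun w ((ψ.derivEquiv hw).symm (v i))) = v :=
    funext fun i => (ψ.derivEquiv hw).apply_symm_apply (v i)
  have h3 : ∀ η : FormField E M k, pullForm ψ.toFun η w (fun i => (ψ.derivEquiv hw).symm (v i)) =
    η (ψ.toFun w) v := fun η => congrArg (η (ψ.toFun w)) h2
  exact (h3 η).symm.trans (h1.trans (h3 σ))

theorem pullCov_injective (hw : w ∈ ψ.source) {α β : CovectorField E M}
    (h : pullCov ψ.toFun α w = pullCov ψ.toFun β w) : α (ψ.toFun w) = β (ψ.toFun w) := by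
  ext v
  have h1 := DFunLike.congr_fun h ((ψ.derivEquiv hw).symm v)
  have h2 : modelDeriv E E ψ.toFun w ((ψ.derivEquiv hw).symm v) = v :=
    (ψ.derivEquiv hw).apply_symm_apply v
  have h3 : ∀ α : CovectorField E M, pullCov ψ.toFun α w ((ψ.derivEquiv hw).symm v) =
    α (ψ.toFun w) v := fun α => congrArg (α (ψ.toFun w)) h2
  exact (h3 α).symm.trans (h1.trans (h3 β))

/-- The form on the image of a parametrization with a given pullback. -/
def pushForm (ψ : LocalParam E M) (σ : E → E [⋀^Fin k]→L[ℝ] ℝ) : FormField E M k := fun x =>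
  ((σ (ψ.invFun x)).compContinuousLinearMap (modelDeriv E E ψ.invFun x) : E [⋀^Fin k]→L[ℝ] ℝ)

/-- The `1`-form on the image of a parametrization with a given pullback. -/
def pushCov (ψ : LocalParam E M) (a : E → E →L[ℝ] ℝ) : CovectorField E M := fun x =>
  (a (ψ.invFun x) ∘L modelDeriv E E ψ.invFun x : E →L[ℝ] ℝ)

theorem pullForm_pushForm (hw : w ∈ ψ.source) (σ : E → E [⋀^Fin k]→L[ℝ] ℝ) :
    pullForm ψ.toFun (pushForm ψ σ) w = σ w := by
  ext v
  have h2 : ∀ v, modelDeriv E E ψ.invFun (ψ.toFun w) (modelDeriv E E ψ.toFun w v) = v := fun v =>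
    (ψ.derivEquiv hw).symm_apply_apply v
  have h1 : pullForm ψ.toFun (pushForm ψ σ) w v = σ (ψ.invFun (ψ.toFun w)) fun i =>
    modelDeriv E E ψ.invFun (ψ.toFun w) (modelDeriv E E ψ.toFun w (v i)) := rfl
  rw [h1, LocalParam.inv_apply hw]
  simp only [h2]

theorem pullCov_pushCov (hw : w ∈ ψ.source) (a : E → E →L[ℝ] ℝ) :
    pullCov ψ.toFun (pushCov ψ a) w = a w := by
  ext v
  have h2 : modelDeriv E E ψ.invFun (ψ.toFun w) (modelDeriv E E ψ.toFun w v) = v :=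
    (ψ.derivEquiv hw).symm_apply_apply v
  have h1 : pullCov ψ.toFun (pushCov ψ a) w v = a (ψ.invFun (ψ.toFun w))
    (modelDeriv E E ψ.invFun (ψ.toFun w) (modelDeriv E E ψ.toFun w v)) := rfl
  rw [h1, LocalParam.inv_apply hw, h2]

theorem pullForm_transition (η : FormField E M k) (hw : w ∈ ψ.source)
    (hφ : ψ.toFun w ∈ φ.target) :
    pullForm ψ.toFun η w = (pullForm φ.toFun η (LocalParam.transition ψ φ w)).compContinuousLinearMap
      (fderiv ℝ (LocalParam.transition ψ φ) w) := by
  ext v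
  have h1 := LocalParam.deriv_transition hw hφ
  have h2 : φ.toFun (LocalParam.transition ψ φ w) = ψ.toFun w := LocalParam.apply_inv hφ
  have h3 : ∀ v, modelDeriv E E ψ.toFun w v = modelDeriv E E φ.toFun (LocalParam.transition ψ φ w)
    (fderiv ℝ (LocalParam.transition ψ φ) w v) := fun v => DFunLike.congr_fun h1 v
  rw [pullForm_apply]
  simp only [h3, ContinuousAlternatingMap.compContinuousLinearMap_apply, pullForm_apply,
    Function.comp_def]
  rw [h2]

/-! ### Functions in parametrizations -/

theorem SmoothFun.pull {f : M → ℝ} (hf : SmoothFun E f) (hw : w ∈ ψ.source) :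
    ContDiffAt ℝ ∞ (fun y => f (ψ.toFun y)) w := by
  rw [← contMDiffAt_iff_contDiffAt]
  exact hf.contMDiffAt.comp w (ψ.contMDiffOn_toFun.contMDiffAt (ψ.open_source.mem_nhds hw))

theorem contMDiffAt_of_pull {f : M → ℝ} {x : M} (hx : x ∈ ψ.target)
    (hf : ContDiffAt ℝ ∞ (fun y => f (ψ.toFun y)) (ψ.invFun x)) :
    ContMDiffAt 𝓘(ℝ, E) 𝓘(ℝ, ℝ) ∞ f x := by
  have h1 : f =ᶠ[𝓝 x] fun y => f (ψ.toFun (ψ.invFun y)) :=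
    (ψ.open_target.eventually_mem hx).mono fun y hy =>
      congrArg f (LocalParam.apply_inv hy).symm
  refine ContMDiffAt.congr_of_eventuallyEq ?_ h1
  exact ContMDiffAt.comp (I' := 𝓘(ℝ, E)) (g := fun y => f (ψ.toFun y)) x (contMDiffAt_iff_contDiffAt.2 hf)
    (ψ.contMDiffOn_invFun.contMDiffAt (ψ.open_target.mem_nhds hx))

theorem pullCov_dFun {f : M → ℝ} (hw : w ∈ ψ.source)
    (hf : ContDiffAt ℝ ∞ (fun y => f (ψ.toFun y)) w) :
    pullCov ψ.toFun (dFun E f) w = fderiv ℝ (fun y => f (ψ.toFun y)) w := by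
  have h1 : ContMDiffAt 𝓘(ℝ, E) 𝓘(ℝ, ℝ) ∞ f (ψ.toFun w) :=
    contMDiffAt_of_pull (ψ := ψ) (LocalParam.apply_mem hw) (by rwa [LocalParam.inv_apply hw])
  rw [← modelDeriv_eq_fderiv]
  exact (modelDeriv_comp (h1.mdifferentiableAt (by simp)) (LocalParam.mdifferentiableAt hw)).symm

variable [FiniteDimensional ℝ E]

/-- Smoothness of a form does not depend on the parametrization: the pullbacks differ by the
derivative of a smooth transition map. -/
theorem pullForm_contDiffAt_of_transition {η : FormField E M k} (hw : w ∈ ψ.source)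
    (hφ : ψ.toFun w ∈ φ.target)
    (hη : ContDiffAt ℝ ∞ (pullForm φ.toFun η) (LocalParam.transition ψ φ w)) :
    ContDiffAt ℝ ∞ (pullForm ψ.toFun η) w := by
  have ht := LocalParam.transition_contDiffAt hw hφ
  refine ContDiffAt.congr_of_eventuallyEq ?_ ((LocalParam.eventually_mem hw φ.open_target hφ).mono
    fun y hy => pullForm_transition η hy.1 hy.2)
  refine contDiffAt_alternating fun v => ?_
  exact (hη.comp w ht).alternating_apply fun i => ht.fderiv_infty.clm_apply contDiffAt_const

theorem FormField.SmoothOn.pull [IsManifold 𝓘(ℝ, E) ∞ M] {η : FormField E M k} {U : Set M}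
    (hU : IsOpen U) (hη : η.SmoothOn U) (hw : w ∈ ψ.source) (hwU : ψ.toFun w ∈ U) :
    ContDiffAt ℝ ∞ (pullForm ψ.toFun η) w := by
  have hx := mem_extChartAt_source (I := 𝓘(ℝ, E)) (ψ.toFun w)
  refine pullForm_contDiffAt_of_transition (φ := chartParam (ψ.toFun w)) hw hx ?_
  have hopen : IsOpen ((extChartAt 𝓘(ℝ, E) (ψ.toFun w)).target ∩
      (extChartAt 𝓘(ℝ, E) (ψ.toFun w)).symm ⁻¹' U) :=
    (continuousOn_extChartAt_symm (ψ.toFun w)).isOpen_inter_preimage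
      (isOpen_extChartAt_target _) hU
  have hmem : extChartAt 𝓘(ℝ, E) (ψ.toFun w) (ψ.toFun w) ∈
      (extChartAt 𝓘(ℝ, E) (ψ.toFun w)).target ∩
      (extChartAt 𝓘(ℝ, E) (ψ.toFun w)).symm ⁻¹' U :=
    ⟨mem_extChartAt_target _, by
      rw [Set.mem_preimage, (extChartAt 𝓘(ℝ, E) (ψ.toFun w)).left_inv hx]; exact hwU⟩
  exact (hη (ψ.toFun w)).contDiffAt (hopen.mem_nhds hmem)

theorem FormField.smoothOn_of_pull [IsManifold 𝓘(ℝ, E) ∞ M] {η : FormField E M k} {U : Set M}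
    (h : ∀ x ∈ U, ∃ ψ : LocalParam E M, x ∈ ψ.target ∧
      ContDiffAt ℝ ∞ (pullForm ψ.toFun η) (ψ.invFun x)) : η.SmoothOn U := by
  intro x₀ y hy
  obtain ⟨ψ, hψ, hs⟩ := h _ hy.2
  exact (pullForm_contDiffAt_of_transition (ψ := chartParam x₀) (φ := ψ) hy.1 hψ hs).contDiffWithinAt

/-- The exterior derivative commutes with parametrizations. -/
theorem pullForm_d [IsManifold 𝓘(ℝ, E) ∞ M] {η : FormField E M k} (hw : w ∈ ψ.source)
    (hη : ContDiffAt ℝ ∞ (pullForm ψ.toFun η) w) :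
    pullForm ψ.toFun η.d w = extDeriv (pullForm ψ.toFun η) w := by
  set x := ψ.toFun w with hx
  set φ : LocalParam E M := chartParam x with hφ
  have hxs : x ∈ φ.target := mem_extChartAt_source (I := 𝓘(ℝ, E)) x
  have ht := LocalParam.transition_contDiffAt hw hxs
  have h0 : ContDiffAt ℝ ∞ (pullForm φ.toFun η) (LocalParam.transition ψ φ w) := by
    have hm : φ.toFun (LocalParam.transition ψ φ w) = x := LocalParam.apply_inv hxs
    refine pullForm_contDiffAt_of_transition (φ := ψ) (LocalParam.inv_mem hxs) ?_ ?_
    · rw [hm]; exact LocalParam.apply_mem hw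
    · rw [LocalParam.transition, hm, hx, LocalParam.inv_apply hw]; exact hη
  have h1 : pullForm ψ.toFun η =ᶠ[𝓝 w] fun y =>
      (pullForm φ.toFun η (LocalParam.transition ψ φ y)).compContinuousLinearMap
        (fderiv ℝ (LocalParam.transition ψ φ) y) :=
    (LocalParam.eventually_mem hw φ.open_target hxs).mono fun y hy =>
      pullForm_transition η hy.1 hy.2
  -- `FormField.d` is computed in the chart centred at the point itself; naturality under the
  -- transition to that chart gives the formula in any other parametrization.
  rw [h1.extDeriv_eq, extDeriv_pullback (r := ∞) h0.diff ht
    (by simp [minSmoothness_of_isRCLikeNormedField]; exact WithTop.coe_le_coe.2 le_top)]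
  have h2 : fderiv ℝ (LocalParam.transition ψ φ) w = modelDeriv E E φ.invFun x ∘L ψ.deriv w := by
    rw [← modelDeriv_eq_fderiv]
    exact modelDeriv_comp (LocalParam.mdifferentiableAt_inv hxs) (LocalParam.mdifferentiableAt hw)
  rw [h2]
  rfl

theorem pullForm_covd [IsManifold 𝓘(ℝ, E) ∞ M] {α : CovectorField E M} (hw : w ∈ ψ.source)
    (hα : ContDiffAt ℝ ∞ (pullCov ψ.toFun α) w) :
    pullForm ψ.toFun α.d w = dCov (pullCov ψ.toFun α) w := by
  rw [CovectorField.d, pullForm_d hw, pullForm_toForm]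
  · rfl
  · rw [pullForm_toForm]; exact covForm_contDiffAt hα

theorem contDiffAt_of_covForm {a : E → E →L[ℝ] ℝ} (h : ContDiffAt ℝ ∞ (covForm a) w) :
    ContDiffAt ℝ ∞ a w :=
  contDiffAt_covector fun v => h.alternating_apply (v := fun _ _ => v) fun _ => contDiffAt_const

theorem CovectorField.Smooth.pull [IsManifold 𝓘(ℝ, E) ∞ M] {α : CovectorField E M}
    (hα : α.Smooth) (hw : w ∈ ψ.source) : ContDiffAt ℝ ∞ (pullCov ψ.toFun α) w := by
  have := FormField.SmoothOn.pull (ψ := ψ) isOpen_univ hα hw trivial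
  rw [pullForm_toForm] at this
  exact contDiffAt_of_covForm this

theorem FormField.Smooth.pull [IsManifold 𝓘(ℝ, E) ∞ M] {η : FormField E M k}
    (hη : η.Smooth) (hw : w ∈ ψ.source) : ContDiffAt ℝ ∞ (pullForm ψ.toFun η) w :=
  FormField.SmoothOn.pull (ψ := ψ) isOpen_univ hη hw trivial

theorem CovectorField.smooth_of_pull [IsManifold 𝓘(ℝ, E) ∞ M] {α : CovectorField E M}
    (h : ∀ x, ∃ ψ : LocalParam E M, x ∈ ψ.target ∧
      ContDiffAt ℝ ∞ (pullCov ψ.toFun α) (ψ.invFun x)) : α.Smooth :=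
  FormField.smoothOn_of_pull fun x _ => by
    obtain ⟨ψ, hψ, hs⟩ := h x
    exact ⟨ψ, hψ, by rw [pullForm_toForm]; exact covForm_contDiffAt hs⟩

end Param
end

noncomputable section

/-! ### Smooth forms -/

section SmoothForms

variable {E : Type*} [NormedAddCommGroup E] [NormedSpace ℝ E] [FiniteDimensional ℝ E]
  {M : Type*} [TopologicalSpace M] [ChartedSpace E M] [IsManifold 𝓘(ℝ, E) ∞ M]
  {k : ℕ} {α β : CovectorField E M} {η σ : FormField E M k} {f h : M → ℝ}

theorem mem_chartParam_target (x : M) : x ∈ (chartParam (E := E) x).target :=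
  mem_extChartAt_source (I := 𝓘(ℝ, E)) x

theorem smoothFun_of_pull (hf : ∀ x, ∃ ψ : LocalParam E M, x ∈ ψ.target ∧
    ContDiffAt ℝ ∞ (fun y => f (ψ.toFun y)) (ψ.invFun x)) : SmoothFun E f := fun x => by
  obtain ⟨ψ, hψ, hs⟩ := hf x
  exact contMDiffAt_of_pull hψ hs

theorem CovectorField.smooth_of_pull_chart
    (h : ∀ x, ContDiffAt ℝ ∞ (pullCov (chartParam (E := E) x).toFun α)
      ((chartParam (E := E) x).invFun x)) : α.Smooth :=
  CovectorField.smooth_of_pull fun x => ⟨chartParam x, mem_chartParam_target x, h x⟩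

theorem CovectorField.Smooth.add (hα : α.Smooth) (hβ : β.Smooth) : (α + β).Smooth :=
  CovectorField.smooth_of_pull_chart fun x =>
    (hα.pull (LocalParam.inv_mem (mem_chartParam_target x))).add
      (hβ.pull (LocalParam.inv_mem (mem_chartParam_target x))) |>.congr_of_eventuallyEq
      (Filter.Eventually.of_forall fun y => by ext v; rfl)

theorem CovectorField.smooth_zero : (0 : CovectorField E M).Smooth :=
  CovectorField.smooth_of_pull_chart fun _ =>
    (contDiffAt_const (c := (0 : E →L[ℝ] ℝ))).congr_of_eventuallyEq
      (Filter.Eventually.of_forall fun y => by ext v; rfl)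

theorem CovectorField.Smooth.sum {ι : Type*} {s : Finset ι} {α : ι → CovectorField E M}
    (hα : ∀ i ∈ s, (α i).Smooth) : (∑ i ∈ s, α i).Smooth := by
  classical
  induction s using Finset.induction_on with
  | empty => simpa using CovectorField.smooth_zero
  | insert i s hi ih =>
    rw [Finset.sum_insert hi]
    exact (hα i (by simp)).add (ih fun j hj => hα j (by simp [hj]))

theorem CovectorField.Smooth.fsmul (hα : α.Smooth) (hf : SmoothFun E f) : (α.fsmul f).Smooth :=
  CovectorField.smooth_of_pull_chart fun x =>
    ((hf.pull (LocalParam.inv_mem (mem_chartParam_target x))).smul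
      (hα.pull (LocalParam.inv_mem (mem_chartParam_target x)))).congr_of_eventuallyEq
      (Filter.Eventually.of_forall fun y => by ext v; rfl)

theorem SmoothFun.dFun (hf : SmoothFun E f) : (dFun E f).Smooth :=
  CovectorField.smooth_of_pull_chart fun x => by
    have hw := LocalParam.inv_mem (mem_chartParam_target (E := E) x)
    refine (hf.pull hw).fderiv_infty.congr_of_eventuallyEq ?_
    exact ((chartParam (E := E) x).open_source.eventually_mem hw).mono fun y hy =>
      pullCov_dFun hy (hf.pull hy)

theorem FormField.smooth_of_pull_chart
    (h : ∀ x, ContDiffAt ℝ ∞ (pullForm (chartParam (E := E) x).toFun η)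
      ((chartParam (E := E) x).invFun x)) : η.Smooth :=
  FormField.smoothOn_of_pull fun x _ => ⟨chartParam x, mem_chartParam_target x, h x⟩

theorem FormField.Smooth.add (hη : η.Smooth) (hσ : σ.Smooth) : FormField.Smooth (η + σ) :=
  FormField.smooth_of_pull_chart fun x =>
    (hη.pull (LocalParam.inv_mem (mem_chartParam_target x))).add
      (hσ.pull (LocalParam.inv_mem (mem_chartParam_target x))) |>.congr_of_eventuallyEq
      (Filter.Eventually.of_forall fun y => by ext v; rfl)

theorem FormField.smooth_zero : FormField.Smooth (0 : FormField E M k) :=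
  FormField.smooth_of_pull_chart fun _ =>
    (contDiffAt_const (c := (0 : E [⋀^Fin k]→L[ℝ] ℝ))).congr_of_eventuallyEq
      (Filter.Eventually.of_forall fun y => by ext v; rfl)

theorem FormField.Smooth.sum {ι : Type*} {s : Finset ι} {η : ι → FormField E M k}
    (hη : ∀ i ∈ s, (η i).Smooth) : FormField.Smooth (∑ i ∈ s, η i) := by
  classical
  induction s using Finset.induction_on with
  | empty => simpa using FormField.smooth_zero
  | insert i s hi ih =>
    rw [Finset.sum_insert hi]
    exact (hη i (by simp)).add (ih fun j hj => hη j (by simp [hj]))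

theorem FormField.Smooth.fsmul (hη : η.Smooth) (hf : SmoothFun E f) :
    FormField.Smooth (η.fsmul f) :=
  FormField.smooth_of_pull_chart fun x =>
    ((hf.pull (LocalParam.inv_mem (mem_chartParam_target x))).smul
      (hη.pull (LocalParam.inv_mem (mem_chartParam_target x)))).congr_of_eventuallyEq
      (Filter.Eventually.of_forall fun y => by ext v; rfl)

theorem CovectorField.Smooth.wedge (hα : α.Smooth) (hβ : β.Smooth) :
    FormField.Smooth (α.wedge β) :=
  FormField.smooth_of_pull_chart fun x => by
    rw [pullForm_wedge]
    exact (hα.pull (LocalParam.inv_mem (mem_chartParam_target x))).covWedge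
      (hβ.pull (LocalParam.inv_mem (mem_chartParam_target x)))

theorem CovectorField.Smooth.d (hα : α.Smooth) : FormField.Smooth α.d :=
  FormField.smooth_of_pull_chart fun x => by
    have hw := LocalParam.inv_mem (mem_chartParam_target (E := E) x)
    refine (dCov_contDiffAt (hα.pull hw)).congr_of_eventuallyEq ?_
    exact ((chartParam (E := E) x).open_source.eventually_mem hw).mono fun y hy =>
      pullForm_covd hy (hα.pull hy)

end SmoothForms

/-! ### Linearity of the pullback of forms -/

section PullAlgebra

variable {E : Type*} [NormedAddCommGroup E] [NormedSpace ℝ E]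
  {M : Type*} [TopologicalSpace M] [ChartedSpace E M] {k : ℕ} {ι : Type*}

theorem pullCov_add (ψ : E → M) (α β : CovectorField E M) (w : E) :
    pullCov ψ (α + β) w = pullCov ψ α w + pullCov ψ β w := rfl

theorem pullCov_sub (ψ : E → M) (α β : CovectorField E M) (w : E) :
    pullCov ψ (α - β) w = pullCov ψ α w - pullCov ψ β w := rfl

theorem pullCov_fsmul (ψ : E → M) (f : M → ℝ) (α : CovectorField E M) (w : E) :
    pullCov ψ (α.fsmul f) w = f (ψ w) • pullCov ψ α w := rfl

theorem pullCov_sum (ψ : E → M) (s : Finset ι) (α : ι → CovectorField E M) (w : E) :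
    pullCov ψ (∑ i ∈ s, α i) w = ∑ i ∈ s, pullCov ψ (α i) w :=
  map_sum (AddMonoidHom.mk' (fun α : CovectorField E M => pullCov ψ α w)
    fun α β => pullCov_add ψ α β w) α s

theorem pullForm_add (ψ : E → M) (η σ : FormField E M k) (w : E) :
    pullForm ψ (η + σ) w = pullForm ψ η w + pullForm ψ σ w := rfl

theorem pullForm_sub (ψ : E → M) (η σ : FormField E M k) (w : E) :
    pullForm ψ (η - σ) w = pullForm ψ η w - pullForm ψ σ w := rfl

theorem pullForm_fsmul (ψ : E → M) (f : M → ℝ) (η : FormField E M k) (w : E) :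
    pullForm ψ (η.fsmul f) w = f (ψ w) • pullForm ψ η w := rfl

theorem pullForm_sum (ψ : E → M) (s : Finset ι) (η : ι → FormField E M k) (w : E) :
    pullForm ψ (∑ i ∈ s, η i) w = ∑ i ∈ s, pullForm ψ (η i) w :=
  map_sum (AddMonoidHom.mk' (fun η : FormField E M k => pullForm ψ η w)
    fun η σ => pullForm_add ψ η σ w) η s

end PullAlgebra

/-! ### Tensoriality -/

section Tensoriality

variable {E : Type*} [NormedAddCommGroup E] [NormedSpace ℝ E] [FiniteDimensional ℝ E]
  {M : Type*} [TopologicalSpace M] [ChartedSpace E M] [IsManifold 𝓘(ℝ, E) ∞ M] [T2Space M]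

variable (E) in
theorem exists_smoothFun_cutoff (x : M) {U : Set M} (hU : U ∈ 𝓝 x) :
    ∃ χ : M → ℝ, SmoothFun E χ ∧ χ x = 1 ∧ ∀ y, y ∉ U → χ y = 0 := by
  obtain ⟨b, -, hb⟩ := (SmoothBumpFunction.nhds_basis_tsupport (I := 𝓘(ℝ, E)) x).mem_iff.1 hU
  refine ⟨b, b.contMDiff, b.eq_one, fun y hy => ?_⟩
  exact image_eq_zero_of_notMem_tsupport fun h => hy (hb h)

/-- A function smooth on a chart agrees near the centre with a smooth function. -/
theorem exists_smoothFun_extension (x : M) {f : M → ℝ}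
    (hf : ∀ y ∈ (chartParam (E := E) x).target, ContMDiffAt 𝓘(ℝ, E) 𝓘(ℝ, ℝ) ∞ f y)
    (b : SmoothBumpFunction 𝓘(ℝ, E) x) : SmoothFun E fun y => b y • f y := by
  refine b.contMDiff_smul fun y hy => (hf y ?_).contMDiffWithinAt
  rw [← extChartAt_source 𝓘(ℝ, E) x] at hy
  exact hy

/-- A linear function in a chart, cut off by a bump function, has the prescribed differential. Thus
covectors at a point can be tested against differentials of global smooth functions. -/
theorem exists_dFun_eq (x : M) (a : E →L[ℝ] ℝ) : ∃ f : M → ℝ, SmoothFun E f ∧ dFun E f x = a := by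
  obtain ⟨b⟩ : Nonempty (SmoothBumpFunction 𝓘(ℝ, E) x) := inferInstance
  set ψ : LocalParam E M := chartParam x
  have hx : x ∈ ψ.target := mem_chartParam_target x
  let l : E →L[ℝ] ℝ := a ∘L ψ.deriv (ψ.invFun x)
  have hl : ∀ y ∈ ψ.target, ContMDiffAt 𝓘(ℝ, E) 𝓘(ℝ, ℝ) ∞ (fun y => l (ψ.invFun y)) y :=
    fun y hy => (l.contDiff.contMDiff.contMDiffAt).comp y
      (ψ.contMDiffOn_invFun.contMDiffAt (ψ.open_target.mem_nhds hy))
  have hs := exists_smoothFun_extension x hl b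
  refine ⟨_, hs, ?_⟩
  have hw := LocalParam.inv_mem hx
  have h1 : pullCov ψ.toFun (dFun E fun y => b y • l (ψ.invFun y)) (ψ.invFun x) = l := by
    rw [pullCov_dFun hw (hs.pull hw)]
    have h2 : (fun y => b (ψ.toFun y) • l (ψ.invFun (ψ.toFun y))) =ᶠ[𝓝 (ψ.invFun x)] l := by
      have h3 := (LocalParam.continuousAt hw).eventually
        (by rw [LocalParam.apply_inv hx]; exact b.eventuallyEq_one)
      filter_upwards [h3, ψ.open_source.eventually_mem hw] with y hy hy'
      rw [LocalParam.inv_apply hy']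
      simp only [Pi.one_apply] at hy
      rw [hy, one_smul]
    rw [h2.fderiv_eq, l.fderiv]
  have h2 := pullCov_injective (β := fun _ => a) hw (h1.trans (by ext v; rfl))
  rw [LocalParam.apply_inv hx] at h2
  exact h2

theorem covector_eq_sum {ι : Type*} [Fintype ι] (e : Module.Basis ι ℝ E) (a : E →L[ℝ] ℝ) :
    a = ∑ i, a (e i) • LinearMap.toContinuousLinearMap (e.coord i) := by
  ext v
  conv_lhs => rw [← e.sum_repr v, map_sum]
  simp [mul_comm]

/-- The factor `1/2` compensates for summing over ordered pairs of indices. -/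
theorem alternating_two_eq_sum {ι : Type*} [Fintype ι] (e : Module.Basis ι ℝ E)
    (σ : E [⋀^Fin 2]→L[ℝ] ℝ) :
    σ = ∑ i, ∑ j, ((1 / 2 : ℝ) * σ ![e i, e j]) •
      covWedge (LinearMap.toContinuousLinearMap (e.coord i))
        (LinearMap.toContinuousLinearMap (e.coord j)) := by
  classical
  refine ContinuousAlternatingMap.toAlternatingMap_injective (e.ext_alternating fun v _ => ?_)
  have h0 : (fun i => e (v i)) = ![e (v 0), e (v 1)] := by funext j; fin_cases j <;> rfl
  have h1 : σ ![e (v 1), e (v 0)] = -σ ![e (v 0), e (v 1)] := by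
    have h := σ.toAlternatingMap.map_swap ![e (v 0), e (v 1)] (i := 0) (j := 1) (by simp)
    have h2 : ![e (v 0), e (v 1)] ∘ Equiv.swap (0 : Fin 2) 1 = ![e (v 1), e (v 0)] := by
      funext j; fin_cases j <;> rfl
    rw [h2] at h
    exact h
  rw [h0]
  simp only [ContinuousAlternatingMap.coe_toAlternatingMap]
  rw [ContinuousAlternatingMap.sum_apply]
  simp only [ContinuousAlternatingMap.sum_apply, ContinuousAlternatingMap.smul_apply, covWedge_apply,
    LinearMap.coe_toContinuousLinearMap', Module.Basis.coord_apply, Module.Basis.repr_self,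
    Finsupp.single_apply, smul_eq_mul, mul_sub, Finset.sum_sub_distrib, mul_ite, mul_one, mul_zero,
    Finset.sum_ite_eq, Finset.mem_univ, if_true]
  rw [h1]
  ring

/-- Smooth coordinate functions near a point, together with the expansions of forms. -/
theorem exists_coordinates (x : M) :
    ∃ c : Fin (Module.finrank ℝ E) → M → ℝ, (∀ i, SmoothFun E (c i)) ∧
      (∀ α : CovectorField E M, α.Smooth → ∃ f : Fin (Module.finrank ℝ E) → M → ℝ,
        (∀ i, SmoothFun E (f i)) ∧ ∀ᶠ y in 𝓝 x, α y = (∑ i, (dFun E (c i)).fsmul (f i)) y) ∧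
      (∀ σ : FormField E M 2, σ.Smooth → ∃ f : Fin (Module.finrank ℝ E) →
          Fin (Module.finrank ℝ E) → M → ℝ, (∀ i j, SmoothFun E (f i j)) ∧
        ∀ᶠ y in 𝓝 x, σ y =
          (∑ i, ∑ j, FormField.fsmul (f i j) ((dFun E (c i)).wedge (dFun E (c j)))) y) := by
  classical
  obtain ⟨b⟩ : Nonempty (SmoothBumpFunction 𝓘(ℝ, E) x) := inferInstance
  set ψ : LocalParam E M := chartParam x
  have hx : x ∈ ψ.target := mem_chartParam_target x
  set e := Module.finBasis ℝ E
  let l : Fin (Module.finrank ℝ E) → E →L[ℝ] ℝ := fun i =>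
    LinearMap.toContinuousLinearMap (e.coord i)
  have hl : ∀ i, ∀ y ∈ ψ.target,
      ContMDiffAt 𝓘(ℝ, E) 𝓘(ℝ, ℝ) ∞ (fun y => l i (ψ.invFun y)) y :=
    fun i y hy => ((l i).contDiff.contMDiff.contMDiffAt).comp y
      (ψ.contMDiffOn_invFun.contMDiffAt (ψ.open_target.mem_nhds hy))
  set c : Fin (Module.finrank ℝ E) → M → ℝ := fun i y => b y • l i (ψ.invFun y)
  have hc : ∀ i, SmoothFun E (c i) := fun i => exists_smoothFun_extension x (hl i) b
  -- The differentials of the cut-off coordinates are needed at all points near `x`, so the bump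
  -- function has to be one around each of these points.
  have hb : ∀ᶠ y in 𝓝 x, y ∈ ψ.target ∧ ∀ᶠ z in 𝓝 y, b z = 1 :=
    (ψ.open_target.eventually_mem hx).and b.eventuallyEq_one.eventually_nhds
  have hdc : ∀ y ∈ ψ.target, (∀ᶠ z in 𝓝 y, b z = 1) → ∀ i,
      pullCov ψ.toFun (dFun E (c i)) (ψ.invFun y) = l i := by
    intro y hy hby i
    have hw := LocalParam.inv_mem hy
    rw [pullCov_dFun hw ((hc i).pull hw)]
    have h2 : (fun z => c i (ψ.toFun z)) =ᶠ[𝓝 (ψ.invFun y)] l i := by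
      have h3 := (LocalParam.continuousAt hw).eventually
        (by rw [LocalParam.apply_inv hy]; exact hby)
      filter_upwards [h3, ψ.open_source.eventually_mem hw] with z hz hz'
      simp only [c]
      rw [LocalParam.inv_apply hz', hz, one_smul]
    rw [h2.fderiv_eq, (l i).fderiv]
  have hpull : ∀ {f : M → ℝ}, (∀ w ∈ ψ.source, ContDiffAt ℝ ∞ (fun y => f (ψ.toFun y)) w) →
      SmoothFun E fun y => b y • f y := fun hf =>
    exists_smoothFun_extension x (fun y hy => contMDiffAt_of_pull hy
      (hf _ (LocalParam.inv_mem hy))) b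
  refine ⟨c, hc, fun α hα => ?_, fun σ hσ => ?_⟩
  · refine ⟨fun i y => b y • pullCov ψ.toFun α (ψ.invFun y) (e i), fun i => hpull fun w hw => ?_,
      hb.mono fun y hy => ?_⟩
    · refine ((hα.pull hw).clm_apply (contDiffAt_const (c := e i))).congr_of_eventuallyEq ?_
      filter_upwards [ψ.open_source.eventually_mem hw] with z hz
      rw [LocalParam.inv_apply hz]
    · have hw := LocalParam.inv_mem hy.1
      have h1 : pullCov ψ.toFun α (ψ.invFun y) = pullCov ψ.toFun (∑ i, (dFun E (c i)).fsmul
          fun y => b y • pullCov ψ.toFun α (ψ.invFun y) (e i)) (ψ.invFun y) := by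
        refine (covector_eq_sum e _).trans ?_
        rw [pullCov_sum]
        refine Finset.sum_congr rfl fun i _ => ?_
        rw [pullCov_fsmul, hdc y hy.1 hy.2 i, LocalParam.apply_inv hy.1, hy.2.self_of_nhds,
          one_smul]
      have h2 := pullCov_injective hw h1
      rwa [LocalParam.apply_inv hy.1] at h2
  · refine ⟨fun i j y => b y • ((1 / 2 : ℝ) * pullForm ψ.toFun σ (ψ.invFun y) ![e i, e j]),
      fun i j => hpull fun w hw => ?_, hb.mono fun y hy => ?_⟩
    · refine ((contDiffAt_const (c := (1 / 2 : ℝ))).mul ((hσ.pull hw).alternating_apply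
        (v := fun k _ => ![e i, e j] k) fun _ => contDiffAt_const)).congr_of_eventuallyEq ?_
      filter_upwards [ψ.open_source.eventually_mem hw] with z hz
      rw [LocalParam.inv_apply hz]
    · have hw := LocalParam.inv_mem hy.1
      have h1 : pullForm ψ.toFun σ (ψ.invFun y) = pullForm ψ.toFun (∑ i, ∑ j, FormField.fsmul
          (fun y => b y • ((1 / 2 : ℝ) * pullForm ψ.toFun σ (ψ.invFun y) ![e i, e j]))
          ((dFun E (c i)).wedge (dFun E (c j)))) (ψ.invFun y) := by
        refine (alternating_two_eq_sum e _).trans ?_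
        rw [pullForm_sum]
        refine Finset.sum_congr rfl fun i _ => ?_
        rw [pullForm_sum]
        refine Finset.sum_congr rfl fun j _ => ?_
        rw [pullForm_fsmul, pullForm_wedge]
        beta_reduce
        rw [hdc y hy.1 hy.2 i, hdc y hy.1 hy.2 j,
          LocalParam.apply_inv hy.1, hy.2.self_of_nhds, one_smul]
      have h2 := pullForm_injective hw h1
      rwa [LocalParam.apply_inv hy.1] at h2

/-- An additive operator on smooth forms which is local over functions and kills the
differentials is zero. -/
theorem CovectorField.tensor_eq_zero {W : Type*} [AddCommGroup W] [Module ℝ W]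
    (T : CovectorField E M → W) (x : M)
    (hadd : ∀ α β : CovectorField E M, α.Smooth → β.Smooth → T (α + β) = T α + T β)
    (hsmul : ∀ (f : M → ℝ) (α : CovectorField E M), SmoothFun E f → α.Smooth →
      T (α.fsmul f) = f x • T α)
    (hd : ∀ f, SmoothFun E f → T (dFun E f) = 0) {α : CovectorField E M} (hα : α.Smooth) :
    T α = 0 := by
  obtain ⟨c, hc, h1, -⟩ := exists_coordinates (E := E) x
  obtain ⟨f, hf, h⟩ := h1 α hα
  obtain ⟨χ, hχ, hχx, hχ0⟩ := exists_smoothFun_cutoff E x h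
  -- The cutoff turns the local expansion of `α` into a global equality; as `χ x = 1`,
  -- multiplication by `χ` does not change the value of `T`.
  have h2 : α.fsmul χ = (∑ i, (dFun E (c i)).fsmul (f i)).fsmul χ := by
    funext y
    by_cases hy : α y = (∑ i, (dFun E (c i)).fsmul (f i)) y
    · exact congrArg (χ y • ·) hy
    · have h0 : χ y = 0 := hχ0 y hy
      simp only [CovectorField.fsmul, h0, zero_smul]
  have hs : ∀ i, ((dFun E (c i)).fsmul (f i)).Smooth := fun i => (hc i).dFun.fsmul (hf i)
  have hsum : ∀ s : Finset (Fin (Module.finrank ℝ E)),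
      T (∑ i ∈ s, (dFun E (c i)).fsmul (f i)) = 0 := by
    intro s
    induction s using Finset.induction_on with
    | empty =>
      have := hadd 0 0 CovectorField.smooth_zero CovectorField.smooth_zero
      rw [add_zero] at this
      simpa using this
    | insert i s hi ih =>
      rw [Finset.sum_insert hi, hadd _ _ (hs i) (CovectorField.Smooth.sum fun j _ => hs j), ih,
        hsmul _ _ (hf i) (hc i).dFun, hd _ (hc i), smul_zero, add_zero]
  have h3 := congrArg T h2
  rw [hsmul _ _ hχ hα, hsmul _ _ hχ (CovectorField.Smooth.sum fun j _ => hs j), hsum, hχx,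
    one_smul, smul_zero] at h3
  exact h3

/-- An additive operator on smooth `2`-forms which is local over functions and kills the
wedge products is zero. -/
theorem FormField.tensor_eq_zero {W : Type*} [AddCommGroup W] [Module ℝ W]
    (T : FormField E M 2 → W) (x : M)
    (hadd : ∀ σ τ : FormField E M 2, σ.Smooth → τ.Smooth → T (σ + τ) = T σ + T τ)
    (hsmul : ∀ (f : M → ℝ) (σ : FormField E M 2), SmoothFun E f → σ.Smooth →
      T (σ.fsmul f) = f x • T σ)
    (hd : ∀ α β : CovectorField E M, α.Smooth → β.Smooth → T (α.wedge β) = 0)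
    {σ : FormField E M 2} (hσ : σ.Smooth) : T σ = 0 := by
  obtain ⟨c, hc, -, h1⟩ := exists_coordinates (E := E) x
  obtain ⟨f, hf, h⟩ := h1 σ hσ
  obtain ⟨χ, hχ, hχx, hχ0⟩ := exists_smoothFun_cutoff E x h
  have hs : ∀ i j, FormField.Smooth
      (FormField.fsmul (f i j) ((dFun E (c i)).wedge (dFun E (c j)))) :=
    fun i j => ((hc i).dFun.wedge (hc j).dFun).fsmul (hf i j)
  have hss : ∀ i, FormField.Smooth
      (∑ j, FormField.fsmul (f i j) ((dFun E (c i)).wedge (dFun E (c j)))) :=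
    fun i => FormField.Smooth.sum fun j _ => hs i j
  have hT : ∀ (s : Finset (Fin (Module.finrank ℝ E))) (σ : Fin (Module.finrank ℝ E) →
      FormField E M 2), (∀ i, (σ i).Smooth) → (∀ i, T (σ i) = 0) → T (∑ i ∈ s, σ i) = 0 := by
    intro s σ hσ h0
    induction s using Finset.induction_on with
    | empty =>
      have := hadd 0 0 FormField.smooth_zero FormField.smooth_zero
      rw [add_zero] at this
      simpa using this
    | insert i s hi ih =>
      rw [Finset.sum_insert hi, hadd _ _ (hσ i) (FormField.Smooth.sum fun j _ => hσ j), ih, h0,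
        add_zero]
  have hsum := hT Finset.univ _ hss fun i => hT Finset.univ _ (hs i) fun j => by
    rw [hsmul _ _ (hf i j) ((hc i).dFun.wedge (hc j).dFun), hd _ _ (hc i).dFun (hc j).dFun,
      smul_zero]
  have h2 : σ.fsmul χ = FormField.fsmul χ
      (∑ i, ∑ j, FormField.fsmul (f i j) ((dFun E (c i)).wedge (dFun E (c j)))) := by
    funext y
    by_cases hy : σ y = (∑ i, ∑ j, FormField.fsmul (f i j)
        ((dFun E (c i)).wedge (dFun E (c j)))) y
    · exact congrArg (χ y • ·) hy
    · have h0 : χ y = 0 := hχ0 y hy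
      simp only [FormField.fsmul, h0, zero_smul]
  have h3 := congrArg T h2
  rw [hsmul _ _ hχ hσ, hsmul _ _ hχ (FormField.Smooth.sum fun j _ => hss j), hsum, hχx,
    one_smul, smul_zero] at h3
  exact h3

end Tensoriality
end

noncomputable section

/-! ### Metrics in parametrizations -/

section PullMetric

variable {E : Type*} [NormedAddCommGroup E] [NormedSpace ℝ E] [FiniteDimensional ℝ E]
  {M : Type*} [TopologicalSpace M] [ChartedSpace E M] [IsManifold 𝓘(ℝ, E) ∞ M]

/-- Nondegeneracy is injectivity of the map to the dual, which has the same dimension. -/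
theorem isInvertible_of_nondegenerate {B : E →L[ℝ] E →L[ℝ] ℝ}
    (hB : ∀ v, (∀ w, B v w = 0) → v = 0) : B.IsInvertible := by
  let e : E ≃ₗ[ℝ] (E →L[ℝ] ℝ) := LinearMap.linearEquivOfInjective B.toLinearMap
    ((injective_iff_map_eq_zero _).2 fun v hv => hB v fun w => DFunLike.congr_fun hv w)
    ((Subspace.dual_finrank_eq (K := ℝ) (V := E)).symm.trans
      (LinearMap.toContinuousLinearMap (𝕜 := ℝ) (E := E) (F' := ℝ)).finrank_eq)
  exact ⟨e.toContinuousLinearEquiv, by ext v w; rfl⟩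

theorem ContinuousLinearMap.IsInvertible.inverse_eq {B : E →L[ℝ] E →L[ℝ] ℝ} (hB : B.IsInvertible)
    {y : E} {a : E →L[ℝ] ℝ} (h : B y = a) : B.inverse a = y := by
  obtain ⟨e, rfl⟩ := hB
  rw [← h, ContinuousLinearMap.inverse_equiv]
  exact e.symm_apply_apply y

variable (g : PseudoRiemannianMetric E M) {ψ : LocalParam E M} {w : E}

/-- The pullback of a metric by a map from `E` to `M`. -/
def pullMetric (ψ : E → M) (w : E) : E →L[ℝ] E →L[ℝ] ℝ :=
  ContinuousLinearMap.bilinearComp (E := E) (F := E) (g.val (ψ w)) (modelDeriv E E ψ w)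
    (modelDeriv E E ψ w)

theorem pullMetric_apply (ψ : E → M) (w y z : E) :
    pullMetric g ψ w y z = (g.val (ψ w) : E →L[ℝ] E →L[ℝ] ℝ) (modelDeriv E E ψ w y)
      (modelDeriv E E ψ w z) := rfl

theorem contMDiffAt_modelDeriv_apply (hw : w ∈ ψ.source) (y : E) :
    ContMDiffAt 𝓘(ℝ, E) (𝓘(ℝ, E).prod 𝓘(ℝ, E)) ∞
      (fun w => Bundle.TotalSpace.mk' E (E := fun x : M => TangentSpace 𝓘(ℝ, E) x) (ψ.toFun w)
        (mfderiv 𝓘(ℝ, E) 𝓘(ℝ, E) ψ.toFun w y)) w := by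
  have hψ := ψ.contMDiffOn_toFun.contMDiffAt (ψ.open_source.mem_nhds hw)
  refine ContMDiffAt.clm_apply_of_inCoordinates (F₁ := E) (F₂ := E)
    (E₁ := fun x : E => TangentSpace 𝓘(ℝ, E) x) (E₂ := fun x : M => TangentSpace 𝓘(ℝ, E) x)
    (IM := 𝓘(ℝ, E)) (IB₁ := 𝓘(ℝ, E)) (IB₂ := 𝓘(ℝ, E))
    (b₁ := (id : E → E)) (b₂ := ψ.toFun) (v := fun _ : E => y)
    (ϕ := fun w => mfderiv 𝓘(ℝ, E) 𝓘(ℝ, E) ψ.toFun w)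
    (hψ.mfderiv_const le_rfl) ?_ hψ
  rw [← contMDiffWithinAt_univ]
  exact contMDiffWithinAt_vectorSpace_iff_contDiffWithinAt.2 contDiffWithinAt_const

theorem pullMetric_contDiffAt (hw : w ∈ ψ.source) : ContDiffAt ℝ ∞ (pullMetric g ψ.toFun) w := by
  refine contDiffAt_covector fun y => contDiffAt_covector fun z => ?_
  have hψ := ψ.contMDiffOn_toFun.contMDiffAt (ψ.open_source.mem_nhds hw)
  have h1 := ContMDiffAt.clm_bundle_apply₂ (F₁ := E) (F₂ := E) (F₃ := ℝ)
    (E₁ := fun x : M => TangentSpace 𝓘(ℝ, E) x) (E₂ := fun x : M => TangentSpace 𝓘(ℝ, E) x)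
    (E₃ := fun _ : M => ℝ) (g.smooth.contMDiffAt.comp w hψ)
    (contMDiffAt_modelDeriv_apply hw y) (contMDiffAt_modelDeriv_apply hw z)
  rw [Bundle.contMDiffAt_totalSpace] at h1
  exact contMDiffAt_iff_contDiffAt.1 h1.2

theorem pullMetric_isInvertible (hw : w ∈ ψ.source) : (pullMetric g ψ.toFun w).IsInvertible :=
  isInvertible_of_nondegenerate fun v hv => by
    have h1 : ψ.derivEquiv hw v = 0 := g.nondegenerate (ψ.toFun w) _ fun z => by
      have h := hv ((ψ.derivEquiv hw).symm z)
      have h2 : modelDeriv E E ψ.toFun w ((ψ.derivEquiv hw).symm z) = z :=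
        (ψ.derivEquiv hw).apply_symm_apply z
      rw [pullMetric_apply, h2] at h
      exact h
    exact (ψ.derivEquiv hw).map_eq_zero_iff.1 h1

theorem inner_apply_param (hw : w ∈ ψ.source) (α β : CovectorField E M) :
    g.inner α β (ψ.toFun w) =
      covInner (pullMetric g ψ.toFun w) (pullCov ψ.toFun α w) (pullCov ψ.toFun β w) := by
  have h : ∀ α : CovectorField E M, (pullMetric g ψ.toFun w).inverse (pullCov ψ.toFun α w) =
      (ψ.derivEquiv hw).symm ((g.flat (ψ.toFun w)).symm (α (ψ.toFun w))) := fun α => by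
    refine (pullMetric_isInvertible g hw).inverse_eq ?_
    ext z
    have h2 : ∀ z, modelDeriv E E ψ.toFun w ((ψ.derivEquiv hw).symm z) = z :=
      (ψ.derivEquiv hw).apply_symm_apply
    rw [pullMetric_apply, h2, pullCov_apply]
    exact DFunLike.congr_fun ((g.flat (ψ.toFun w)).apply_symm_apply (α (ψ.toFun w)))
      (modelDeriv E E ψ.toFun w z)
  have h2 : ∀ z, modelDeriv E E ψ.toFun w ((ψ.derivEquiv hw).symm z) = z :=
    (ψ.derivEquiv hw).apply_symm_apply
  rw [covInner, h, h, pullMetric_apply, h2, h2]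
  rfl

/-- The metric at a point, as a bilinear form on the model space. -/
def PseudoRiemannianMetric.modelVal (x : M) : E →L[ℝ] E →L[ℝ] ℝ := g.val x

/-- The metric induced on the covectors at a point. -/
def covectorInner (x : M) (a b : E →L[ℝ] ℝ) : ℝ :=
  g.modelVal x ((g.flat x).symm a) ((g.flat x).symm b)

theorem covectorInner_symm (x : M) (a b : E →L[ℝ] ℝ) :
    covectorInner g x a b = covectorInner g x b a := g.symm x _ _

theorem covectorInner_sub_left (x : M) (a a' b : E →L[ℝ] ℝ) :
    covectorInner g x (a - a') b = covectorInner g x a b - covectorInner g x a' b := by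
  rw [covectorInner, map_sub, map_sub]
  rfl

theorem eq_zero_of_covectorInner (x : M) {a : E →L[ℝ] ℝ} (h : ∀ b, covectorInner g x a b = 0) :
    a = 0 := by
  have h1 : (g.flat x).symm a = 0 := g.nondegenerate x _ fun (v : E) => by
    have := h (g.flat x v)
    rw [covectorInner, LinearEquiv.symm_apply_apply] at this
    exact this
  simpa using h1

end PullMetric

/-! ### Uniqueness of the operators -/

section Uniqueness

variable {E : Type*} [NormedAddCommGroup E] [NormedSpace ℝ E] [FiniteDimensional ℝ E]
  {M : Type*} [TopologicalSpace M] [ChartedSpace E M] [IsManifold 𝓘(ℝ, E) ∞ M] [T2Space M]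
  (g : PseudoRiemannianMetric E M) (π : BivectorField E M)

/-- The metric and torsion conditions at a point. -/
structure IsMetricConnectionAt (x : M)
    (A : CovectorField E M → CovectorField E M → E →L[ℝ] ℝ) : Prop where
  torsionFree : ∀ α β : CovectorField E M, α.Smooth → β.Smooth →
    A α β - A β α = π.koszul α β x
  metric : ∀ α β γ : CovectorField E M, α.Smooth → β.Smooth → γ.Smooth →
    π.eval α (dFun E (g.inner β γ)) x =
      covectorInner g x (A α β) (γ x) + covectorInner g x (β x) (A α γ)

variable {g π}

/-- The Koszul argument. Paired with a third form, the difference of two solutions is symmetric in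
the first two arguments, by the torsion condition, and antisymmetric in the last two, by the metric
condition; hence it is zero. No tensoriality is assumed, which allows purely local expressions as
operators. -/
theorem IsMetricConnectionAt.unique {x : M}
    {A A' : CovectorField E M → CovectorField E M → E →L[ℝ] ℝ}
    (hA : IsMetricConnectionAt g π x A) (hA' : IsMetricConnectionAt g π x A')
    {α β : CovectorField E M} (hα : α.Smooth) (hβ : β.Smooth) : A α β = A' α β := by
  let t := fun α β γ : CovectorField E M => covectorInner g x (A α β - A' α β) (γ x)
  have h12 : ∀ α β γ : CovectorField E M, α.Smooth → β.Smooth → t α β γ = t β α γ := by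
    intro α β γ hα hβ
    have h : A α β - A' α β = A β α - A' β α := by
      have := (hA.torsionFree α β hα hβ).trans (hA'.torsionFree α β hα hβ).symm
      rw [sub_eq_sub_iff_add_eq_add] at this ⊢
      rw [this]; abel
    simp only [t, h]
  have h23 : ∀ α β γ : CovectorField E M, α.Smooth → β.Smooth → γ.Smooth →
      t α β γ = -t α γ β := by
    intro α β γ hα hβ hγ
    have h1 := hA.metric α β γ hα hβ hγ
    have h2 := hA'.metric α β γ hα hβ hγ
    have h3 : t α β γ = _ := covectorInner_sub_left g x (A α β) (A' α β) (γ x)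
    have h4 : t α γ β = _ := covectorInner_sub_left g x (A α γ) (A' α γ) (β x)
    rw [covectorInner_symm g x (β x)] at h1 h2
    rw [h3, h4]
    linarith
  rw [← sub_eq_zero]
  refine eq_zero_of_covectorInner g x fun b => ?_
  -- The third covector has to come from a smooth form, because the symmetries permute all three
  -- slots.
  obtain ⟨f, hf, rfl⟩ := exists_dFun_eq x b
  have hγ := hf.dFun
  have e1 := h12 α β (dFun E f) hα hβ
  have e2 := h23 β α (dFun E f) hβ hα hγ
  have e3 := h12 β (dFun E f) α hβ hγ
  have e4 := h23 (dFun E f) β α hγ hβ hα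
  have e5 := h12 (dFun E f) α β hγ hα
  have e6 := h23 α (dFun E f) β hα hγ hβ
  change t α β (dFun E f) = 0
  linarith

/-- Both operators have the same defect `r` in the product rule, so their difference is linear over
functions and is determined by differentials. -/
theorem CovectorField.operator_unique {W : Type*} [AddCommGroup W] [Module ℝ W]
    {T T' : CovectorField E M → W} (x : M) (r : (M → ℝ) → CovectorField E M → W)
    (hadd : ∀ α β : CovectorField E M, α.Smooth → β.Smooth → T (α + β) = T α + T β)
    (hadd' : ∀ α β : CovectorField E M, α.Smooth → β.Smooth → T' (α + β) = T' α + T' β)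
    (hsmul : ∀ (f : M → ℝ) (α : CovectorField E M), SmoothFun E f → α.Smooth →
      T (α.fsmul f) = f x • T α + r f α)
    (hsmul' : ∀ (f : M → ℝ) (α : CovectorField E M), SmoothFun E f → α.Smooth →
      T' (α.fsmul f) = f x • T' α + r f α)
    (hd : ∀ f, SmoothFun E f → T (dFun E f) = T' (dFun E f)) {α : CovectorField E M}
    (hα : α.Smooth) : T α = T' α := by
  refine sub_eq_zero.1 (CovectorField.tensor_eq_zero (fun α => T α - T' α) x
    (fun α β hα hβ => ?_) (fun f α hf hα => ?_) (fun f hf => sub_eq_zero.2 (hd f hf)) hα)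
  · rw [hadd _ _ hα hβ, hadd' _ _ hα hβ]; abel
  · rw [hsmul _ _ hf hα, hsmul' _ _ hf hα, smul_sub]; abel

theorem FormField.operator_unique {W : Type*} [AddCommGroup W] [Module ℝ W]
    {T T' : FormField E M 2 → W} (x : M) (r : (M → ℝ) → FormField E M 2 → W)
    (hadd : ∀ σ τ : FormField E M 2, σ.Smooth → τ.Smooth → T (σ + τ) = T σ + T τ)
    (hadd' : ∀ σ τ : FormField E M 2, σ.Smooth → τ.Smooth → T' (σ + τ) = T' σ + T' τ)
    (hsmul : ∀ (f : M → ℝ) (σ : FormField E M 2), SmoothFun E f → σ.Smooth →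
      T (σ.fsmul f) = f x • T σ + r f σ)
    (hsmul' : ∀ (f : M → ℝ) (σ : FormField E M 2), SmoothFun E f → σ.Smooth →
      T' (σ.fsmul f) = f x • T' σ + r f σ)
    (hd : ∀ α β : CovectorField E M, α.Smooth → β.Smooth → T (α.wedge β) = T' (α.wedge β))
    {σ : FormField E M 2} (hσ : σ.Smooth) : T σ = T' σ := by
  refine sub_eq_zero.1 (FormField.tensor_eq_zero (fun σ => T σ - T' σ) x
    (fun σ τ hσ hτ => ?_) (fun f σ hf hσ => ?_)
    (fun α β hα hβ => sub_eq_zero.2 (hd α β hα hβ)) hσ)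
  · rw [hadd _ _ hσ hτ, hadd' _ _ hσ hτ]; abel
  · rw [hsmul _ _ hf hσ, hsmul' _ _ hf hσ, smul_sub]; abel

end Uniqueness
end

noncomputable section

/-! ### Frames of commuting Killing fields -/

section FrameCongr

variable {E : Type*} [NormedAddCommGroup E] [NormedSpace ℝ E] {ι : Type*} [Fintype ι]
  {u v : ι → E → E} {w : E}

theorem frameConn_congr (a : E →L[ℝ] ℝ) {b b' : E → E →L[ℝ] ℝ} (h : b =ᶠ[𝓝 w] b') :
    frameConn u v a b w = frameConn u v a b' w := by
  simp only [frameConn, lieCov, h.fderiv_eq, h.eq_of_nhds]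

theorem frameConnForm_congr (a : E →L[ℝ] ℝ) {σ σ' : E → E [⋀^Fin 2]→L[ℝ] ℝ} (h : σ =ᶠ[𝓝 w] σ') :
    frameConnForm u v a σ w = frameConnForm u v a σ' w := by
  simp only [frameConnForm, lieForm, h.fderiv_eq, h.eq_of_nhds]

theorem frameBracket_congr {a a' b b' : E → E →L[ℝ] ℝ} (ha : a =ᶠ[𝓝 w] a') (hb : b =ᶠ[𝓝 w] b') :
    frameBracket u v a b w = frameBracket u v a' b' w := by
  simp only [frameBracket, lieCov, ha.fderiv_eq, ha.eq_of_nhds, hb.fderiv_eq, hb.eq_of_nhds]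

end FrameCongr

/-! ### The geometric operations read in an adapted frame -/

section AdaptedFrame

variable {E : Type*} [NormedAddCommGroup E] [NormedSpace ℝ E] [FiniteDimensional ℝ E]
  {M : Type*} [TopologicalSpace M] [ChartedSpace E M] [IsManifold 𝓘(ℝ, E) ∞ M]

/-- A local expression `π = ∑ uᵣ ∧ vᵣ` of a bivector field by commuting Killing fields. -/
structure AdaptedFrame (g : PseudoRiemannianMetric E M) (π : BivectorField E M) where
  /-- The parametrization. -/
  param : LocalParam E M
  /-- The number of terms. -/
  size : ℕ
  /-- The first factors, in the parametrization. -/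
  left : Fin size → E → E
  /-- The second factors, in the parametrization. -/
  right : Fin size → E → E
  commuting : ∀ w ∈ param.source, IsCommutingFrame left right w
  killing_left : ∀ w ∈ param.source, ∀ r, IsKillingAt (pullMetric g param.toFun) (left r) w
  killing_right : ∀ w ∈ param.source, ∀ r, IsKillingAt (pullMetric g param.toFun) (right r) w
  bivector : ∀ w ∈ param.source, (π (param.toFun w) : ⋀[ℝ]^2 E) =
    ∑ r, exteriorPower.ιMulti ℝ 2 ![param.deriv w (left r w), param.deriv w (right r w)]

variable {g : PseudoRiemannianMetric E M} {π : BivectorField E M} (F : AdaptedFrame g π) {w : E}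

theorem eval_param (hw : w ∈ F.param.source) (α β : CovectorField E M) :
    π.eval α β (F.param.toFun w) =
      frameEval F.left F.right (pullCov F.param.toFun α w) (pullCov F.param.toFun β w) w := by
  have h1 : π.eval α β (F.param.toFun w) = bivectorEval (V := E)
    (∑ r, exteriorPower.ιMulti ℝ 2 ![F.param.deriv w (F.left r w), F.param.deriv w (F.right r w)])
    (α (F.param.toFun w)) (β (F.param.toFun w)) :=
      congrArg (fun P : ⋀[ℝ]^2 E => bivectorEval (V := E) P (α (F.param.toFun w))
        (β (F.param.toFun w))) (F.bivector w hw)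
  rw [h1]
  simp only [bivectorEval, map_sum, exteriorPower.alternatingMapLinearEquiv_apply_ιMulti]
  rfl

theorem sharp_param (hw : w ∈ F.param.source) (α : CovectorField E M) :
    bivectorSharp (V := E) (π (F.param.toFun w)) (α (F.param.toFun w)) =
      F.param.deriv w (frameSharp F.left F.right (pullCov F.param.toFun α w) w) := by
  have h1 := congrArg (fun P : ⋀[ℝ]^2 E => bivectorSharp (V := E) P (α (F.param.toFun w)))
    (F.bivector w hw)
  refine h1.trans ?_
  simp only [bivectorSharp, map_sum, bivectorLift_ιMulti, frameSharp, map_sub, map_smul]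
  rfl

theorem pullForm_contract (hw : w ∈ F.param.source) {k : ℕ} (ε : FormField E M (k + 2)) :
    pullForm F.param.toFun (π.contract ε) w =
      ∑ r, interiorProduct (F.right r) (interiorProduct (F.left r)
        (pullForm F.param.toFun ε)) w := by
  have h1 := congrArg (fun P : ⋀[ℝ]^2 E => (bivectorContract (V := E) P
    (ε (F.param.toFun w))).compContinuousLinearMap (F.param.deriv w)) (F.bivector w hw)
  refine h1.trans ?_
  ext z
  simp only [bivectorContract, map_sum, bivectorLift_ιMulti,
    ContinuousAlternatingMap.compContinuousLinearMap_apply, ContinuousAlternatingMap.sum_apply]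
  refine Finset.sum_congr rfl fun r _ => ?_
  refine congrArg (ε (F.param.toFun w)) ?_
  funext i
  refine Fin.cases rfl (fun i => ?_) i
  refine Fin.cases rfl (fun i => ?_) i
  rfl

/-- This is the torsion identity `frameConn_torsion` carried to the manifold: in a frame the Koszul
bracket is `D_α β - D_β α`. -/
theorem pullCov_koszul (hw : w ∈ F.param.source) {α β : CovectorField E M} (hα : α.Smooth)
    (hβ : β.Smooth) :
    pullCov F.param.toFun (π.koszul α β) w =
      frameConn F.left F.right (pullCov F.param.toFun α w) (pullCov F.param.toFun β) w -
      frameConn F.left F.right (pullCov F.param.toFun β w) (pullCov F.param.toFun α) w := by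
  have hH := F.commuting w hw
  have ha := hα.pull (ψ := F.param) hw
  have hb := hβ.pull (ψ := F.param) hw
  have hev : (fun y => π.eval α β (F.param.toFun y)) =ᶠ[𝓝 w] fun y =>
      frameEval F.left F.right (pullCov F.param.toFun α y) (pullCov F.param.toFun β y) y :=
    (F.param.open_source.eventually_mem hw).mono fun y hy => eval_param F hy α β
  have hvc : ∀ α β : CovectorField E M, ContDiffAt ℝ ∞ (pullCov F.param.toFun β) w → ∀ z : E,
      vectorContract (V := E) (bivectorSharp (V := E) (π (F.param.toFun w))
        (α (F.param.toFun w))) (β.d (F.param.toFun w)) (F.param.deriv w z) =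
      dCov (pullCov F.param.toFun β) w
        ![frameSharp F.left F.right (pullCov F.param.toFun α w) w, z] := by
    intro α β hb z
    rw [sharp_param F hw, ← pullForm_covd hw hb]
    refine congrArg (β.d (F.param.toFun w)) ?_
    funext i
    fin_cases i <;> rfl
  ext z
  have h1 : pullCov F.param.toFun (π.koszul α β) w z =
    vectorContract (V := E) (bivectorSharp (V := E) (π (F.param.toFun w))
        (α (F.param.toFun w))) (β.d (F.param.toFun w)) (F.param.deriv w z) -
    vectorContract (V := E) (bivectorSharp (V := E) (π (F.param.toFun w))
        (β (F.param.toFun w))) (α.d (F.param.toFun w)) (F.param.deriv w z) +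
    pullCov F.param.toFun (dFun E (π.eval α β)) w z := rfl
  rw [h1, hvc _ _ hb, hvc _ _ ha, pullCov_dFun hw
    ((frameEval_contDiffAt hH ha hb).congr_of_eventuallyEq hev), hev.fderiv_eq,
    sub_apply, frameConn_torsion hH ha hb]

theorem inner_contDiffAt (hw : w ∈ F.param.source) {α β : CovectorField E M} (hα : α.Smooth)
    (hβ : β.Smooth) : ContDiffAt ℝ ∞ (fun y => g.inner α β (F.param.toFun y)) w :=
  (covInner_contDiffAt (pullMetric_contDiffAt g hw) (pullMetric_isInvertible g hw)
    (hα.pull hw) (hβ.pull hw)).congr_of_eventuallyEq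
    ((F.param.open_source.eventually_mem hw).mono fun _ hy => inner_apply_param g hy α β)

/-- The metric condition. In the frame `#α` is a combination of Killing fields, and along each of
these the metric on covectors satisfies the Leibniz rule with Lie derivatives. -/
theorem eval_dFun_inner (hw : w ∈ F.param.source) {α β γ : CovectorField E M}
    (hβ : β.Smooth) (hγ : γ.Smooth) :
    π.eval α (dFun E (g.inner β γ)) (F.param.toFun w) =
      covInner (pullMetric g F.param.toFun w)
        (frameConn F.left F.right (pullCov F.param.toFun α w) (pullCov F.param.toFun β) w)
        (pullCov F.param.toFun γ w) +
      covInner (pullMetric g F.param.toFun w) (pullCov F.param.toFun β w)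
        (frameConn F.left F.right (pullCov F.param.toFun α w) (pullCov F.param.toFun γ) w) := by
  have hH := F.commuting w hw
  have hb := hβ.pull (ψ := F.param) hw
  have hc := hγ.pull (ψ := F.param) hw
  have hev : (fun y => g.inner β γ (F.param.toFun y)) =ᶠ[𝓝 w] fun y =>
      covInner (pullMetric g F.param.toFun y) (pullCov F.param.toFun β y)
        (pullCov F.param.toFun γ y) :=
    (F.param.open_source.eventually_mem hw).mono fun _ hy => inner_apply_param g hy β γ
  have hG := pullMetric_contDiffAt g hw
  have hi := pullMetric_isInvertible g hw
  have hl := fun r => lieFun_covInner hG hi (F.killing_left w hw r) hb hc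
  have hr := fun r => lieFun_covInner hG hi (F.killing_right w hw r) hb hc
  rw [eval_param F hw, pullCov_dFun hw (inner_contDiffAt F hw hβ hγ), hev.fderiv_eq, frameEval]
  simp only [lieFun] at hl hr
  simp only [hl, hr]
  simp only [frameConn, covInner, map_sum, map_sub, map_smul, sum_apply, sub_apply,
    smul_apply, smul_eq_mul, ← Finset.sum_add_distrib]
  refine Finset.sum_congr rfl fun r _ => ?_
  ring

theorem eval_smoothFun (hF : ∀ x, ∃ F : AdaptedFrame g π, x ∈ F.param.target)
    {α β : CovectorField E M} (hα : α.Smooth) (hβ : β.Smooth) : SmoothFun E (π.eval α β) :=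
  smoothFun_of_pull fun x => by
    obtain ⟨F, hx⟩ := hF x
    have hw := LocalParam.inv_mem hx
    exact ⟨F.param, hx, (frameEval_contDiffAt (F.commuting _ hw) (hα.pull hw)
      (hβ.pull hw)).congr_of_eventuallyEq
      ((F.param.open_source.eventually_mem hw).mono fun y hy => eval_param F hy α β)⟩

theorem isPoisson_of_adaptedFrames (hF : ∀ x, ∃ F : AdaptedFrame g π, x ∈ F.param.target) :
    π.IsPoisson where
  smooth f h hf hh := eval_smoothFun hF hf.dFun hh.dFun
  jacobi f h k hf hh hk := by
    funext x
    obtain ⟨F, hx⟩ := hF x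
    have hw := LocalParam.inv_mem hx
    have key : ∀ f h k : M → ℝ, SmoothFun E f → SmoothFun E h → SmoothFun E k →
        π.bracket f (π.bracket h k) x =
          frameEval F.left F.right (fderiv ℝ (fun y => f (F.param.toFun y)) (F.param.invFun x))
            (fderiv ℝ (fun y => frameEval F.left F.right
              (fderiv ℝ (fun y => h (F.param.toFun y)) y)
              (fderiv ℝ (fun y => k (F.param.toFun y)) y) y) (F.param.invFun x))
            (F.param.invFun x) := by
      intro f h k hf hh hk
      have h1 : SmoothFun E (π.bracket h k) := eval_smoothFun hF hh.dFun hk.dFun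
      have h2 := eval_param F hw (dFun E f) (dFun E (π.bracket h k))
      rw [LocalParam.apply_inv hx] at h2
      refine h2.trans ?_
      rw [pullCov_dFun hw (hf.pull hw), pullCov_dFun hw (h1.pull hw)]
      congr 1
      refine Filter.EventuallyEq.fderiv_eq ?_
      filter_upwards [F.param.open_source.eventually_mem hw] with y hy
      refine (eval_param F hy _ _).trans ?_
      rw [pullCov_dFun hy (hh.pull hy), pullCov_dFun hy (hk.pull hy)]
    have h1 := frameEval_jacobi (F.commuting _ hw) (hf.pull hw) (hh.pull hw) (hk.pull hw)
    simp only [Pi.add_apply, Pi.zero_apply]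
    rw [key f h k hf hh hk, key h k f hh hk hf, key k f h hk hf hh]
    exact h1

theorem extDeriv_sum_eq {k : ℕ} {ι : Type*} {s : Finset ι} {η : ι → E → E [⋀^Fin k]→L[ℝ] ℝ}
    (hη : ∀ i ∈ s, DifferentiableAt ℝ (η i) w) :
    extDeriv (fun y => ∑ i ∈ s, η i y) w = ∑ i ∈ s, extDeriv (η i) w := by
  simp only [extDeriv, fderiv_fun_sum hη]
  exact map_sum (ContinuousAlternatingMap.alternatizeUncurryFinCLM ℝ E ℝ) _ _

/-- In a frame `π ⌟ ε` is the sum of the contractions of `ε` with `uᵣ` and `vᵣ`. The form `ε` has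
top degree, hence is closed, and Killing fields preserve it. -/
theorem contract_closed_of_adaptedFrames
    (hF : ∀ x, ∃ F : AdaptedFrame g π, x ∈ F.param.target) {k : ℕ}
    (hk : Module.finrank ℝ E = k + 2) {U : Set M} (hU : IsOpen U) {ε : FormField E M (k + 2)}
    (hε : g.IsVolumeFormOn U ε) {x : M} (hx : x ∈ U) : FormField.d (π.contract ε) x = 0 := by
  obtain ⟨F, hxF⟩ := hF x
  have hw := LocalParam.inv_mem hxF
  have hU' : F.param.toFun (F.param.invFun x) ∈ U := by rwa [LocalParam.apply_inv hxF]
  have hη := hε.smooth.pull hU hw hU'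
  have hH := F.commuting _ hw
  have hev : pullForm F.param.toFun (π.contract ε) =ᶠ[𝓝 (F.param.invFun x)] fun y =>
      ∑ r, interiorProduct (F.right r) (interiorProduct (F.left r)
        (pullForm F.param.toFun ε)) y :=
    (F.param.open_source.eventually_mem hw).mono fun y hy => pullForm_contract F hy ε
  have hs : ∀ r, ContDiffAt ℝ ∞ (interiorProduct (F.right r) (interiorProduct (F.left r)
        (pullForm F.param.toFun ε))) (F.param.invFun x) := fun r =>
    interiorProduct_contDiffAt (hH.smooth_right r)
      (interiorProduct_contDiffAt (hH.smooth_left r) hη)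
  have hsq : ∀ᶠ y in 𝓝 (F.param.invFun x), ∀ v : Fin (k + 2) → E,
      (pullForm F.param.toFun ε y v) ^ 2 =
        |Matrix.det (Matrix.of fun i j => pullMetric g F.param.toFun y (v i) (v j))| :=
    (LocalParam.eventually_mem hw hU hU').mono fun y hy v =>
      hε.sq_eq _ hy.2 fun i => F.param.deriv y (v i)
  have hG := pullMetric_contDiffAt g hw
  have hi := pullMetric_isInvertible g hw
  have hzero : pullForm F.param.toFun (FormField.d (π.contract ε)) (F.param.invFun x) = 0 := by
    rw [pullForm_d hw ((ContDiffAt.sum fun r _ => hs r).congr_of_eventuallyEq hev),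
      hev.extDeriv_eq, extDeriv_sum_eq fun r _ => (hs r).diff]
    refine Finset.sum_eq_zero fun r _ => ?_
    refine extDeriv_interiorProduct_interiorProduct (hH.smooth_left r) (hH.smooth_right r) hη
      (hH.comm_mixed r r).self_of_nhds.symm ?_ ?_ ?_
    · exact alternating_eq_zero_of_finrank_lt (by omega) _
    · exact lieForm_volume hk hG hi (F.killing_left _ hw r) hη hsq
    · exact lieForm_volume hk hG hi (F.killing_right _ hw r) hη hsq
  have h2 := pullForm_injective (σ := 0) hw (hzero.trans rfl)
  rw [LocalParam.apply_inv hxF] at h2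
  exact h2

end AdaptedFrame
end

noncomputable section

/-! ### Compatibility from frames of commuting Killing fields -/

section PullFunctions

variable {E : Type*} [NormedAddCommGroup E] [NormedSpace ℝ E]
  {M : Type*} [TopologicalSpace M] [ChartedSpace E M] {k : ℕ}

theorem pullCov_fun_add (ψ : E → M) (α β : CovectorField E M) :
    pullCov ψ (α + β) = fun w => pullCov ψ α w + pullCov ψ β w := rfl

theorem pullCov_fun_fsmul (ψ : E → M) (f : M → ℝ) (α : CovectorField E M) :
    pullCov ψ (α.fsmul f) = fun w => f (ψ w) • pullCov ψ α w := rfl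

theorem pullForm_fun_add (ψ : E → M) (η σ : FormField E M k) :
    pullForm ψ (η + σ) = fun w => pullForm ψ η w + pullForm ψ σ w := rfl

theorem pullForm_fun_fsmul (ψ : E → M) (f : M → ℝ) (η : FormField E M k) :
    pullForm ψ (η.fsmul f) = fun w => f (ψ w) • pullForm ψ η w := rfl

end PullFunctions

/-! ### Global operators with prescribed expressions in all frames -/

section Compatibility

variable {E : Type*} [NormedAddCommGroup E] [NormedSpace ℝ E] [FiniteDimensional ℝ E]
  {M : Type*} [TopologicalSpace M] [ChartedSpace E M] [IsManifold 𝓘(ℝ, E) ∞ M]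
  {g : PseudoRiemannianMetric E M} {π : BivectorField E M}

/-- The adapted frames cover the manifold. -/
def HasAdaptedFrames (g : PseudoRiemannianMetric E M) (π : BivectorField E M) : Prop :=
  ∀ x, ∃ F : AdaptedFrame g π, x ∈ F.param.target

/-- The local expression of the connection in a frame. -/
def AdaptedFrame.conn (F : AdaptedFrame g π) (α β : CovectorField E M) : CovectorField E M :=
  pushCov F.param fun y =>
    frameConn F.left F.right (pullCov F.param.toFun α y) (pullCov F.param.toFun β) y

/-- The local expression of the connection on `2`-forms in a frame. -/
def AdaptedFrame.connForm (F : AdaptedFrame g π) (α : CovectorField E M) (σ : FormField E M 2) :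
    FormField E M 2 :=
  pushForm F.param fun y =>
    frameConnForm F.left F.right (pullCov F.param.toFun α y) (pullForm F.param.toFun σ) y

/-- The local expression of the bracket of `1`-forms in a frame. -/
def AdaptedFrame.bracket (F : AdaptedFrame g π) (α β : CovectorField E M) : FormField E M 2 :=
  pushForm F.param
    (frameBracket F.left F.right (pullCov F.param.toFun α) (pullCov F.param.toFun β))

variable (g π) in
/-- An operator which has the expected expression in all adapted frames. -/
def IsFrameConnection (D : CovectorField E M → CovectorField E M → CovectorField E M) : Prop :=
  ∀ (F : AdaptedFrame g π) (w : E), w ∈ F.param.source → ∀ α β : CovectorField E M, α.Smooth →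
    β.Smooth → pullCov F.param.toFun (D α β) w =
      frameConn F.left F.right (pullCov F.param.toFun α w) (pullCov F.param.toFun β) w

variable (g π) in
/-- An operator on `2`-forms which has the expected expression in all adapted frames. -/
def IsFrameConnectionForm (D₂ : CovectorField E M → FormField E M 2 → FormField E M 2) : Prop :=
  ∀ (F : AdaptedFrame g π) (w : E), w ∈ F.param.source →
    ∀ (α : CovectorField E M) (σ : FormField E M 2), α.Smooth → σ.Smooth →
      pullForm F.param.toFun (D₂ α σ) w =
        frameConnForm F.left F.right (pullCov F.param.toFun α w) (pullForm F.param.toFun σ) w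

variable (g π) in
/-- A bracket of `1`-forms which has the expected expression in all adapted frames. -/
def IsFrameBracket (B : CovectorField E M → CovectorField E M → FormField E M 2) : Prop :=
  ∀ (F : AdaptedFrame g π) (w : E), w ∈ F.param.source → ∀ α β : CovectorField E M, α.Smooth →
    β.Smooth → pullForm F.param.toFun (B α β) w =
      frameBracket F.left F.right (pullCov F.param.toFun α) (pullCov F.param.toFun β) w

theorem CovectorField.ext_of_frames (hF : HasAdaptedFrames g π) {α β : CovectorField E M}
    (h : ∀ (F : AdaptedFrame g π) (w : E), w ∈ F.param.source →
      pullCov F.param.toFun α w = pullCov F.param.toFun β w) : α = β := by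
  funext x
  obtain ⟨F, hx⟩ := hF x
  have h1 := pullCov_injective (LocalParam.inv_mem hx) (h F _ (LocalParam.inv_mem hx))
  rwa [LocalParam.apply_inv hx] at h1

theorem FormField.ext_of_frames (hF : HasAdaptedFrames g π) {k : ℕ} {η σ : FormField E M k}
    (h : ∀ (F : AdaptedFrame g π) (w : E), w ∈ F.param.source →
      pullForm F.param.toFun η w = pullForm F.param.toFun σ w) : η = σ := by
  funext x
  obtain ⟨F, hx⟩ := hF x
  have h1 := pullForm_injective (LocalParam.inv_mem hx) (h F _ (LocalParam.inv_mem hx))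
  rwa [LocalParam.apply_inv hx] at h1

theorem CovectorField.smooth_of_frames (hF : HasAdaptedFrames g π) {α : CovectorField E M}
    (h : ∀ (F : AdaptedFrame g π) (w : E), w ∈ F.param.source →
      ContDiffAt ℝ ∞ (pullCov F.param.toFun α) w) : α.Smooth :=
  CovectorField.smooth_of_pull fun x => by
    obtain ⟨F, hx⟩ := hF x
    exact ⟨F.param, hx, h F _ (LocalParam.inv_mem hx)⟩

theorem FormField.smooth_of_frames (hF : HasAdaptedFrames g π) {k : ℕ} {η : FormField E M k}
    (h : ∀ (F : AdaptedFrame g π) (w : E), w ∈ F.param.source →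
      ContDiffAt ℝ ∞ (pullForm F.param.toFun η) w) : η.Smooth :=
  FormField.smoothOn_of_pull fun x _ => by
    obtain ⟨F, hx⟩ := hF x
    exact ⟨F.param, hx, h F _ (LocalParam.inv_mem hx)⟩

variable {D : CovectorField E M → CovectorField E M → CovectorField E M}
  {D₂ : CovectorField E M → FormField E M 2 → FormField E M 2}
  {B : CovectorField E M → CovectorField E M → FormField E M 2}

theorem IsFrameConnection.eventually (hD : IsFrameConnection g π D) (F : AdaptedFrame g π) {w : E}
    (hw : w ∈ F.param.source) {α β : CovectorField E M} (hα : α.Smooth) (hβ : β.Smooth) :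
    pullCov F.param.toFun (D α β) =ᶠ[𝓝 w] fun y =>
      frameConn F.left F.right (pullCov F.param.toFun α y) (pullCov F.param.toFun β) y :=
  (F.param.open_source.eventually_mem hw).mono fun y hy => hD F y hy α β hα hβ

theorem IsFrameConnection.smooth (hF : HasAdaptedFrames g π) (hD : IsFrameConnection g π D)
    {α β : CovectorField E M} (hα : α.Smooth) (hβ : β.Smooth) : (D α β).Smooth :=
  CovectorField.smooth_of_frames hF fun F w hw =>
    (frameConn_contDiffAt (F.commuting w hw) (hα.pull hw) (hβ.pull hw)).congr_of_eventuallyEq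
      (hD.eventually F hw hα hβ)

theorem pullCov_dFun_eventually (F : AdaptedFrame g π) {w : E} (hw : w ∈ F.param.source)
    {f : M → ℝ} (hf : SmoothFun E f) : pullCov F.param.toFun (dFun E f) =ᶠ[𝓝 w]
      fderiv ℝ fun y => f (F.param.toFun y) :=
  (F.param.open_source.eventually_mem hw).mono fun _ hy => pullCov_dFun hy (hf.pull hy)

theorem eval_dFun_param (F : AdaptedFrame g π) {w : E} (hw : w ∈ F.param.source)
    {f : M → ℝ} (hf : SmoothFun E f) (α : CovectorField E M) :
    π.eval α (dFun E f) (F.param.toFun w) = frameEval F.left F.right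
      (pullCov F.param.toFun α w) (fderiv ℝ (fun y => f (F.param.toFun y)) w) w := by
  rw [eval_param F hw, pullCov_dFun hw (hf.pull hw)]

theorem IsFrameConnection.isMetric (hF : HasAdaptedFrames g π) (hD : IsFrameConnection g π D) :
    IsMetricContravariantConnection g π D where
  connection :=
    { smooth := fun α β hα hβ => hD.smooth hF hα hβ
      add_left := fun α α' β hα hα' hβ => CovectorField.ext_of_frames hF fun F w hw => by
        rw [hD F w hw _ _ (hα.add hα') hβ, pullCov_add, pullCov_add, frameConn_add_left,
          hD F w hw _ _ hα hβ, hD F w hw _ _ hα' hβ]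
      add_right := fun α β β' hα hβ hβ' => CovectorField.ext_of_frames hF fun F w hw => by
        rw [hD F w hw _ _ hα (hβ.add hβ'), pullCov_add, hD F w hw _ _ hα hβ,
          hD F w hw _ _ hα hβ', pullCov_fun_add]
        exact frameConn_add_right _ (hβ.pull hw).diff (hβ'.pull hw).diff
      fsmul_left := fun f α β hf hα hβ => CovectorField.ext_of_frames hF fun F w hw => by
        rw [hD F w hw _ _ (hα.fsmul hf) hβ, pullCov_fsmul, pullCov_fsmul, frameConn_smul_left,
          hD F w hw _ _ hα hβ]
      leibniz := fun f α β hf hα hβ => CovectorField.ext_of_frames hF fun F w hw => by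
        rw [hD F w hw _ _ hα (hβ.fsmul hf), pullCov_add, pullCov_fsmul, pullCov_fsmul,
          hD F w hw _ _ hα hβ, eval_dFun_param F hw hf, pullCov_fun_fsmul]
        exact frameConn_leibniz _ (hf.pull hw).diff (hβ.pull hw).diff }
  torsionFree α β hα hβ := CovectorField.ext_of_frames hF fun F w hw => by
    rw [pullCov_sub, pullCov_sub, hD F w hw _ _ hα hβ, hD F w hw _ _ hβ hα,
      pullCov_koszul F hw hα hβ, sub_self]
    rfl
  metric α β γ hα hβ hγ := by
    funext x
    obtain ⟨F, hx⟩ := hF x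
    have hw := LocalParam.inv_mem hx
    have h1 := eval_dFun_inner F hw (α := α) hβ hγ
    rw [← hD F _ hw _ _ hα hβ, ← hD F _ hw _ _ hα hγ, ← inner_apply_param g hw,
      ← inner_apply_param g hw, LocalParam.apply_inv hx] at h1
    exact h1

theorem koszul_smooth (hF : HasAdaptedFrames g π)
    {α β : CovectorField E M} (hα : α.Smooth) (hβ : β.Smooth) : (π.koszul α β).Smooth :=
  CovectorField.smooth_of_frames hF fun F w hw => by
    refine ((frameConn_contDiffAt (F.commuting w hw) (hα.pull hw) (hβ.pull hw)).sub
      (frameConn_contDiffAt (F.commuting w hw) (hβ.pull hw)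
        (hα.pull hw))).congr_of_eventuallyEq ?_
    exact (F.param.open_source.eventually_mem hw).mono fun y hy => pullCov_koszul F hy hα hβ

theorem IsFrameConnection.isFlat (hF : HasAdaptedFrames g π) (hD : IsFrameConnection g π D) :
    IsFlat π D := fun α β γ hα hβ hγ => CovectorField.ext_of_frames hF fun F w hw => by
  rw [pullCov_sub, pullCov_sub, hD F w hw _ _ hα (hD.smooth hF hβ hγ),
    hD F w hw _ _ hβ (hD.smooth hF hα hγ), hD F w hw _ _ (koszul_smooth hF hα hβ) hγ,
    pullCov_koszul F hw hα hβ, frameConn_congr _ (hD.eventually F hw hβ hγ),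
    frameConn_congr _ (hD.eventually F hw hα hγ)]
  exact frameConn_flat (F.commuting w hw) (hα.pull hw) (hβ.pull hw) (hγ.pull hw)

theorem IsFrameConnectionForm.smooth (hF : HasAdaptedFrames g π)
    (hD : IsFrameConnectionForm g π D₂) {α : CovectorField E M} {σ : FormField E M 2}
    (hα : α.Smooth) (hσ : σ.Smooth) : FormField.Smooth (D₂ α σ) :=
  FormField.smooth_of_frames hF fun F w hw =>
    (frameConnForm_contDiffAt (F.commuting w hw) (hα.pull hw) (hσ.pull hw)).congr_of_eventuallyEq
      ((F.param.open_source.eventually_mem hw).mono fun y hy => hD F y hy α σ hα hσ)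

theorem IsFrameBracket.eventually (hB : IsFrameBracket g π B) (F : AdaptedFrame g π) {w : E}
    (hw : w ∈ F.param.source) {α β : CovectorField E M} (hα : α.Smooth) (hβ : β.Smooth) :
    pullForm F.param.toFun (B α β) =ᶠ[𝓝 w]
      frameBracket F.left F.right (pullCov F.param.toFun α) (pullCov F.param.toFun β) :=
  (F.param.open_source.eventually_mem hw).mono fun y hy => hB F y hy α β hα hβ

theorem IsFrameBracket.smooth (hF : HasAdaptedFrames g π)
    (hB : IsFrameBracket g π B) {α β : CovectorField E M}
    (hα : α.Smooth) (hβ : β.Smooth) : FormField.Smooth (B α β) :=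
  FormField.smooth_of_frames hF fun F w hw =>
    (frameBracket_contDiffAt (F.commuting w hw) (hα.pull hw) (hβ.pull hw)).congr_of_eventuallyEq
      (hB.eventually F hw hα hβ)

/-- `d(D_{df} β)` in a frame. -/
theorem IsFrameConnection.pullForm_d (hF : HasAdaptedFrames g π) (hD : IsFrameConnection g π D)
    (F : AdaptedFrame g π) {w : E} (hw : w ∈ F.param.source) {f : M → ℝ} {β : CovectorField E M}
    (hf : SmoothFun E f) (hβ : β.Smooth) :
    pullForm F.param.toFun (D (dFun E f) β).d w =
      frameBracket F.left F.right (pullCov F.param.toFun (dFun E f)) (pullCov F.param.toFun β) w +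
      frameConnForm F.left F.right (pullCov F.param.toFun (dFun E f) w)
        (pullForm F.param.toFun β.d) w := by
  have hdf := pullCov_dFun_eventually F hw hf
  have hb := hβ.pull (ψ := F.param) hw
  rw [pullForm_covd hw ((hD.smooth hF hf.dFun hβ).pull hw)]
  have h1 : pullCov F.param.toFun (D (dFun E f) β) =ᶠ[𝓝 w] fun y => frameConn F.left F.right
      (fderiv ℝ (fun y => f (F.param.toFun y)) y) (pullCov F.param.toFun β) y :=
    (hD.eventually F hw hf.dFun hβ).trans (hdf.mono fun y hy =>
      congrArg (fun a => frameConn F.left F.right a (pullCov F.param.toFun β) y) hy)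
  have h2 : dCov (pullCov F.param.toFun (D (dFun E f) β)) w = dCov (fun y =>
      frameConn F.left F.right
      (fderiv ℝ (fun y => f (F.param.toFun y)) y) (pullCov F.param.toFun β) y) w :=
    Filter.EventuallyEq.extDeriv_eq (h1.mono fun y hy => congrArg
      (ContinuousAlternatingMap.ofSubsingleton ℝ E ℝ (0 : Fin 1)) hy)
  have h3 : pullForm F.param.toFun β.d =ᶠ[𝓝 w] dCov (pullCov F.param.toFun β) :=
    (F.param.open_source.eventually_mem hw).mono fun y hy => pullForm_covd hy (hβ.pull hy)
  rw [h2, frameConn_fderiv_leibniz (F.commuting w hw) (hf.pull hw) hb,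
    frameBracket_congr hdf Filter.EventuallyEq.rfl, frameConnForm_congr _ h3, hdf.eq_of_nhds]

theorem isGeneralizedBracket_of_frames (hF : HasAdaptedFrames g π) (hD : IsFrameConnection g π D)
    (hD₂ : IsFrameConnectionForm g π D₂) (hB : IsFrameBracket g π B) :
    IsGeneralizedBracket π D D₂ B where
  ext_smooth α σ hα hσ := hD₂.smooth hF hα hσ
  ext_add α σ τ hα hσ hτ := FormField.ext_of_frames hF fun F w hw => by
    rw [hD₂ F w hw _ _ hα (hσ.add hτ), pullForm_add, hD₂ F w hw _ _ hα hσ, hD₂ F w hw _ _ hα hτ,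
      pullForm_fun_add]
    exact frameConnForm_add _ (hσ.pull hw).diff (hτ.pull hw).diff
  ext_leibniz f α σ hf hα hσ := FormField.ext_of_frames hF fun F w hw => by
    rw [hD₂ F w hw _ _ hα (hσ.fsmul hf), pullForm_add, pullForm_fsmul, pullForm_fsmul,
      hD₂ F w hw _ _ hα hσ, eval_dFun_param F hw hf, pullForm_fun_fsmul]
    exact frameConnForm_leibniz _ (hf.pull hw).diff (hσ.pull hw).diff
  ext_wedge α β γ hα hβ hγ := FormField.ext_of_frames hF fun F w hw => by
    rw [hD₂ F w hw _ _ hα (hβ.wedge hγ), pullForm_add, pullForm_wedge, pullForm_wedge,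
      pullForm_wedge]
    beta_reduce
    rw [hD F w hw _ _ hα hβ, hD F w hw _ _ hα hγ]
    exact frameConnForm_covWedge _ (hβ.pull hw) (hγ.pull hw)
  smooth α β hα hβ := hB.smooth hF hα hβ
  symm α β hα hβ := FormField.ext_of_frames hF fun F w hw => by
    rw [hB F w hw _ _ hα hβ, hB F w hw _ _ hβ hα, frameBracket_symm]
  add_left α α' β hα hα' hβ := FormField.ext_of_frames hF fun F w hw => by
    rw [hB F w hw _ _ (hα.add hα') hβ, pullForm_add, hB F w hw _ _ hα hβ, hB F w hw _ _ hα' hβ,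
      pullCov_fun_add]
    exact frameBracket_add_left (hα.pull hw).diff (hα'.pull hw).diff _
  product f α β hf hα hβ := FormField.ext_of_frames hF fun F w hw => by
    rw [hB F w hw _ _ (hα.fsmul hf) hβ, pullForm_add, pullForm_fsmul, hB F w hw _ _ hα hβ,
      pullForm_wedge, pullCov_fun_fsmul]
    beta_reduce
    rw [hD F w hw _ _ hf.dFun hβ, pullCov_dFun hw (hf.pull hw)]
    exact frameBracket_product (hf.pull hw).diff (hα.pull hw).diff _
  leibniz f β hf hβ := FormField.ext_of_frames hF fun F w hw => by
    rw [hD.pullForm_d hF F hw hf hβ, pullForm_add, hB F w hw _ _ hf.dFun hβ,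
      hD₂ F w hw _ _ hf.dFun hβ.d]

theorem metacurvature_of_frames (hF : HasAdaptedFrames g π) (hD : IsFrameConnection g π D)
    (hD₂ : IsFrameConnectionForm g π D₂) (hB : IsFrameBracket g π B) {f : M → ℝ}
    {β γ : CovectorField E M} (hf : SmoothFun E f) (hβ : β.Smooth) (hγ : γ.Smooth) :
    D₂ (dFun E f) (B β γ) - B (D (dFun E f) β) γ - B (D (dFun E f) γ) β = 0 :=
  FormField.ext_of_frames hF fun F w hw => by
    have hdf := pullCov_dFun_eventually F hw hf
    have h1 : ∀ {β : CovectorField E M}, β.Smooth → pullCov F.param.toFun (D (dFun E f) β) =ᶠ[𝓝 w]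
        fun y => frameConn F.left F.right
        (fderiv ℝ (fun y => f (F.param.toFun y)) y) (pullCov F.param.toFun β) y := fun hβ =>
      (hD.eventually F hw hf.dFun hβ).trans (hdf.mono fun y hy =>
        congrArg (fun a => frameConn F.left F.right a (pullCov F.param.toFun _) y) hy)
    rw [pullForm_sub, pullForm_sub, hD₂ F w hw _ _ hf.dFun (hB.smooth hF hβ hγ),
      hB F w hw _ _ (hD.smooth hF hf.dFun hβ) hγ, hB F w hw _ _ (hD.smooth hF hf.dFun hγ) hβ,
      frameConnForm_congr _ (hB.eventually F hw hβ hγ), hdf.eq_of_nhds,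
      frameBracket_congr (h1 hβ) Filter.EventuallyEq.rfl,
      frameBracket_congr (h1 hγ) Filter.EventuallyEq.rfl]
    exact frameBracket_metacurvature (F.commuting w hw) (hf.pull hw) (hβ.pull hw) (hγ.pull hw)

/-! ### Uniqueness, gluing of the local expressions, and compatibility -/

variable [T2Space M]

/-- The expression in one frame satisfies the torsion and metric conditions at each point of its
image. By pointwise uniqueness it therefore agrees with the expression in any other frame and with
any global metric connection. -/
theorem AdaptedFrame.isMetricConnectionAt (F : AdaptedFrame g π) {x : M}
    (hx : x ∈ F.param.target) : IsMetricConnectionAt g π x fun α β => F.conn α β x := by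
  obtain ⟨w, hw, rfl⟩ : ∃ w ∈ F.param.source, F.param.toFun w = x :=
    ⟨_, LocalParam.inv_mem hx, LocalParam.apply_inv hx⟩
  have hp : ∀ α β, pullCov F.param.toFun (F.conn α β) w =
      frameConn F.left F.right (pullCov F.param.toFun α w) (pullCov F.param.toFun β) w :=
    fun α β => pullCov_pushCov hw _
  constructor
  · intro α β hα hβ
    refine pullCov_injective (α := F.conn α β - F.conn β α) hw ?_
    rw [pullCov_sub, hp, hp, pullCov_koszul F hw hα hβ]
  · intro α β γ hα hβ hγ
    have h1 := eval_dFun_inner F hw (α := α) hβ hγ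
    rw [← hp, ← hp, ← inner_apply_param g hw, ← inner_apply_param g hw] at h1
    exact h1

theorem IsMetricContravariantConnection.isMetricConnectionAt
    (hD : IsMetricContravariantConnection g π D) (x : M) :
    IsMetricConnectionAt g π x fun α β => D α β x where
  torsionFree α β hα hβ := congrFun (sub_eq_zero.1 (hD.torsionFree α β hα hβ)) x
  metric α β γ hα hβ hγ := congrFun (hD.metric α β γ hα hβ hγ) x

theorem IsMetricContravariantConnection.isFrameConnection
    (hD : IsMetricContravariantConnection g π D) : IsFrameConnection g π D :=
  fun F w hw α β hα hβ => by
    have hx := LocalParam.apply_mem hw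
    have h := (hD.isMetricConnectionAt (F.param.toFun w)).unique (F.isMetricConnectionAt hx) hα hβ
    rw [← pullCov_pushCov (ψ := F.param) hw fun y =>
      frameConn F.left F.right (pullCov F.param.toFun α y) (pullCov F.param.toFun β) y]
    exact congrArg (fun a : E →L[ℝ] ℝ => a ∘L F.param.deriv w) h

/-- A frame is chosen separately at each point; uniqueness makes the value independent of the
choice, so no partition of unity is needed. -/
theorem exists_isFrameConnection (hF : HasAdaptedFrames g π) :
    ∃ D, IsFrameConnection g π D := by
  choose 𝓕 h𝓕 using hF
  refine ⟨fun α β x => (𝓕 x).conn α β x, fun F w hw α β hα hβ => ?_⟩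
  have hx := LocalParam.apply_mem hw
  have h := ((𝓕 (F.param.toFun w)).isMetricConnectionAt (h𝓕 _)).unique
    (F.isMetricConnectionAt hx) hα hβ
  rw [← pullCov_pushCov (ψ := F.param) hw fun y =>
    frameConn F.left F.right (pullCov F.param.toFun α y) (pullCov F.param.toFun β) y]
  exact congrArg (fun a : E →L[ℝ] ℝ => a ∘L F.param.deriv w) h

/-- The local characterization of the connection on `2`-forms. -/
theorem frameConnForm_unique (hD : IsFrameConnection g π D) (F : AdaptedFrame g π) {w : E}
    (hw : w ∈ F.param.source) {α : CovectorField E M} (hα : α.Smooth)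
    {T : FormField E M 2 → E [⋀^Fin 2]→L[ℝ] ℝ}
    (hadd : ∀ σ τ : FormField E M 2, σ.Smooth → τ.Smooth → T (σ + τ) = T σ + T τ)
    (hsmul : ∀ (f : M → ℝ) (σ : FormField E M 2), SmoothFun E f → σ.Smooth →
      T (σ.fsmul f) = f (F.param.toFun w) • T σ +
        π.eval α (dFun E f) (F.param.toFun w) • pullForm F.param.toFun σ w)
    (hwedge : ∀ β γ : CovectorField E M, β.Smooth → γ.Smooth → T (β.wedge γ) =
      pullForm F.param.toFun ((D α β).wedge γ + β.wedge (D α γ)) w)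
    {σ : FormField E M 2} (hσ : σ.Smooth) : T σ =
      frameConnForm F.left F.right (pullCov F.param.toFun α w) (pullForm F.param.toFun σ) w := by
  refine FormField.operator_unique (F.param.toFun w)
    (fun f σ => π.eval α (dFun E f) (F.param.toFun w) • pullForm F.param.toFun σ w)
    (T' := fun σ => frameConnForm F.left F.right (pullCov F.param.toFun α w)
      (pullForm F.param.toFun σ) w)
    hadd (fun σ τ hσ hτ => ?_) hsmul (fun f σ hf hσ => ?_) (fun β γ hβ hγ => ?_) hσ
  · rw [pullForm_fun_add]
    exact frameConnForm_add _ (hσ.pull hw).diff (hτ.pull hw).diff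
  · rw [eval_dFun_param F hw hf, pullForm_fun_fsmul]
    exact frameConnForm_leibniz _ (hf.pull hw).diff (hσ.pull hw).diff
  · rw [hwedge β γ hβ hγ, pullForm_add, pullForm_wedge, pullForm_wedge, pullForm_wedge]
    beta_reduce
    rw [hD F w hw _ _ hα hβ, hD F w hw _ _ hα hγ]
    exact (frameConnForm_covWedge _ (hβ.pull hw) (hγ.pull hw)).symm

/-- The local characterization of the bracket of `1`-forms. -/
theorem frameBracket_unique (hF : HasAdaptedFrames g π) (hD : IsFrameConnection g π D)
    (F : AdaptedFrame g π) {w : E}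
    (hw : w ∈ F.param.source) {β : CovectorField E M} (hβ : β.Smooth)
    {T : CovectorField E M → E [⋀^Fin 2]→L[ℝ] ℝ}
    (hadd : ∀ α α' : CovectorField E M, α.Smooth → α'.Smooth → T (α + α') = T α + T α')
    (hsmul : ∀ (f : M → ℝ) (α : CovectorField E M), SmoothFun E f → α.Smooth →
      T (α.fsmul f) = f (F.param.toFun w) • T α +
        pullForm F.param.toFun (α.wedge (D (dFun E f) β)) w)
    (hd : ∀ f : M → ℝ, SmoothFun E f → T (dFun E f) =
      pullForm F.param.toFun (D (dFun E f) β).d w -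
        frameConnForm F.left F.right (pullCov F.param.toFun (dFun E f) w)
          (pullForm F.param.toFun β.d) w)
    {α : CovectorField E M} (hα : α.Smooth) : T α =
      frameBracket F.left F.right (pullCov F.param.toFun α) (pullCov F.param.toFun β) w := by
  refine CovectorField.operator_unique (F.param.toFun w)
    (fun f α => pullForm F.param.toFun (α.wedge (D (dFun E f) β)) w)
    (T' := fun α => frameBracket F.left F.right (pullCov F.param.toFun α)
      (pullCov F.param.toFun β) w)
    hadd (fun α α' hα hα' => ?_) hsmul (fun f α hf hα => ?_) (fun f hf => ?_) hα
  · rw [pullCov_fun_add]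
    exact frameBracket_add_left (hα.pull hw).diff (hα'.pull hw).diff _
  · rw [pullForm_wedge, pullCov_fun_fsmul]
    beta_reduce
    rw [hD F w hw _ _ hf.dFun hβ, pullCov_dFun hw (hf.pull hw)]
    exact frameBracket_product (hf.pull hw).diff (hα.pull hw).diff _
  · rw [hd f hf, hD.pullForm_d hF F hw hf hβ, add_sub_cancel_right]

theorem pullForm_congr_point {k : ℕ} {ψ : E → M} {η σ : FormField E M k} {w : E}
    (h : η (ψ w) = σ (ψ w)) : pullForm ψ η w = pullForm ψ σ w :=
  congrArg (fun τ : E [⋀^Fin k]→L[ℝ] ℝ => τ.compContinuousLinearMap (modelDeriv E E ψ w)) h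

/-- An equality of forms at a point may be checked in any parametrization through it. This moves
between a given frame and the one chosen at the point. -/
theorem pullForm_congr_param {k : ℕ} {ψ φ : LocalParam E M} {η σ : FormField E M k} {w w' : E}
    (hw' : w' ∈ φ.source) (hww' : φ.toFun w' = ψ.toFun w)
    (h : pullForm φ.toFun η w' = pullForm φ.toFun σ w') :
    pullForm ψ.toFun η w = pullForm ψ.toFun σ w := by
  have h1 := pullForm_injective hw' h
  rw [hww'] at h1
  exact pullForm_congr_point h1

theorem exists_isFrameConnectionForm (hF : HasAdaptedFrames g π) (hD : IsFrameConnection g π D) :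
    ∃ D₂, IsFrameConnectionForm g π D₂ := by
  choose 𝓕 h𝓕 using hF
  refine ⟨fun α σ x => (𝓕 x).connForm α σ x, fun F w hw α σ hα hσ => ?_⟩
  obtain ⟨w', hw', hww'⟩ : ∃ w' ∈ (𝓕 (F.param.toFun w)).param.source,
      (𝓕 (F.param.toFun w)).param.toFun w' = F.param.toFun w :=
    ⟨_, LocalParam.inv_mem (h𝓕 _), LocalParam.apply_inv (h𝓕 _)⟩
  set F' := 𝓕 (F.param.toFun w)
  have hp : ∀ σ, pullForm F'.param.toFun (F'.connForm α σ) w' = frameConnForm F'.left F'.right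
      (pullCov F'.param.toFun α w') (pullForm F'.param.toFun σ) w' :=
    fun σ => pullForm_pushForm hw' _
  refine frameConnForm_unique hD F hw hα
    -- The expression in the chosen frame `F'` is read in `F`. It satisfies the axioms that
    -- determine the operator at this point, hence equals the expression in `F`.
    (T := fun σ => pullForm F.param.toFun (F'.connForm α σ) w) (fun σ τ hσ hτ => ?_)
    (fun f σ hf hσ => ?_) (fun β γ hβ hγ => ?_) hσ
  · rw [← pullForm_add]
    refine pullForm_congr_param hw' hww' ?_
    rw [pullForm_add, hp, hp, hp, pullForm_fun_add]
    exact frameConnForm_add _ (hσ.pull hw').diff (hτ.pull hw').diff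
  · rw [← pullForm_fsmul, ← pullForm_fsmul, ← pullForm_add]
    refine pullForm_congr_param hw' hww' ?_
    rw [pullForm_add, pullForm_fsmul, pullForm_fsmul, hp, hp, eval_dFun_param F' hw' hf,
      pullForm_fun_fsmul]
    exact frameConnForm_leibniz _ (hf.pull hw').diff (hσ.pull hw').diff
  · refine pullForm_congr_param hw' hww' ?_
    rw [hp, pullForm_add, pullForm_wedge, pullForm_wedge, pullForm_wedge]
    beta_reduce
    rw [hD F' w' hw' _ _ hα hβ, hD F' w' hw' _ _ hα hγ]
    exact frameConnForm_covWedge _ (hβ.pull hw') (hγ.pull hw')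

theorem exists_isFrameBracket (hF : HasAdaptedFrames g π) (hD : IsFrameConnection g π D)
    (hD₂ : IsFrameConnectionForm g π D₂) : ∃ B, IsFrameBracket g π B := by
  have hF' := hF
  choose 𝓕 h𝓕 using hF'
  refine ⟨fun α β x => (𝓕 x).bracket α β x, fun F w hw α β hα hβ => ?_⟩
  obtain ⟨w', hw', hww'⟩ : ∃ w' ∈ (𝓕 (F.param.toFun w)).param.source,
      (𝓕 (F.param.toFun w)).param.toFun w' = F.param.toFun w :=
    ⟨_, LocalParam.inv_mem (h𝓕 _), LocalParam.apply_inv (h𝓕 _)⟩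
  set F' := 𝓕 (F.param.toFun w)
  have hp : ∀ α, pullForm F'.param.toFun (F'.bracket α β) w' = frameBracket F'.left F'.right
      (pullCov F'.param.toFun α) (pullCov F'.param.toFun β) w' :=
    fun α => pullForm_pushForm hw' _
  refine frameBracket_unique hF hD F hw hβ
    (T := fun α => pullForm F.param.toFun (F'.bracket α β) w) (fun α α' hα hα' => ?_)
    (fun f α hf hα => ?_) (fun f hf => ?_) hα
  · rw [← pullForm_add]
    refine pullForm_congr_param hw' hww' ?_
    rw [pullForm_add, hp, hp, hp, pullCov_fun_add]
    exact frameBracket_add_left (hα.pull hw').diff (hα'.pull hw').diff _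
  · rw [← pullForm_fsmul, ← pullForm_add]
    refine pullForm_congr_param hw' hww' ?_
    rw [pullForm_add, pullForm_fsmul, hp, hp, pullForm_wedge, pullCov_fun_fsmul]
    beta_reduce
    rw [hD F' w' hw' _ _ hf.dFun hβ, pullCov_dFun hw' (hf.pull hw')]
    exact frameBracket_product (hf.pull hw').diff (hα.pull hw').diff _
  · rw [← hD₂ F w hw _ _ hf.dFun hβ.d, ← pullForm_sub]
    refine pullForm_congr_param hw' hww' ?_
    rw [hp, pullForm_sub, hD₂ F' w' hw' _ _ hf.dFun hβ.d, hD.pullForm_d hF F' hw' hf hβ,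
      add_sub_cancel_right]

theorem IsGeneralizedBracket.isFrameConnectionForm (hD : IsFrameConnection g π D)
    (hB : IsGeneralizedBracket π D D₂ B) : IsFrameConnectionForm g π D₂ :=
  fun F w hw α σ hα hσ => frameConnForm_unique hD F hw hα
    (T := fun σ => pullForm F.param.toFun (D₂ α σ) w)
    (fun σ τ hσ hτ => by rw [hB.ext_add α σ τ hα hσ hτ, pullForm_add])
    (fun f σ hf hσ => by
      rw [hB.ext_leibniz f α σ hf hα hσ, pullForm_add, pullForm_fsmul, pullForm_fsmul])
    (fun β γ hβ hγ => by rw [hB.ext_wedge α β γ hα hβ hγ]) hσ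

theorem IsGeneralizedBracket.isFrameBracket (hF : HasAdaptedFrames g π)
    (hD : IsFrameConnection g π D) (hB : IsGeneralizedBracket π D D₂ B) : IsFrameBracket g π B :=
  fun F w hw α β hα hβ => frameBracket_unique hF hD F hw hβ
    (T := fun α => pullForm F.param.toFun (B α β) w)
    (fun α α' hα hα' => by rw [hB.add_left α α' β hα hα' hβ, pullForm_add])
    (fun f α hf hα => by rw [hB.product f α β hf hα hβ, pullForm_add, pullForm_fsmul])
    (fun f hf => by
      rw [hB.leibniz f β hf hβ, pullForm_add,
        hB.isFrameConnectionForm hD F w hw _ _ hf.dFun hβ.d, add_sub_cancel_right]) hα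

/-- A bivector field which is locally a sum of products of commuting Killing fields is compatible
with the metric. -/
theorem isCompatible_of_adaptedFrames (hF : HasAdaptedFrames g π) : IsCompatible g π where
  exists_connection := by
    obtain ⟨D, hD⟩ := exists_isFrameConnection hF
    exact ⟨D, hD.isMetric hF⟩
  flat D hD := hD.isFrameConnection.isFlat hF
  metacurvature D hD := by
    have hD' := hD.isFrameConnection
    obtain ⟨D₂, hD₂⟩ := exists_isFrameConnectionForm hF hD'
    obtain ⟨B, hB⟩ := exists_isFrameBracket hF hD' hD₂
    exact ⟨⟨D₂, B, isGeneralizedBracket_of_frames hF hD' hD₂ hB⟩, fun D₂ B hB f β γ hf hβ hγ =>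
      metacurvature_of_frames hF hD' (hB.isFrameConnectionForm hD') (hB.isFrameBracket hF hD')
        hf hβ hγ⟩
  volume _ hk _ hU _ hε _ hx := contract_closed_of_adaptedFrames hF hk hU hε hx

end Compatibility
end

noncomputable section

/-! ### Invariant bivectors -/

section InvariantBivector

variable {V : Type*} [NormedAddCommGroup V] [NormedSpace ℝ V]

theorem bivector_exists_sum (Q : ⋀[ℝ]^2 V) :
    ∃ (m : ℕ) (u v : Fin m → V), Q = ∑ r, exteriorPower.ιMulti ℝ 2 ![u r, v r] := by
  have h : Q ∈ Submodule.span ℝ (Set.range (exteriorPower.ιMulti ℝ 2 (M := V))) := by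
    rw [exteriorPower.ιMulti_span]; trivial
  obtain ⟨m, c, x, hx⟩ := Submodule.mem_span_set'.1 h
  choose y hy using fun r => (x r).2
  -- Decomposable bivectors span, and the coefficient is absorbed in the first factor.
  refine ⟨m, fun r => c r • y r 0, fun r => y r 1, ?_⟩
  rw [← hx]
  refine Finset.sum_congr rfl fun r _ => ?_
  rw [← hy r]
  have h1 : y r = ![y r 0, y r 1] := by funext i; fin_cases i <;> rfl
  have h2 : ![c r • y r 0, y r 1] = Function.update (y r) 0 (c r • y r 0) := by
    funext i; fin_cases i <;> rfl
  rw [h2, AlternatingMap.map_update_smul, Function.update_eq_self]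

theorem bivectorEval_map (L : V →L[ℝ] V) (Q : ⋀[ℝ]^2 V) (a b : V →L[ℝ] ℝ) :
    bivectorEval (exteriorPower.map 2 L.toLinearMap Q) a b = bivectorEval Q (a ∘L L) (b ∘L L) := by
  obtain ⟨m, u, v, rfl⟩ := bivector_exists_sum Q
  simp only [bivectorEval, map_sum, exteriorPower.map_apply_ιMulti,
    exteriorPower.alternatingMapLinearEquiv_apply_ιMulti]
  rfl

theorem bivectorEval_antisymm (Q : ⋀[ℝ]^2 V) (a b : V →L[ℝ] ℝ) :
    bivectorEval Q a b = -bivectorEval Q b a := by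
  obtain ⟨m, u, v, rfl⟩ := bivector_exists_sum Q
  simp only [bivectorEval, map_sum, exteriorPower.alternatingMapLinearEquiv_apply_ιMulti,
    ← Finset.sum_neg_distrib]
  refine Finset.sum_congr rfl fun r _ => ?_
  change a (u r) * b (v r) - a (v r) * b (u r) = -(b (u r) * a (v r) - b (v r) * a (u r))
  ring

theorem apply_bivectorSharp (Q : ⋀[ℝ]^2 V) (a b : V →L[ℝ] ℝ) :
    b (bivectorSharp Q a) = bivectorEval Q a b := by
  obtain ⟨m, u, v, rfl⟩ := bivector_exists_sum Q
  simp only [bivectorEval, bivectorSharp, map_sum,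
    exteriorPower.alternatingMapLinearEquiv_apply_ιMulti, bivectorLift_ιMulti]
  refine Finset.sum_congr rfl fun r _ => ?_
  change b (a (u r) • v r - a (v r) • u r) = a (u r) * b (v r) - a (v r) * b (u r)
  rw [map_sub, map_smul, map_smul, smul_eq_mul, smul_eq_mul]

theorem bivectorSharp_sum {m : ℕ} (u v : Fin m → V) (a : V →L[ℝ] ℝ) :
    bivectorSharp (∑ r, exteriorPower.ιMulti ℝ 2 ![u r, v r]) a =
      ∑ r, (a (u r) • v r - a (v r) • u r) := by
  simp only [bivectorSharp, map_sum, bivectorLift_ιMulti]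
  rfl

/-- The vectors associated to the covectors by a bivector. -/
def bivectorRange (Q : ⋀[ℝ]^2 V) : Submodule ℝ V where
  carrier := Set.range (bivectorSharp Q)
  add_mem' := by
    rintro _ _ ⟨a, rfl⟩ ⟨b, rfl⟩
    refine ⟨a + b, ?_⟩
    obtain ⟨m, u, v, rfl⟩ := bivector_exists_sum Q
    simp only [bivectorSharp_sum, ← Finset.sum_add_distrib, add_apply, add_smul]
    exact Finset.sum_congr rfl fun r _ => by abel
  zero_mem' := by
    refine ⟨0, ?_⟩
    obtain ⟨m, u, v, rfl⟩ := bivector_exists_sum Q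
    simp [bivectorSharp_sum]
  smul_mem' := by
    rintro c _ ⟨a, rfl⟩
    refine ⟨c • a, ?_⟩
    obtain ⟨m, u, v, rfl⟩ := bivector_exists_sum Q
    simp only [bivectorSharp_sum, Finset.smul_sum, smul_apply, smul_sub, smul_smul, smul_eq_mul]

variable [FiniteDimensional ℝ V]

theorem covectors_separate {x y : V} (h : ∀ b : V →L[ℝ] ℝ, b x = b y) : x = y :=
  (SeparatingDual.eq_iff_forall_dual_eq (R := ℝ)).2 h

/-- `Q = ½ ∑ eᵢ ∧ Q♯(eⁱ)`. -/
theorem bivector_eq_zero {Q : ⋀[ℝ]^2 V} (h : ∀ a, bivectorSharp Q a = 0) : Q = 0 := by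
  let e := Module.finBasis ℝ V
  let l : Fin (Module.finrank ℝ V) → V →L[ℝ] ℝ := fun i =>
    LinearMap.toContinuousLinearMap (e.coord i)
  obtain ⟨m, u, v, hQ⟩ := bivector_exists_sum Q
  have hu0 : ∀ x y z : V, Function.update ![x, y] 0 z = ![z, y] := fun x y z => by
    funext i; fin_cases i <;> rfl
  have hu1 : ∀ x y z : V, Function.update ![x, y] 1 z = ![x, z] := fun x y z => by
    funext i; fin_cases i <;> rfl
  let W : V →ₗ[ℝ] V →ₗ[ℝ] ⋀[ℝ]^2 V := LinearMap.mk₂ ℝ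
    (fun x y => exteriorPower.ιMulti ℝ 2 ![x, y])
    (fun x x' y => by
      have := (exteriorPower.ιMulti ℝ 2 (M := V)).map_update_add ![x, y] 0 x x'
      simpa only [hu0, hu1] using this)
    (fun c x y => by
      have := (exteriorPower.ιMulti ℝ 2 (M := V)).map_update_smul ![x, y] 0 c x
      simpa only [hu0, hu1] using this)
    (fun x y y' => by
      have := (exteriorPower.ιMulti ℝ 2 (M := V)).map_update_add ![x, y] 1 y y'
      simpa only [hu0, hu1] using this)
    (fun c x y => by
      have := (exteriorPower.ιMulti ℝ 2 (M := V)).map_update_smul ![x, y] 1 c y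
      simpa only [hu0, hu1] using this)
  have hW : ∀ x y, W x y = -W y x := by
    intro x y
    have h := (exteriorPower.ιMulti ℝ 2 (M := V)).map_swap ![y, x] (i := 0) (j := 1) (by simp)
    have h2 : ![y, x] ∘ Equiv.swap (0 : Fin 2) 1 = ![x, y] := by
      funext j; fin_cases j <;> rfl
    rw [h2] at h
    exact h
  have hsum : ∀ x, ∑ i, l i x • e i = x := fun x => e.sum_repr x
  have h1 : ∑ i, W (e i) (bivectorSharp Q (l i)) = Q + Q := by
    rw [hQ]
    simp only [bivectorSharp_sum, map_sum, map_sub, map_smul]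
    rw [Finset.sum_comm, ← Finset.sum_add_distrib]
    refine Finset.sum_congr rfl fun r _ => ?_
    have h2 : ∀ x y, ∑ i, l i x • W (e i) y = W x y := fun x y => by
      conv_rhs => rw [← hsum x, map_sum, LinearMap.sum_apply]
      simp only [map_smul, LinearMap.smul_apply]
    rw [Finset.sum_sub_distrib, h2, h2, hW (v r) (u r), sub_neg_eq_add]
    rfl
  simp only [h, map_zero, Finset.sum_const_zero] at h1
  have h3 : (2 : ℝ) • Q = 0 := by rw [two_smul, ← h1]
  simpa using h3

theorem bivector_ext {Q R : ⋀[ℝ]^2 V} (h : ∀ a b, bivectorEval Q a b = bivectorEval R a b) :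
    Q = R := by
  rw [← sub_eq_zero]
  refine bivector_eq_zero fun a => covectors_separate fun b => ?_
  rw [apply_bivectorSharp, map_zero, bivectorEval, map_sub, sub_eq_zero]
  exact h a b

/-- A bivector is a sum of products of elements of its range. -/
theorem bivector_exists_sum_range (Q : ⋀[ℝ]^2 V) :
    ∃ (m : ℕ) (u v : Fin m → V), Q = ∑ r, exteriorPower.ιMulti ℝ 2 ![u r, v r] ∧
      (∀ r, u r ∈ bivectorRange Q) ∧ ∀ r, v r ∈ bivectorRange Q := by
  -- A linear projection `P` onto the range fixes every `Q♯a`, and therefore fixes `Q`; applied to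
  -- any decomposition of `Q` it moves all factors into the range.
  obtain ⟨p, hp⟩ := (bivectorRange Q).subtype.exists_leftInverse_of_injective
    (bivectorRange Q).ker_subtype
  let P : V →L[ℝ] V := LinearMap.toContinuousLinearMap ((bivectorRange Q).subtype ∘ₗ p)
  have hP : ∀ a, P (bivectorSharp Q a) = bivectorSharp Q a := fun a =>
    congrArg Subtype.val (LinearMap.congr_fun hp ⟨bivectorSharp Q a, a, rfl⟩)
  have hQ : exteriorPower.map 2 P.toLinearMap Q = Q := by
    refine bivector_ext fun a b => ?_
    rw [bivectorEval_map, ← apply_bivectorSharp, ContinuousLinearMap.comp_apply, hP,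
      apply_bivectorSharp, bivectorEval_antisymm, ← apply_bivectorSharp,
      ContinuousLinearMap.comp_apply, hP, apply_bivectorSharp, ← bivectorEval_antisymm]
  obtain ⟨m, u, v, h⟩ := bivector_exists_sum Q
  refine ⟨m, fun r => P (u r), fun r => P (v r), ?_, fun r => (p (u r)).2, fun r => (p (v r)).2⟩
  conv_lhs => rw [← hQ, h]
  simp only [map_sum, exteriorPower.map_apply_ιMulti]
  refine Finset.sum_congr rfl fun r _ => congrArg _ ?_
  funext i
  fin_cases i <;> rfl

/-- A bivector which is invariant under a family of linear maps has a range on which the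
derivative of the family vanishes, if this derivative is antisymmetric. -/
theorem invariant_bivector_range_abelian {A : V → V →L[ℝ] V} {s₀ : V}
    (hA : DifferentiableAt ℝ A s₀) (h0 : A s₀ = ContinuousLinearMap.id ℝ V) {Q : ⋀[ℝ]^2 V}
    (hinv : ∀ᶠ s in 𝓝 s₀, exteriorPower.map 2 (A s).toLinearMap Q = Q)
    (hanti : ∀ S T, fderiv ℝ A s₀ S T = -fderiv ℝ A s₀ T S) {X Y : V}
    (hX : X ∈ bivectorRange Q) (hY : Y ∈ bivectorRange Q) : fderiv ℝ A s₀ X Y = 0 := by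
  set ad := fderiv ℝ A s₀ with had
  -- The function `s ↦ Q(a ∘ A s, b ∘ A s)` is locally constant. Its derivative at `s₀` is `Q(a ∘ ad
  -- S, b) + Q(a, b ∘ ad S)`, which is the difference of the two sides.
  have hsymm : ∀ (S : V) (a b : V →L[ℝ] ℝ), b (ad S (bivectorSharp Q a)) = a (ad S (bivectorSharp Q b)) := by
    intro S a b
    obtain ⟨m, u, v, hQ⟩ := bivector_exists_sum Q
    have hd : ∀ (a : V →L[ℝ] ℝ) (T : V), HasFDerivAt (fun s => a (A s T))
        (a ∘L (ContinuousLinearMap.apply ℝ V T) ∘L ad) s₀ := fun a T =>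
      a.hasFDerivAt.comp s₀ ((ContinuousLinearMap.apply ℝ V T).hasFDerivAt.comp s₀ hA.hasFDerivAt)
    have hev : (fun s => ∑ r, (a (A s (u r)) * b (A s (v r)) - a (A s (v r)) * b (A s (u r))))
        =ᶠ[𝓝 s₀] fun _ => bivectorEval Q a b := by
      filter_upwards [hinv] with s hs
      rw [← hs, bivectorEval_map, hQ]
      simp only [bivectorEval, map_sum, exteriorPower.alternatingMapLinearEquiv_apply_ιMulti]
      rfl
    have h1 := HasFDerivAt.fun_sum fun r (_ : r ∈ Finset.univ) =>
      ((hd a (u r)).mul (hd b (v r))).sub ((hd a (v r)).mul (hd b (u r)))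
    have h2 := DFunLike.congr_fun (h1.unique ((hasFDerivAt_const _ _).congr_of_eventuallyEq hev)) S
    rw [hQ]
    simp only [bivectorSharp_sum, map_sum, map_sub, map_smul, smul_eq_mul]
    simp only [h0, sum_apply, sub_apply, add_apply, smul_apply, ContinuousLinearMap.comp_apply,
      ContinuousLinearMap.apply_apply, smul_eq_mul, zero_apply, ContinuousLinearMap.id_apply] at h2
    rw [← sub_eq_zero, ← Finset.sum_sub_distrib, ← h2]
    exact Finset.sum_congr rfl fun r _ => by ring
  -- Symmetry in `a`, `b` and antisymmetry in `c`, `a`, applied alternately, change the sign of the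
  -- form while restoring the order of its arguments.
  have hT : ∀ a b c : V →L[ℝ] ℝ, b (ad (bivectorSharp Q c) (bivectorSharp Q a)) = 0 := by
    intro a b c
    let t := fun c a b : V →L[ℝ] ℝ => b (ad (bivectorSharp Q c) (bivectorSharp Q a))
    have h23 : ∀ c a b, t c a b = t c b a := fun c a b => hsymm _ a b
    have h12 : ∀ c a b, t c a b = -t a c b := fun c a b => by
      simp only [t]
      rw [hanti, map_neg]
    have e1 := h23 c a b
    have e2 := h12 c b a
    have e3 := h23 b c a
    have e4 := h12 b a c
    have e5 := h23 a b c
    have e6 := h12 a c b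
    change t c a b = 0
    linarith
  obtain ⟨c, rfl⟩ := hX
  obtain ⟨a, rfl⟩ := hY
  exact covectors_separate fun b => by rw [hT, map_zero]

end InvariantBivector
end

noncomputable section

/-! ### Fundamental vector fields in parametrizations -/

section ActionChart

variable {E : Type*} [NormedAddCommGroup E] [NormedSpace ℝ E]
  {F : Type*} [NormedAddCommGroup F] [NormedSpace ℝ F]
  {G : Type*} [TopologicalSpace G] [ChartedSpace F G] [Group G] [LieGroup 𝓘(ℝ, F) ∞ G]
  {N : Type*} [TopologicalSpace N] [ChartedSpace E N]
  [MulAction G N] [ContMDiffSMul 𝓘(ℝ, F) 𝓘(ℝ, E) ∞ G N]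
  {θ : LocalParam F G} {ψ : LocalParam E N} {s : F} {y : E}

/-- The action in parametrizations. -/
def actionChart (θ : LocalParam F G) (ψ : LocalParam E N) (q : F × E) : E :=
  ψ.invFun (θ.toFun q.1 • ψ.toFun q.2)

/-- The conjugation in a parametrization. -/
def conjChart (θ : LocalParam F G) (q : F × F) : F :=
  θ.invFun (θ.toFun q.1 * θ.toFun q.2 * (θ.toFun q.1)⁻¹)

/-- The adjoint action in a parametrization. -/
def adjointChart (θ : LocalParam F G) (s : F) : F →L[ℝ] F :=
  fderiv ℝ (conjChart θ) (s, θ.invFun 1) ∘L ContinuousLinearMap.inr ℝ F F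

/-- The fundamental vector fields of the action in parametrizations. -/
def fundamentalChart (θ : LocalParam F G) (ψ : LocalParam E N) (T : F) (y : E) : E :=
  fderiv ℝ (actionChart θ ψ) (θ.invFun 1, y) (T, 0)

theorem LocalParam.contMDiffAt_toFun {ψ : LocalParam E N} (hy : y ∈ ψ.source) :
    ContMDiffAt 𝓘(ℝ, E) 𝓘(ℝ, E) ∞ ψ.toFun y :=
  ψ.contMDiffOn_toFun.contMDiffAt (ψ.open_source.mem_nhds hy)

theorem LocalParam.contMDiffAt_invFun {ψ : LocalParam E N} {x : N} (hx : x ∈ ψ.target) :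
    ContMDiffAt 𝓘(ℝ, E) 𝓘(ℝ, E) ∞ ψ.invFun x :=
  ψ.contMDiffOn_invFun.contMDiffAt (ψ.open_target.mem_nhds hx)

theorem contMDiffAt_fst_param {W : Type*} [NormedAddCommGroup W] [NormedSpace ℝ W] {q : F × W}
    (hs : q.1 ∈ θ.source) :
    ContMDiffAt 𝓘(ℝ, F × W) 𝓘(ℝ, F) ∞ (fun q : F × W => θ.toFun q.1) q :=
  ContMDiffAt.comp q (LocalParam.contMDiffAt_toFun hs) contDiff_fst.contMDiff.contMDiffAt

theorem contMDiffAt_snd_param {W : Type*} [NormedAddCommGroup W] [NormedSpace ℝ W] {q : W × E}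
    (hy : q.2 ∈ ψ.source) :
    ContMDiffAt 𝓘(ℝ, W × E) 𝓘(ℝ, E) ∞ (fun q : W × E => ψ.toFun q.2) q :=
  ContMDiffAt.comp q (LocalParam.contMDiffAt_toFun hy) contDiff_snd.contMDiff.contMDiffAt

theorem contMDiffAt_action_param (hs : s ∈ θ.source) (hy : y ∈ ψ.source) :
    ContMDiffAt 𝓘(ℝ, F × E) 𝓘(ℝ, E) ∞ (fun q : F × E => θ.toFun q.1 • ψ.toFun q.2) (s, y) :=
  ContMDiffAt.comp (s, y) (contMDiff_smul (I := 𝓘(ℝ, F)) (I' := 𝓘(ℝ, E)) (n := ∞) (G := G)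
    (M := N)).contMDiffAt ((contMDiffAt_fst_param hs).prodMk (contMDiffAt_snd_param hy))

theorem actionChart_contDiffAt (hs : s ∈ θ.source) (hy : y ∈ ψ.source)
    (h : θ.toFun s • ψ.toFun y ∈ ψ.target) : ContDiffAt ℝ ∞ (actionChart θ ψ) (s, y) := by
  rw [← contMDiffAt_iff_contDiffAt]
  exact ContMDiffAt.comp (s, y) (LocalParam.contMDiffAt_invFun h) (contMDiffAt_action_param hs hy)

theorem contMDiffAt_conj_param (hs : s ∈ θ.source) {t : F} (ht : t ∈ θ.source) :
    ContMDiffAt 𝓘(ℝ, F × F) 𝓘(ℝ, F) ∞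
      (fun q : F × F => θ.toFun q.1 * θ.toFun q.2 * (θ.toFun q.1)⁻¹) (s, t) :=
  ((contMDiffAt_fst_param (q := (s, t)) hs).mul (contMDiffAt_snd_param (q := (s, t)) ht)).mul
    (contMDiffAt_fst_param (q := (s, t)) hs).inv

theorem conjChart_contDiffAt (hs : s ∈ θ.source) {t : F} (ht : t ∈ θ.source)
    (h : θ.toFun s * θ.toFun t * (θ.toFun s)⁻¹ ∈ θ.target) :
    ContDiffAt ℝ ∞ (conjChart θ) (s, t) := by
  rw [← contMDiffAt_iff_contDiffAt]
  exact ContMDiffAt.comp (s, t) (LocalParam.contMDiffAt_invFun h) (contMDiffAt_conj_param hs ht)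

theorem apply_inv_one (h1 : (1 : G) ∈ θ.target) : θ.toFun (θ.invFun 1) = 1 :=
  LocalParam.apply_inv h1

theorem conj_one_mem (h1 : (1 : G) ∈ θ.target) (s : F) :
    θ.toFun s * θ.toFun (θ.invFun 1) * (θ.toFun s)⁻¹ ∈ θ.target := by
  rw [apply_inv_one h1]; simpa using h1

theorem conjChart_one (h1 : (1 : G) ∈ θ.target) (s : F) : conjChart θ (s, θ.invFun 1) =
    θ.invFun 1 := by
  rw [conjChart, apply_inv_one h1, mul_one, mul_inv_cancel]

theorem conjChart_contDiffAt_one (h1 : (1 : G) ∈ θ.target) (hs : s ∈ θ.source) :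
    ContDiffAt ℝ ∞ (conjChart θ) (s, θ.invFun 1) :=
  conjChart_contDiffAt hs (LocalParam.inv_mem h1) (conj_one_mem h1 s)

theorem adjointChart_contDiffAt (h1 : (1 : G) ∈ θ.target) (hs : s ∈ θ.source) :
    ContDiffAt ℝ ∞ (adjointChart θ) s := by
  have h : ContDiffAt ℝ ∞ (fun s => fderiv ℝ (conjChart θ) (s, θ.invFun 1)) s :=
    ContDiffAt.comp s (conjChart_contDiffAt_one h1 hs).fderiv_infty
      (contDiffAt_id.prodMk contDiffAt_const)
  exact h.clm_comp contDiffAt_const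

theorem adjointChart_one (h1 : (1 : G) ∈ θ.target) :
    adjointChart θ (θ.invFun 1) = ContinuousLinearMap.id ℝ F := by
  have hs := LocalParam.inv_mem h1
  have h2 := (conjChart_contDiffAt_one h1 hs).diff.hasFDerivAt.comp (θ.invFun 1)
    (hasFDerivAt_prodMk_right (θ.invFun 1) (θ.invFun 1))
  have hev : (conjChart θ ∘ fun t => (θ.invFun 1, t)) =ᶠ[𝓝 (θ.invFun 1)] id := by
    filter_upwards [θ.open_source.eventually_mem hs] with t ht
    rw [Function.comp_apply, conjChart, apply_inv_one h1, one_mul, inv_one, mul_one,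
      LocalParam.inv_apply ht, id]
  exact (h2.unique ((hasFDerivAt_id _).congr_of_eventuallyEq hev) :)

theorem one_smul_mem (h1 : (1 : G) ∈ θ.target) (hy : y ∈ ψ.source) :
    θ.toFun (θ.invFun 1) • ψ.toFun y ∈ ψ.target := by
  rw [apply_inv_one h1, one_smul]; exact LocalParam.apply_mem hy

theorem actionChart_one (h1 : (1 : G) ∈ θ.target) (hy : y ∈ ψ.source) :
    actionChart θ ψ (θ.invFun 1, y) = y := by
  rw [actionChart, apply_inv_one h1, one_smul, LocalParam.inv_apply hy]

theorem actionChart_contDiffAt_one (h1 : (1 : G) ∈ θ.target) (hy : y ∈ ψ.source) :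
    ContDiffAt ℝ ∞ (actionChart θ ψ) (θ.invFun 1, y) :=
  actionChart_contDiffAt (LocalParam.inv_mem h1) hy (one_smul_mem h1 hy)

theorem eventually_action_mem (hs : s ∈ θ.source) (hy : y ∈ ψ.source)
    (h : θ.toFun s • ψ.toFun y ∈ ψ.target) :
    ∀ᶠ q in 𝓝 (s, y), q.1 ∈ θ.source ∧ q.2 ∈ ψ.source ∧
      θ.toFun q.1 • ψ.toFun q.2 ∈ ψ.target := by
  have hc := (contMDiffAt_action_param (G := G) hs hy).continuousAt.eventually
    (ψ.open_target.eventually_mem h)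
  exact (continuousAt_fst.eventually (θ.open_source.eventually_mem hs)).and
    ((continuousAt_snd.eventually (ψ.open_source.eventually_mem hy)).and hc)

theorem fundamentalChart_contDiffAt (h1 : (1 : G) ∈ θ.target) (hy : y ∈ ψ.source) (T : F) :
    ContDiffAt ℝ ∞ (fundamentalChart θ ψ T) y := by
  have h : ContDiffAt ℝ ∞ (fun y => fderiv ℝ (actionChart θ ψ) (θ.invFun 1, y)) y :=
    ContDiffAt.comp y (actionChart_contDiffAt_one h1 hy).fderiv_infty
      (contDiffAt_const.prodMk contDiffAt_id)
  exact h.clm_apply contDiffAt_const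

theorem fderiv_fundamentalChart (h1 : (1 : G) ∈ θ.target) (hy : y ∈ ψ.source) (T : F) (v : E) :
    fderiv ℝ (fundamentalChart θ ψ T) y v =
      fderiv ℝ (fderiv ℝ (actionChart θ ψ)) (θ.invFun 1, y) (0, v) (T, 0) := by
  have h2 := (actionChart_contDiffAt_one h1 hy).fderiv_infty.diff.hasFDerivAt.comp y
    (hasFDerivAt_prodMk_right (θ.invFun 1) y)
  have h3 := (ContinuousLinearMap.apply ℝ E ((T, 0) : F × E)).hasFDerivAt.comp y h2
  exact DFunLike.congr_fun h3.fderiv v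

theorem hasFDerivAt_actionChart_one (h1 : (1 : G) ∈ θ.target) (hy : y ∈ ψ.source) :
    HasFDerivAt (fun s => actionChart θ ψ (s, y))
      (fderiv ℝ (actionChart θ ψ) (θ.invFun 1, y) ∘L ContinuousLinearMap.inl ℝ F E)
      (θ.invFun 1) :=
  HasFDerivAt.comp (g := actionChart θ ψ) (f := fun s => (s, y)) (θ.invFun 1)
    (actionChart_contDiffAt_one h1 hy).diff.hasFDerivAt (hasFDerivAt_prodMk_left (θ.invFun 1) y)

/-- The derivative in the group variable of the partial derivative in the space variable. -/
theorem hasFDerivAt_fderiv_actionChart (h1 : (1 : G) ∈ θ.target) (hy : y ∈ ψ.source) (v : E) :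
    HasFDerivAt (fun s => fderiv ℝ (actionChart θ ψ) (s, y) (0, v))
      (ContinuousLinearMap.apply ℝ E ((0, v) : F × E) ∘L
        fderiv ℝ (fderiv ℝ (actionChart θ ψ)) (θ.invFun 1, y) ∘L
          ContinuousLinearMap.inl ℝ F E) (θ.invFun 1) := by
  have h2 := HasFDerivAt.comp (g := fderiv ℝ (actionChart θ ψ)) (f := fun s => (s, y)) (θ.invFun 1)
    (actionChart_contDiffAt_one h1 hy).fderiv_infty.diff.hasFDerivAt
    (hasFDerivAt_prodMk_left (θ.invFun 1) y)
  exact (ContinuousLinearMap.apply ℝ E ((0, v) : F × E)).hasFDerivAt.comp (θ.invFun 1) h2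

/-- Symmetry of the mixed derivative: varying the differential of a translation with the group
element gives the linearization of the fundamental field. -/
theorem fderiv_fderiv_actionChart (h1 : (1 : G) ∈ θ.target) (hy : y ∈ ψ.source) (S : F) (v : E) :
    fderiv ℝ (fderiv ℝ (actionChart θ ψ)) (θ.invFun 1, y) (S, 0) (0, v) =
      fderiv ℝ (fundamentalChart θ ψ S) y v := by
  rw [fderiv_fundamentalChart h1 hy,
    (actionChart_contDiffAt_one h1 hy).fderiv_fderiv_symm]

/-- The fundamental fields are equivariant. -/
theorem fderiv_actionChart_fundamentalChart (h1 : (1 : G) ∈ θ.target) (hs : s ∈ θ.source)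
    (hy : y ∈ ψ.source) (h : θ.toFun s • ψ.toFun y ∈ ψ.target) (T : F) :
    fderiv ℝ (actionChart θ ψ) (s, y) (0, fundamentalChart θ ψ T y) =
      fundamentalChart θ ψ (adjointChart θ s T) (actionChart θ ψ (s, y)) := by
  have hs₀ := LocalParam.inv_mem h1
  have hy' : actionChart θ ψ (s, y) ∈ ψ.source := LocalParam.inv_mem h
  -- This is `s • (t • y) = (s t s⁻¹) • (s • y)` in coordinates, to be differentiated in `t` at the
  -- identity.
  have hev : (fun t => actionChart θ ψ (s, actionChart θ ψ (t, y))) =ᶠ[𝓝 (θ.invFun 1)]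
      fun t => actionChart θ ψ (conjChart θ (s, t), actionChart θ ψ (s, y)) := by
    have hc : ContinuousAt (fun t : F => (t, y)) (θ.invFun 1) := by fun_prop
    have hc' : ContinuousAt (fun t : F => (s, t)) (θ.invFun 1) := by fun_prop
    have e1 := hc.eventually (eventually_action_mem (G := G) hs₀ hy (one_smul_mem h1 hy))
    have e2 := hc'.eventually ((contMDiffAt_conj_param (G := G) hs hs₀).continuousAt.eventually
      (θ.open_target.eventually_mem (conj_one_mem h1 s)))
    filter_upwards [e1, e2] with t ht ht'
    simp only [actionChart, conjChart]
    rw [LocalParam.apply_inv ht.2.2, LocalParam.apply_inv ht', LocalParam.apply_inv h,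
      smul_smul, smul_smul, inv_mul_cancel_right]
  have hL : HasFDerivAt (fun t => actionChart θ ψ (s, actionChart θ ψ (t, y))) _ (θ.invFun 1) :=
    HasFDerivAt.comp (g := actionChart θ ψ) (f := fun t => (s, actionChart θ ψ (t, y)))
      (θ.invFun 1)
      (by
        have := (actionChart_contDiffAt hs hy h).diff.hasFDerivAt
        rwa [← actionChart_one h1 hy] at this)
      ((hasFDerivAt_const s (θ.invFun 1)).prodMk (hasFDerivAt_actionChart_one h1 hy))
  have hR : HasFDerivAt (fun t => actionChart θ ψ (conjChart θ (s, t), actionChart θ ψ (s, y))) _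
      (θ.invFun 1) :=
    HasFDerivAt.comp (g := actionChart θ ψ)
      (f := fun t => (conjChart θ (s, t), actionChart θ ψ (s, y))) (θ.invFun 1)
      (by
        have := (actionChart_contDiffAt_one h1 hy').diff.hasFDerivAt
        rwa [← conjChart_one h1 s] at this)
      (((conjChart_contDiffAt_one h1 hs).diff.hasFDerivAt.comp (θ.invFun 1)
        (hasFDerivAt_prodMk_right s (θ.invFun 1))).prodMk
        (hasFDerivAt_const _ _))
  have := DFunLike.congr_fun (hL.unique (hR.congr_of_eventuallyEq hev)) T
  rw [actionChart_one h1 hy, conjChart_one h1 s] at this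
  exact this

/-- The bracket of two fundamental fields. -/
theorem fundamentalChart_bracket (h1 : (1 : G) ∈ θ.target) (hy : y ∈ ψ.source) (S T : F) :
    fderiv ℝ (fundamentalChart θ ψ S) y (fundamentalChart θ ψ T y) -
      fderiv ℝ (fundamentalChart θ ψ T) y (fundamentalChart θ ψ S y) =
      fundamentalChart θ ψ (fderiv ℝ (adjointChart θ) (θ.invFun 1) S T) y := by
  have hs₀ := LocalParam.inv_mem h1
  -- The equivariance of the fundamental fields is now differentiated in `s` at the identity; the
  -- derivative of the adjoint action appears on the right-hand side.
  have hev : (fun s => fderiv ℝ (actionChart θ ψ) (s, y) (0, fundamentalChart θ ψ T y))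
      =ᶠ[𝓝 (θ.invFun 1)] fun s => fderiv ℝ (actionChart θ ψ) (θ.invFun 1, actionChart θ ψ (s, y))
        (adjointChart θ s T, 0) := by
    have hc : ContinuousAt (fun t : F => (t, y)) (θ.invFun 1) := by fun_prop
    have e1 := hc.eventually (eventually_action_mem (G := G) hs₀ hy (one_smul_mem h1 hy))
    filter_upwards [e1] with s hs
    exact fderiv_actionChart_fundamentalChart h1 hs.1 hs.2.1 hs.2.2 T
  have hL := hasFDerivAt_fderiv_actionChart h1 hy (fundamentalChart θ ψ T y)
  have hA : HasFDerivAt (fun s => ((adjointChart θ s T, 0) : F × E))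
      ((ContinuousLinearMap.inl ℝ F E ∘L ContinuousLinearMap.apply ℝ F T) ∘L
        fderiv ℝ (adjointChart θ) (θ.invFun 1)) (θ.invFun 1) :=
    (ContinuousLinearMap.inl ℝ F E ∘L ContinuousLinearMap.apply ℝ F T).hasFDerivAt.comp
      (θ.invFun 1) (adjointChart_contDiffAt h1 hs₀).diff.hasFDerivAt
  have hB : HasFDerivAt (fun s => fderiv ℝ (actionChart θ ψ)
      (θ.invFun 1, actionChart θ ψ (s, y))) _ (θ.invFun 1) :=
    HasFDerivAt.comp (g := fderiv ℝ (actionChart θ ψ))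
      (f := fun s => (θ.invFun 1, actionChart θ ψ (s, y))) (θ.invFun 1)
      (by
        have := (actionChart_contDiffAt_one h1 hy).fderiv_infty.diff.hasFDerivAt
        rwa [← actionChart_one h1 hy] at this)
      ((hasFDerivAt_const _ _).prodMk (hasFDerivAt_actionChart_one h1 hy))
  have := DFunLike.congr_fun (hL.unique ((hB.clm_apply hA).congr_of_eventuallyEq hev)) S
  rw [actionChart_one h1 hy, adjointChart_one h1] at this
  have h2 : fderiv ℝ (fundamentalChart θ ψ S) y (fundamentalChart θ ψ T y) =
      fderiv ℝ (actionChart θ ψ) (θ.invFun 1, y)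
        (fderiv ℝ (adjointChart θ) (θ.invFun 1) S T, 0) +
      fderiv ℝ (fderiv ℝ (actionChart θ ψ)) (θ.invFun 1, y) (0, fundamentalChart θ ψ S y)
        (T, 0) := by
    rw [← fderiv_fderiv_actionChart h1 hy]
    exact this
  rw [h2, ← fderiv_fundamentalChart h1 hy, add_sub_cancel_right]
  rfl

theorem fundamentalChart_self (h1 : (1 : G) ∈ θ.target) (T : F) :
    fundamentalChart θ θ T (θ.invFun 1) = T := by
  have hs₀ := LocalParam.inv_mem h1
  have h2 := hasFDerivAt_actionChart_one (G := G) (ψ := θ) h1 hs₀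
  have hev : (fun s => actionChart θ θ (s, θ.invFun 1)) =ᶠ[𝓝 (θ.invFun 1)] id := by
    filter_upwards [θ.open_source.eventually_mem hs₀] with t ht
    rw [actionChart, apply_inv_one h1, smul_eq_mul, mul_one, LocalParam.inv_apply ht, id]
  exact DFunLike.congr_fun (h2.unique ((hasFDerivAt_id _).congr_of_eventuallyEq hev)) T

/-- The Lie bracket of a Lie group is antisymmetric. -/
theorem fderiv_adjointChart_antisymm (h1 : (1 : G) ∈ θ.target) (S T : F) :
    fderiv ℝ (adjointChart θ) (θ.invFun 1) S T = -fderiv ℝ (adjointChart θ) (θ.invFun 1) T S := by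
  -- The bracket formula is applied to left multiplication of the group on itself, where the
  -- fundamental field of `T` has value `T` at the identity. The commutator of vector fields is
  -- visibly antisymmetric.
  have h2 := fundamentalChart_bracket (G := G) (ψ := θ) h1 (LocalParam.inv_mem h1) S T
  have h3 := fundamentalChart_bracket (G := G) (ψ := θ) h1 (LocalParam.inv_mem h1) T S
  simp only [fundamentalChart_self h1] at h2 h3
  rw [← h2, ← h3, neg_sub]

theorem fundamentalChart_zero (y : E) : fundamentalChart θ ψ 0 y = 0 := by
  rw [fundamentalChart, ← Prod.zero_eq_mk, map_zero]

theorem fundamentalChart_commute (h1 : (1 : G) ∈ θ.target) (hy : y ∈ ψ.source) {S T : F}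
    (h : fderiv ℝ (adjointChart θ) (θ.invFun 1) S T = 0) :
    CommuteNear (fundamentalChart θ ψ S) (fundamentalChart θ ψ T) y := by
  filter_upwards [ψ.open_source.eventually_mem hy] with z hz
  have h2 := fundamentalChart_bracket h1 hz S T
  rw [h, fundamentalChart_zero, sub_eq_zero] at h2
  exact h2.symm

/-- The fundamental fields of an isometric action are Killing fields. -/
theorem fundamentalChart_isKillingAt {g : E → E →L[ℝ] E →L[ℝ] ℝ} (h1 : (1 : G) ∈ θ.target)
    (hy : y ∈ ψ.source) (hg : DifferentiableAt ℝ g y)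
    (hinv : ∀ᶠ s in 𝓝 (θ.invFun 1), ∀ v w, g (actionChart θ ψ (s, y))
      (fderiv ℝ (actionChart θ ψ) (s, y) (0, v)) (fderiv ℝ (actionChart θ ψ) (s, y) (0, w)) =
        g y v w) (T : F) : IsKillingAt g (fundamentalChart θ ψ T) y := by
  intro v w
  have hB : HasFDerivAt (fun s => g (actionChart θ ψ (s, y))) _ (θ.invFun 1) :=
    HasFDerivAt.comp (g := g) (f := fun s => actionChart θ ψ (s, y)) (θ.invFun 1)
      (by
        have := hg.hasFDerivAt
        rwa [← actionChart_one h1 hy] at this)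
      (hasFDerivAt_actionChart_one h1 hy)
  -- The isometry identity is differentiated in the group variable at the identity.
  have hL := (hB.clm_apply (hasFDerivAt_fderiv_actionChart h1 hy v)).clm_apply
    (hasFDerivAt_fderiv_actionChart h1 hy w)
  have h2 := DFunLike.congr_fun (hL.unique ((hasFDerivAt_const (g y v w) _).congr_of_eventuallyEq
    (hinv.mono fun s hs => hs v w))) T
  have h3 : ∀ v, fderiv ℝ (actionChart θ ψ) (θ.invFun 1, y) (0, v) = v := by
    intro v
    have h4 := HasFDerivAt.comp (g := actionChart θ ψ) (f := fun y => (θ.invFun 1, y)) y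
      (actionChart_contDiffAt_one h1 hy).diff.hasFDerivAt (hasFDerivAt_prodMk_right _ y)
    have hev : (actionChart θ ψ ∘ fun y => (θ.invFun 1, y)) =ᶠ[𝓝 y] id := by
      filter_upwards [ψ.open_source.eventually_mem hy] with z hz
      exact actionChart_one h1 hz
    exact DFunLike.congr_fun (h4.unique ((hasFDerivAt_id _).congr_of_eventuallyEq hev)) v
  rw [actionChart_one h1 hy, h3, h3] at h2
  rw [← fderiv_fderiv_actionChart h1 hy, ← fderiv_fderiv_actionChart h1 hy]
  have h5 : g y v (fderiv ℝ (fderiv ℝ (actionChart θ ψ)) (θ.invFun 1, y) (T, 0) (0, w)) +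
      (g y (fderiv ℝ (fderiv ℝ (actionChart θ ψ)) (θ.invFun 1, y) (T, 0) (0, v)) w +
        fderiv ℝ g y (fundamentalChart θ ψ T y) v w) = 0 := h2
  linarith

end ActionChart
end

noncomputable section

/-! ### Quotients by isometric actions -/

section Translation

variable (E : Type*) [NormedAddCommGroup E] [NormedSpace ℝ E]
  (F : Type*) [NormedAddCommGroup F] [NormedSpace ℝ F]
  {G : Type*} [TopologicalSpace G] [ChartedSpace F G] [Group G]
  {N : Type*} [TopologicalSpace N] [ChartedSpace E N]

theorem contMDiff_translation [MulAction G N] [h : ContMDiffSMul 𝓘(ℝ, F) 𝓘(ℝ, E) ∞ G N] (a : G) :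
    ContMDiff 𝓘(ℝ, E) 𝓘(ℝ, E) ∞ (fun x : N => a • x) :=
  h.contMDiff_smul.comp (contMDiff_const.prodMk contMDiff_id)

theorem mdifferentiableAt_translation [MulAction G N] [ContMDiffSMul 𝓘(ℝ, F) 𝓘(ℝ, E) ∞ G N]
    (a : G) (x : N) : MDifferentiableAt 𝓘(ℝ, E) 𝓘(ℝ, E) (fun x : N => a • x) x :=
  (contMDiff_translation E F a).mdifferentiable (by simp) x

end Translation

/-! ### The infinitesimal and adjoint actions, and their coordinate expressions -/

section ModelAction

variable {E : Type*} [NormedAddCommGroup E] [NormedSpace ℝ E]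
  {F : Type*} [NormedAddCommGroup F] [NormedSpace ℝ F]
  {G : Type*} [TopologicalSpace G] [ChartedSpace F G] [Group G] [LieGroup 𝓘(ℝ, F) ∞ G]
  {N : Type*} [TopologicalSpace N] [ChartedSpace E N]
  [MulAction G N] [ContMDiffSMul 𝓘(ℝ, F) 𝓘(ℝ, E) ∞ G N]
  {θ : LocalParam F G} {ψ : LocalParam E N} {s : F} {y : E}

theorem exteriorPower_map_comp {V W U : Type*} [NormedAddCommGroup V] [NormedSpace ℝ V]
    [NormedAddCommGroup W] [NormedSpace ℝ W] [NormedAddCommGroup U] [NormedSpace ℝ U]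
    (L : W →L[ℝ] U) (K : V →L[ℝ] W) (Q : ⋀[ℝ]^2 V) :
    exteriorPower.map 2 (L ∘L K).toLinearMap Q =
      exteriorPower.map 2 L.toLinearMap (exteriorPower.map 2 K.toLinearMap Q) := by
  exact LinearMap.congr_fun (exteriorPower.map_comp _ _) Q

variable (E F) in
/-- The infinitesimal action, as a map of model spaces. -/
def modelAction (G : Type*) [TopologicalSpace G] [ChartedSpace F G] [Group G] {N : Type*}
    [TopologicalSpace N] [ChartedSpace E N] [MulAction G N] (x : N) : F →L[ℝ] E :=
  modelDeriv F E (fun a : G => a • x) 1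

variable (F) in
/-- The adjoint action, as a map of model spaces. -/
def modelAd (a : G) : F →L[ℝ] F := modelDeriv F F (fun b : G => a * b * a⁻¹) 1

variable (E F) in
theorem mdifferentiableAt_orbit (x : N) (a : G) :
    MDifferentiableAt 𝓘(ℝ, F) 𝓘(ℝ, E) (fun a : G => a • x) a :=
  ((contMDiff_smul (I := 𝓘(ℝ, F)) (I' := 𝓘(ℝ, E)) (n := ∞) (G := G)
    (M := N)).comp (contMDiff_id.prodMk contMDiff_const)).mdifferentiable (by simp) a

variable (F) in
theorem mdifferentiableAt_conj (a b : G) :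
    MDifferentiableAt 𝓘(ℝ, F) 𝓘(ℝ, F) (fun b : G => a * b * a⁻¹) b :=
  ((contMDiff_const.mul contMDiff_id).mul contMDiff_const :
    ContMDiff 𝓘(ℝ, F) 𝓘(ℝ, F) ∞ fun b : G => a * b * a⁻¹).mdifferentiable (by simp) b

/-- The derivative at `b = 1` of `a • (b • x) = (a b a⁻¹) • (a • x)`. -/
theorem modelDeriv_translation_comp_modelAction (a : G) (x : N) :
    modelDeriv E E (fun x : N => a • x) x ∘L modelAction E F G x =
      modelAction E F G (a • x) ∘L modelAd F a := by
  have h1 := modelDeriv_comp (E := F) (F := E) (F' := E) (g := fun x : N => a • x)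
    (f := fun b : G => b • x) (x := 1) (mdifferentiableAt_translation E F a _)
    (mdifferentiableAt_orbit E F x 1)
  have h2 := modelDeriv_comp (E := F) (F := F) (F' := E) (g := fun b : G => b • a • x)
    (f := fun b : G => a * b * a⁻¹) (x := 1) (mdifferentiableAt_orbit E F (a • x) _)
    (mdifferentiableAt_conj F a 1)
  have h3 : (fun b : G => a • b • x) = fun b : G => (a * b * a⁻¹) • a • x := by
    funext b
    rw [smul_smul, smul_smul, inv_mul_cancel_right]
  have h4 : a * 1 * a⁻¹ = 1 := by rw [mul_one, mul_inv_cancel]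
  rw [one_smul] at h1
  rw [h4] at h2
  exact h1.symm.trans ((congrArg (fun f => modelDeriv F E f 1) h3).trans h2)

theorem deriv_fundamentalChart (h1 : (1 : G) ∈ θ.target) (hy : y ∈ ψ.source) (T : F) :
    ψ.deriv y (fundamentalChart θ ψ T y) =
      modelAction E F G (ψ.toFun y) (θ.deriv (θ.invFun 1) T) := by
  have hs₀ := LocalParam.inv_mem h1
  have e1 : (fun s => ψ.toFun (actionChart θ ψ (s, y))) =ᶠ[𝓝 (θ.invFun 1)]
      fun s => θ.toFun s • ψ.toFun y := by
    have hc : ContinuousAt (fun t : F => (t, y)) (θ.invFun 1) := by fun_prop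
    filter_upwards [hc.eventually (eventually_action_mem (G := G) hs₀ hy (one_smul_mem h1 hy))]
      with s hs
    exact LocalParam.apply_inv hs.2.2
  have h2 := modelDeriv_comp (E := F) (F := E) (F' := E) (g := ψ.toFun)
    (f := fun s => actionChart θ ψ (s, y)) (x := θ.invFun 1)
    (by rw [actionChart_one h1 hy]; exact LocalParam.mdifferentiableAt hy)
    (hasFDerivAt_actionChart_one h1 hy).differentiableAt.mdifferentiableAt
  have h3 := modelDeriv_comp (E := F) (F := F) (F' := E) (g := fun a : G => a • ψ.toFun y)
    (f := θ.toFun) (x := θ.invFun 1) (mdifferentiableAt_orbit E F _ _)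
    (LocalParam.mdifferentiableAt hs₀)
  rw [modelDeriv_eq_fderiv, (hasFDerivAt_actionChart_one h1 hy).fderiv, actionChart_one h1 hy] at h2
  rw [apply_inv_one h1] at h3
  exact DFunLike.congr_fun (h2.symm.trans ((modelDeriv_congr e1).trans h3)) T

theorem deriv_adjointChart (h1 : (1 : G) ∈ θ.target) (hs : s ∈ θ.source) (T : F) :
    θ.deriv (θ.invFun 1) (adjointChart θ s T) =
      modelAd F (θ.toFun s) (θ.deriv (θ.invFun 1) T) := by
  have hs₀ := LocalParam.inv_mem h1
  have e1 : (fun t => θ.toFun (conjChart θ (s, t))) =ᶠ[𝓝 (θ.invFun 1)]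
      fun t => θ.toFun s * θ.toFun t * (θ.toFun s)⁻¹ := by
    have hc' : ContinuousAt (fun t : F => (s, t)) (θ.invFun 1) := by fun_prop
    filter_upwards [hc'.eventually ((contMDiffAt_conj_param (G := G) hs hs₀).continuousAt.eventually
      (θ.open_target.eventually_mem (conj_one_mem h1 s)))] with t ht
    exact LocalParam.apply_inv ht
  have h0 : HasFDerivAt (fun t => conjChart θ (s, t)) (adjointChart θ s) (θ.invFun 1) :=
    HasFDerivAt.comp (g := conjChart θ) (f := fun t => (s, t)) (θ.invFun 1)
    (conjChart_contDiffAt_one h1 hs).diff.hasFDerivAt (hasFDerivAt_prodMk_right _ _)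
  have h2 := modelDeriv_comp (E := F) (F := F) (F' := F) (g := θ.toFun)
    (f := fun t => conjChart θ (s, t)) (x := θ.invFun 1)
    (by rw [conjChart_one h1]; exact LocalParam.mdifferentiableAt hs₀)
    h0.differentiableAt.mdifferentiableAt
  have h3 := modelDeriv_comp (E := F) (F := F) (F' := F)
    (g := fun b : G => θ.toFun s * b * (θ.toFun s)⁻¹)
    (f := θ.toFun) (x := θ.invFun 1) (mdifferentiableAt_conj F _ _)
    (LocalParam.mdifferentiableAt hs₀)
  rw [modelDeriv_eq_fderiv, h0.fderiv, conjChart_one h1] at h2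
  rw [apply_inv_one h1] at h3
  exact DFunLike.congr_fun (h2.symm.trans ((modelDeriv_congr e1).trans h3)) T

theorem deriv_actionChart (hs : s ∈ θ.source) (hy : y ∈ ψ.source)
    (h : θ.toFun s • ψ.toFun y ∈ ψ.target) (v : E) :
    ψ.deriv (actionChart θ ψ (s, y)) (fderiv ℝ (actionChart θ ψ) (s, y) (0, v)) =
      modelDeriv E E (fun x : N => θ.toFun s • x) (ψ.toFun y) (ψ.deriv y v) := by
  have hy' : actionChart θ ψ (s, y) ∈ ψ.source := LocalParam.inv_mem h
  have e1 : (fun z => ψ.toFun (actionChart θ ψ (s, z))) =ᶠ[𝓝 y]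
      fun z => θ.toFun s • ψ.toFun z := by
    have hc : ContinuousAt (fun z : E => (s, z)) y := by fun_prop
    filter_upwards [hc.eventually (eventually_action_mem (G := G) hs hy h)] with z hz
    exact LocalParam.apply_inv hz.2.2
  have h0 : HasFDerivAt (fun z => actionChart θ ψ (s, z))
      (fderiv ℝ (actionChart θ ψ) (s, y) ∘L ContinuousLinearMap.inr ℝ F E) y :=
    HasFDerivAt.comp (g := actionChart θ ψ) (f := fun z => (s, z)) y
    (actionChart_contDiffAt hs hy h).diff.hasFDerivAt (hasFDerivAt_prodMk_right _ _)
  have h2 := modelDeriv_comp (E := E) (F := E) (F' := E) (g := ψ.toFun)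
    (f := fun z => actionChart θ ψ (s, z)) (x := y)
    (LocalParam.mdifferentiableAt hy') h0.differentiableAt.mdifferentiableAt
  have h3 := modelDeriv_comp (E := E) (F := E) (F' := E)
    (g := fun x : N => θ.toFun s • x)
    (f := ψ.toFun) (x := y) (mdifferentiableAt_translation E F _ _)
    (LocalParam.mdifferentiableAt hy)
  rw [modelDeriv_eq_fderiv, h0.fderiv] at h2
  exact DFunLike.congr_fun (h2.symm.trans ((modelDeriv_congr e1).trans h3)) v

variable [FiniteDimensional ℝ F]

theorem exteriorPower_map_adjointChart (h1 : (1 : G) ∈ θ.target) (hs : s ∈ θ.source)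
    {Q : ⋀[ℝ]^2 F}
    (hQ : ∀ a : G, exteriorPower.map 2 (modelAd F a).toLinearMap Q = Q) :
    exteriorPower.map 2 (adjointChart θ s).toLinearMap (exteriorPower.map 2
      ((θ.derivEquiv (LocalParam.inv_mem h1)).symm : F →L[ℝ] F).toLinearMap Q) =
      exteriorPower.map 2
        ((θ.derivEquiv (LocalParam.inv_mem h1)).symm : F →L[ℝ] F).toLinearMap Q := by
  set e := θ.derivEquiv (LocalParam.inv_mem h1)
  have h : adjointChart θ s ∘L (e.symm : F →L[ℝ] F) =
      (e.symm : F →L[ℝ] F) ∘L modelAd F (θ.toFun s) := by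
    ext T
    refine e.injective ?_
    have h2 := deriv_adjointChart h1 hs (e.symm T)
    have h3 : θ.deriv (θ.invFun 1) (e.symm T) = T := e.apply_symm_apply T
    rw [h3] at h2
    exact h2.trans (e.apply_symm_apply _).symm
  rw [← exteriorPower_map_comp, h, exteriorPower_map_comp, hQ]

/-- An `Ad`-invariant bivector is a sum of products of commuting elements of the Lie algebra. -/
theorem exists_commuting_sum (h1 : (1 : G) ∈ θ.target) {Q : ⋀[ℝ]^2 F}
    (hQ : ∀ a : G, exteriorPower.map 2 (modelAd F a).toLinearMap Q = Q) :
    ∃ (H : Submodule ℝ F) (m : ℕ) (u v : Fin m → F),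
      Q = ∑ r, exteriorPower.ιMulti ℝ 2
        ![θ.deriv (θ.invFun 1) (u r), θ.deriv (θ.invFun 1) (v r)] ∧
      (∀ S ∈ H, ∀ T ∈ H, fderiv ℝ (adjointChart θ) (θ.invFun 1) S T = 0) ∧
      (∀ r, u r ∈ H) ∧ ∀ r, v r ∈ H := by
  have hs₀ := LocalParam.inv_mem h1
  set e := θ.derivEquiv (LocalParam.inv_mem h1) with he
  -- The bivector is transported to coordinates, where the Lie bracket is the derivative of
  -- `adjointChart` and the range lemma applies.
  set Q' : ⋀[ℝ]^2 F := exteriorPower.map 2 (e.symm : F →L[ℝ] F).toLinearMap Q with hQ'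
  obtain ⟨m, u, v, hsum, hu, hv⟩ := bivector_exists_sum_range Q'
  refine ⟨bivectorRange Q', m, u, v, ?_, fun S hS T hT => ?_, hu, hv⟩
  · have h2 : exteriorPower.map 2 (e : F →L[ℝ] F).toLinearMap Q' = Q := by
      rw [hQ', ← exteriorPower_map_comp, ContinuousLinearEquiv.coe_comp_coe_symm]
      exact LinearMap.congr_fun exteriorPower.map_id Q
    rw [← h2, hsum]
    simp only [map_sum, exteriorPower.map_apply_ιMulti]
    refine Finset.sum_congr rfl fun r _ => congrArg _ ?_
    funext i
    fin_cases i <;> rfl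
  · refine invariant_bivector_range_abelian (adjointChart_contDiffAt h1 hs₀).diff
      (adjointChart_one h1) ?_ (fderiv_adjointChart_antisymm h1) hS hT
    filter_upwards [θ.open_source.eventually_mem hs₀] with s hs
    exact exteriorPower_map_adjointChart h1 hs hQ

end ModelAction

/-! ### Descent of the bivector and its adapted frames -/

section Quotient

variable {E : Type*} [NormedAddCommGroup E] [NormedSpace ℝ E] [FiniteDimensional ℝ E]
  {F : Type*} [NormedAddCommGroup F] [NormedSpace ℝ F] [FiniteDimensional ℝ F]
  {M : Type*} [TopologicalSpace M] [ChartedSpace E M] [IsManifold 𝓘(ℝ, E) ∞ M]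
  {N : Type*} [TopologicalSpace N] [ChartedSpace E N] [IsManifold 𝓘(ℝ, E) ∞ N]
  {G : Type*} [TopologicalSpace G] [ChartedSpace F G] [Group G] [LieGroup 𝓘(ℝ, F) ∞ G]
  [MulAction G N] [ContMDiffSMul 𝓘(ℝ, F) 𝓘(ℝ, E) ∞ G N]
  {p : N → M}

/-- A local diffeomorphism transports parametrizations. -/
theorem exists_param_of_isLocalDiffeomorph (hp : IsLocalDiffeomorph 𝓘(ℝ, E) 𝓘(ℝ, E) ∞ p) (x : N) :
    ∃ (ψ : LocalParam E N) (φ : LocalParam E M), p x ∈ φ.target ∧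
      (∀ w ∈ φ.source, w ∈ ψ.source ∧ φ.toFun w = p (ψ.toFun w) ∧
        φ.deriv w = modelDeriv E E p (ψ.toFun w) ∘L ψ.deriv w) := by
  obtain ⟨Φ, hx, hΦ⟩ := hp x
  set ψ : LocalParam E N := chartParam x
  have hψ := mem_chartParam_target (E := E) x
  have hw := LocalParam.inv_mem hψ
  have hsrc : ∀ w ∈ (ψ.trans Φ).source, w ∈ ψ.source ∧ ψ.toFun w ∈ Φ.source := fun w hw => hw
  have heq : ∀ w ∈ (ψ.trans Φ).source, (ψ.trans Φ).toFun w = p (ψ.toFun w) := fun w hw =>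
    (hΦ (hsrc w hw).2).symm
  refine ⟨ψ, ψ.trans Φ, ?_, fun w hw => ⟨(hsrc w hw).1, heq w hw, ?_⟩⟩
  · have hmem : ψ.invFun x ∈ (ψ.trans Φ).source := ⟨hw, by
      change ψ.toFun (ψ.invFun x) ∈ Φ.source
      rwa [LocalParam.apply_inv hψ]⟩
    have := LocalParam.apply_mem hmem
    rwa [heq _ hmem, LocalParam.apply_inv hψ] at this
  · rw [← modelDeriv_comp (E := E) (F := E) (F' := E) (g := p) (f := ψ.toFun)
      (hp.contMDiff.mdifferentiable (by simp) _)
      (LocalParam.mdifferentiableAt (hsrc w hw).1)]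
    exact modelDeriv_congr (((ψ.trans Φ).open_source.eventually_mem hw).mono heq)

/-- The image in `M` of the bivector induced by `Q`. -/
def pushBivector (p : N → M) (G : Type*) [TopologicalSpace G] [ChartedSpace F G] [Group G]
    [MulAction G N] (Q : ⋀[ℝ]^2 F) (x : N) : ⋀[ℝ]^2 E :=
  exteriorPower.map 2 (modelDeriv E E p x ∘L modelAction E F G x).toLinearMap Q

/-- Translation by `a` carries the infinitesimal action at `x` to that at `a • x` up to `Ad a`,
which `Q` absorbs; the projection does not see `a`. -/
theorem pushBivector_smul (hp : IsLocalDiffeomorph 𝓘(ℝ, E) 𝓘(ℝ, E) ∞ p) {Q : ⋀[ℝ]^2 F}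
    (hQ : ∀ a : G, exteriorPower.map 2 (modelAd F a).toLinearMap Q = Q) {a : G}
    (ha : ∀ x, p (a • x) = p x) (x : N) :
    pushBivector (E := E) p G Q (a • x) = pushBivector (E := E) p G Q x := by
  have h1 := modelDeriv_comp (E := E) (F := E) (F' := E) (g := p) (f := fun x : N => a • x) (x := x)
    (hp.contMDiff.mdifferentiable (by simp) _) (mdifferentiableAt_translation E F a x)
  simp only [ha] at h1
  have h2 : modelDeriv E E p x = modelDeriv E E p (a • x) ∘L
    modelDeriv E E (fun x : N => a • x) x := h1
  rw [pushBivector, pushBivector, h2, ContinuousLinearMap.comp_assoc,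
    modelDeriv_translation_comp_modelAction, ← ContinuousLinearMap.comp_assoc,
    exteriorPower_map_comp _ (modelAd F a), hQ]

theorem pushBivector_eq (p : N → M) (Q : ⋀[ℝ]^2 F) (x : N) :
    pushBivector (E := E) p G Q x = exteriorPower.map 2 (modelDeriv E E p x).toLinearMap
      (exteriorPower.map 2 (modelAction E F G x).toLinearMap Q) :=
  exteriorPower_map_comp _ _ Q

/-- If the fibres of `p` are orbits, an invariant bivector induces a bivector field. -/
theorem exists_pushBivector_descent (hp : IsLocalDiffeomorph 𝓘(ℝ, E) 𝓘(ℝ, E) ∞ p) {Γ : Subgroup G}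
    (h_quot : ∀ x y : N, p x = p y ↔ ∃ a ∈ Γ, a • x = y) (hsurj : Function.Surjective p)
    {Q : ⋀[ℝ]^2 F} (hQ : ∀ a : G, exteriorPower.map 2 (modelAd F a).toLinearMap Q = Q) :
    ∃ π : M → ⋀[ℝ]^2 E, ∀ x : N, π (p x) = pushBivector p G Q x := by
  refine ⟨fun x => pushBivector p G Q (Function.surjInv hsurj x), fun x => ?_⟩
  -- The chosen point of the fibre differs from `x` by an element of `Γ`.
  obtain ⟨a, ha, h⟩ := (h_quot x (Function.surjInv hsurj (p x))).1
    (Function.surjInv_eq hsurj (p x)).symm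
  have h2 := pushBivector_smul hp hQ (fun y => ((h_quot y (a • y)).2 ⟨a, ha, rfl⟩).symm) x
  rwa [h] at h2

-- Near a point the parametrization of `M` is `p` after one of the covering space, so both spaces
-- share coordinates. The fundamental fields upstairs then serve as fields on `M`; they are Killing
-- because the action preserves the pulled back metric, and they commute because the elements chosen
-- in the Lie algebra do.
set_option maxHeartbeats 1600000 in
theorem hasAdaptedFrames_of_action {g : PseudoRiemannianMetric E M} {π : M → ⋀[ℝ]^2 E}
    (hp : IsLocalDiffeomorph 𝓘(ℝ, E) 𝓘(ℝ, E) ∞ p) (hsurj : Function.Surjective p)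
    (h_isom : ∀ (a : G) (x : N) (v w : E),
      g.modelVal (p (a • x)) (modelDeriv E E p (a • x) (modelDeriv E E (fun y : N => a • y) x v))
        (modelDeriv E E p (a • x) (modelDeriv E E (fun y : N => a • y) x w)) =
      g.modelVal (p x) (modelDeriv E E p x v) (modelDeriv E E p x w))
    {Q : ⋀[ℝ]^2 F} (hQ : ∀ a : G, exteriorPower.map 2 (modelAd F a).toLinearMap Q = Q)
    (hπ : ∀ x : N, π (p x) = pushBivector (E := E) p G Q x) : HasAdaptedFrames g π := by
  intro x
  obtain ⟨x, rfl⟩ := hsurj x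
  obtain ⟨ψ, φ, hx, hφ⟩ := exists_param_of_isLocalDiffeomorph hp x
  haveI : IsManifold 𝓘(ℝ, F) ∞ G := inferInstance
  obtain ⟨θ, h1⟩ : ∃ θ : LocalParam F G, (1 : G) ∈ θ.target :=
    ⟨chartParam 1, mem_chartParam_target 1⟩
  have hs₀ := LocalParam.inv_mem h1
  obtain ⟨H, m, u, v, hsum, hH, hu, hv⟩ := exists_commuting_sum h1 hQ
  have hpd : ∀ w ∈ φ.source, ∀ z, φ.deriv w z = modelDeriv E E p (ψ.toFun w) (ψ.deriv w z) :=
    fun w hw z => DFunLike.congr_fun (hφ w hw).2.2 z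
  have hG : ∀ w ∈ φ.source, ∀ z z', pullMetric g φ.toFun w z z' =
      g.modelVal (p (ψ.toFun w)) (modelDeriv E E p (ψ.toFun w) (ψ.deriv w z))
        (modelDeriv E E p (ψ.toFun w) (ψ.deriv w z')) := by
    intro w hw z z'
    rw [← (hφ w hw).2.1, ← hpd w hw, ← hpd w hw]
    rfl
  have hK : ∀ w ∈ φ.source, ∀ T, IsKillingAt (pullMetric g φ.toFun) (fundamentalChart θ ψ T) w := by
    intro w hw T
    have hwψ := (hφ w hw).1
    refine fundamentalChart_isKillingAt h1 hwψ (pullMetric_contDiffAt g hw).diff ?_ T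
    have hc : ContinuousAt (fun t : F => (t, w)) (θ.invFun 1) := by fun_prop
    -- The domain of `φ` may be smaller than that of `ψ`, so it must be ensured separately that the
    -- moved point stays in it.
    have hA := (hasFDerivAt_actionChart_one (G := G) h1 hwψ).continuousAt.eventually
      (φ.open_source.eventually_mem (by
        change actionChart θ ψ (θ.invFun 1, w) ∈ φ.source
        rwa [actionChart_one h1 hwψ]))
    filter_upwards [hc.eventually (eventually_action_mem (G := G) hs₀ hwψ (one_smul_mem h1 hwψ)),
      hA] with s hs hsA z z'
    rw [hG _ hsA, hG _ hw, deriv_actionChart hs.1 hs.2.1 hs.2.2, deriv_actionChart hs.1 hs.2.1 hs.2.2]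
    have h2 : ψ.toFun (actionChart θ ψ (s, w)) = θ.toFun s • ψ.toFun w :=
      LocalParam.apply_inv hs.2.2
    rw [h2]
    exact h_isom _ _ _ _
  refine ⟨{
    param := φ
    size := m
    left := fun r => fundamentalChart θ ψ (u r)
    right := fun r => fundamentalChart θ ψ (v r)
    commuting := fun w hw =>
      { smooth_left := fun r => fundamentalChart_contDiffAt h1 (hφ w hw).1 _
        smooth_right := fun r => fundamentalChart_contDiffAt h1 (hφ w hw).1 _
        comm_left := fun r s =>
          fundamentalChart_commute h1 (hφ w hw).1 (hH _ (hu r) _ (hu s))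
        comm_right := fun r s =>
          fundamentalChart_commute h1 (hφ w hw).1 (hH _ (hv r) _ (hv s))
        comm_mixed := fun r s =>
          fundamentalChart_commute h1 (hφ w hw).1 (hH _ (hu r) _ (hv s)) }
    killing_left := fun w hw r => hK w hw _
    killing_right := fun w hw r => hK w hw _
    bivector := fun w hw => ?_ }, hx⟩
  have h3 : π (φ.toFun w) = pushBivector (E := E) p G Q (ψ.toFun w) := by
    rw [(hφ w hw).2.1]
    exact hπ _
  refine h3.trans ?_
  rw [pushBivector, hsum]
  simp only [map_sum, exteriorPower.map_apply_ιMulti]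
  refine Finset.sum_congr rfl fun r _ => congrArg _ ?_
  funext i
  fin_cases i
  · exact ((hpd w hw _).trans (congrArg _ (deriv_fundamentalChart h1 (hφ w hw).1 (u r)))).symm
  · exact ((hpd w hw _).trans (congrArg _ (deriv_fundamentalChart h1 (hφ w hw).1 (v r)))).symm

end Quotient
end

/-! ### The theorem -/

set_option maxHeartbeats 8000000 in
theorem mainTheorem7
    {E : Type*} [NormedAddCommGroup E] [NormedSpace ℝ E] [FiniteDimensional ℝ E]
    {F : Type*} [NormedAddCommGroup F] [NormedSpace ℝ F] [FiniteDimensional ℝ F]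
    -- the manifold `M` with its metric `g`
    {M : Type*} [TopologicalSpace M] [T2Space M] [ChartedSpace E M] [IsManifold 𝓘(ℝ, E) ∞ M]
    (g : PseudoRiemannianMetric E M)
    -- the covering `p : M' → M`
    {M' : Type*} [TopologicalSpace M'] [T2Space M'] [ChartedSpace E M']
    [IsManifold 𝓘(ℝ, E) ∞ M']
    (p : M' → M) (hp_cov : IsCoveringMap p)
    (hp_diffeo : IsLocalDiffeomorph 𝓘(ℝ, E) 𝓘(ℝ, E) ∞ p) (hp_surj : Function.Surjective p)
    -- the Lie group `G`, acting smoothly on `M'` by isometries of the pulled back metric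
    {G : Type*} [TopologicalSpace G] [ChartedSpace F G] [Group G] [LieGroup 𝓘(ℝ, F) ∞ G]
    [MulAction G M'] [ContMDiffSMul 𝓘(ℝ, F) 𝓘(ℝ, E) ∞ G M']
    (h_isom : ∀ (a : G) (x : M') (v w : TangentSpace 𝓘(ℝ, E) x),
      g.pullback p (a • x) (mfderiv 𝓘(ℝ, E) 𝓘(ℝ, E) (fun y : M' => a • y) x v)
        (mfderiv 𝓘(ℝ, E) 𝓘(ℝ, E) (fun y : M' => a • y) x w) = g.pullback p x v w)
    -- `M` is the quotient of `M'` by the subgroup `Γ`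
    (Γ : Subgroup G) (h_quot : ∀ x y : M', p x = p y ↔ ∃ a ∈ Γ, a • x = y)
    -- the invariant Poisson bivector
    (Q : ⋀[ℝ]^2 (GroupLieAlgebra 𝓘(ℝ, F) G))
    (hQ_poisson : (leftInvariantBivector F Q).IsPoisson) (hQ_inv : IsAdInvariant F Q) :
    ∃ π : BivectorField E M,
      (∀ x : M', exteriorPower.map 2
          (mfderiv 𝓘(ℝ, E) 𝓘(ℝ, E) p x).toLinearMap (inducedBivector E F M' Q x) = π (p x)) ∧
      π.IsPoisson ∧ IsCompatible g π := by
  let Q₀ : ⋀[ℝ]^2 F := Q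
  have hQ : ∀ a : G, exteriorPower.map 2 (modelAd F a).toLinearMap Q₀ = Q₀ := hQ_inv
  obtain ⟨π, hπ⟩ := exists_pushBivector_descent hp_diffeo h_quot hp_surj hQ
  have hF := hasAdaptedFrames_of_action hp_diffeo hp_surj h_isom hQ hπ
  refine ⟨π, fun x => ?_, isPoisson_of_adaptedFrames hF, isCompatible_of_adaptedFrames hF⟩
  have h := (pushBivector_eq (E := E) (F := F) (G := G) p Q₀ x).symm.trans (hπ x).symm
  exact h
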